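/- A permutation of length $n\ge 1$ is a linear ordering $\pi(1),\dots,\pi(n)$ of $1,\dots,n$. It contains a permutation $\tau$ of length $k$ if there are indices $1\le i_1<\dots<i_k\le n$ such that $\pi(i_1),\dots,\pi(i_k)$ is in the same relative order as $\tau$; let $\operatorname{Av}(3124,4312)$ be the set of all permutations that contain neither $3124$ nor $4312$. An interval of $\pi$ is a nonempty set $\{i,i+1,\dots,i+k\}$ of consecutive indices whose entries $\{\pi(i),\dots,\pi(i+k)\}$ form a set of consecutive integers; a permutation of length $n$ is simple if its only intervals are those of length $1$ and $n$ (so $1$, $12$ and $21$ are simple). Let $s_n$ be the number of simple permutations of length $n$ in $\operatorname{Av}(3124,4312)$. Theorem. As formal power series, \[ \sum_{n\ge 1} s_n x^n=\frac{x-2x^2-5x^3+12x^4+x^5-8x^6-3x^7}{(1-2x)(1-x-x^2)^2}. \] -/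

import Mathlib

namespace PermPattern

open Equiv (Perm)

/-- A permutation of length `n` is an element of `Perm (Fin n)`; its one-line notation is
`π 0, π 1, …, π (n - 1)`, with positions and values both numbered from `0`.
`Contains τ π` says that some subsequence of the entries of `π` (at the strictly increasing
positions `f 0 < f 1 < …`) is in the same relative order as `τ`. -/
def Contains {k n : ℕ} (τ : Perm (Fin k)) (π : Perm (Fin n)) : Prop :=
  ∃ f : Fin k → Fin n, StrictMono f ∧ ∀ i j, τ i < τ j ↔ π (f i) < π (f j)

/-- A family of sets of permutations, graded by length. -/
abbrev PermSet : Type := (n : ℕ) → Set (Perm (Fin n))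

/-- `Av B` consists of the permutations that contain no element of `B`. -/
def Av (B : Set (Σ k : ℕ, Perm (Fin k))) : PermSet :=
  fun _ => {π | ∀ τ ∈ B, ¬ Contains τ.2 π}

/-- The permutation 3124 (one-line notation `2,0,1,3` when numbered from `0`). -/
def p3124 : Perm (Fin 4) where
  toFun := ![2, 0, 1, 3]
  invFun := ![1, 2, 0, 3]
  left_inv := by decide
  right_inv := by decide

/-- The permutation 4312 (one-line notation `3,2,0,1` when numbered from `0`). -/
def p4312 : Perm (Fin 4) where
  toFun := ![3, 2, 0, 1]
  invFun := ![2, 3, 1, 0]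
  left_inv := by decide
  right_inv := by decide

/-- An interval of `π`: a nonempty set `I = {a, …, b}` of consecutive indices whose entries
form a set `{c, …, d}` of consecutive integers. -/
def IsInterval {n : ℕ} (π : Perm (Fin n)) (I : Finset (Fin n)) : Prop :=
  I.Nonempty ∧ (∃ a b, I = Finset.Icc a b) ∧ ∃ c d, I.image π = Finset.Icc c d

/-- `π` is simple if its only intervals are those of length `1` and `n`. -/
def IsSimple {n : ℕ} (π : Perm (Fin n)) : Prop :=
  ∀ I : Finset (Fin n), IsInterval π I → I.card = 1 ∨ I.card = n

/-- The simple permutations of `C`. -/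
def Si (C : PermSet) : PermSet :=
  fun n => {π | π ∈ C n ∧ IsSimple π}

/-- The generating function `∑_{n ≥ 1} |C n| xⁿ` of a set of permutations, counted by length.
Permutations are nonempty, so the constant term is `0`. -/
noncomputable def genFun (C : PermSet) : PowerSeries ℚ :=
  PowerSeries.mk fun n => if n = 0 then 0 else ((C n).ncard : ℚ)

end PermPattern

/-!
A permutation avoids `3124` and `4312` exactly when, for every `312`-pattern `c … a … b`, each
entry larger than `c` lies between `c` and `b` in position; in particular `c` is then a
left-to-right maximum. For a simple permutation of length at least `3` this pins down the whole
shape.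

* The entries after the minimum decrease: otherwise a maximal stretch of them that cannot be cut
  into a larger left and a smaller right part would be an interval. Those of them that come after
  the maximum too are the entries of kind `E`.
* Among the entries that are not left-to-right maxima and are not of kind `E`, those with no smaller
  such entry before them are of kind `D`; they decrease. The others are of kind `U`. If there is an
  entry of kind `U`, there is exactly one of kind `E`, no two entries of kind `U` are adjacent, and
  they increase and sit directly below the entry of kind `E`.
* The left-to-right maxima that are smaller than the first `D` form an initial segment; they are of
  kind `F`. The remaining left-to-right maxima are of kind `M`.

By simplicity every `E` has an `M` directly above it in value and every `F` has a `D` directly below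
it. So the permutation can be read off from the word that lists the entries of kind `M`, `D`, `U`
from left to right, where a hat on an `M` (or a `D`) records that it has an `E` (or an `F`) next to
it in value. The letters are `m`, `mh`, `d`, `dh`, `u`, and hatted letters have weight `2`.

The words that arise are the *good words* (`GoodWord`), which are described by conditions on
consecutive letters and on which letters can precede which. `Frame.goodWord` and
`exists_goodWord` show that every simple permutation in the class has a good word. Conversely each
word determines a finite set of points with a position and a value, and hence a permutation; if the
word is good, the permutation lies in the class (`Realizes.mem_av`) and is simple
(`Realizes.isSimple`, because a set of at least two points that is convex in both position and value
contains an `E`, then the minimum, then the maximum). The word is unique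
(`Realizes.word_unique`) because the kind of an entry is expressed by the relative order alone.

Good words are the language of a finite automaton (`goodWord_iff`), and solving its transfer
equations gives their generating function by weight (`gf_s0_mul`). The permutations of length `1`
and `2` contribute the remaining `x + 2 x²`.
-/

namespace SimpleAv

/-! ### Words, the automaton and its generating function -/

section

/-- The letters that encode entries: `m` and `mh` stand for a left-to-right maximum without and
with an entry of kind `E` directly below it, `d` and `dh` for an entry of kind `D` without and with
an entry of kind `F` directly above it, and `u` for an entry of kind `U`. -/
inductive Letter
  | m | mh | d | dh | u
  deriving DecidableEq

instance : Fintype Letter where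
  elems := {.m, .mh, .d, .dh, .u}
  complete := by intro x; cases x <;> decide

namespace Letter

/-- The number of entries that a letter accounts for. -/
def wt : Letter → ℕ
  | m => 1 | mh => 2 | d => 1 | dh => 2 | u => 1

end Letter

open Letter

/-- The weight of a word, which is the length of the permutation it encodes. -/
def weight (w : List Letter) : ℕ := (w.map wt).sum

@[simp] lemma weight_nil : weight [] = 0 := rfl
@[simp] lemma weight_cons (a : Letter) (w : List Letter) : weight (a :: w) = wt a + weight w := rfl

lemma wt_pos (a : Letter) : 1 ≤ wt a := by cases a <;> decide

lemma length_le_weight (w : List Letter) : w.length ≤ weight w := by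
  induction w with
  | nil => simp
  | cons a w ih => have := wt_pos a; simp; omega

/-- The states of an automaton that reads a word from left to right.

Before the first `d`: `s0` nothing has been read, `am` only `m`, `a1` only `mh`, `a1'` only `m mh`,
and in `a2` there are at least two letters `mh`. The state `a1d` is reached by `mh d` alone.
After a `d` and before any `u`: the digit is the number of letters `mh` (with `2` for two or more),
and the last letter is a `d` or `dh` for the suffix `d`, an `m` for the suffix `m`, and an `mh` for
the suffix `h`. After a `u`: the last letter is `u` in `pu`, and `d` or `dh` in `pd`.
No good word leads to `dead`. -/
inductive State
  | s0 | am | a1 | a1' | a2 | a1d | b1d | b1m | b2d | b2m | b2h | pu | pd | dead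

open State

/-- The transition function of the automaton. -/
def step : State → Letter → State
  | s0, m => am
  | s0, mh => a1
  | am, mh => a1'
  | a1, mh => a2
  | a1, d => a1d
  | a1', mh => a2
  | a1', d => b1d
  | a2, mh => a2
  | a2, d => b2d
  | a1d, dh => b1d
  | a1d, m => b1m
  | a1d, mh => b2h
  | b1d, dh => b1d
  | b1d, m => b1m
  | b1d, mh => b2h
  | b1d, u => pu
  | b1m, d => b1d
  | b1m, dh => b1d
  | b1m, mh => b2h
  | b1m, u => pu
  | b2d, dh => b2d
  | b2d, m => b2m
  | b2d, mh => b2h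
  | b2m, d => b2d
  | b2m, dh => b2d
  | b2m, mh => b2h
  | b2h, d => b2d
  | b2h, dh => b2d
  | b2h, mh => b2h
  | pu, d => pd
  | pu, dh => pd
  | pd, dh => pd
  | pd, u => pu
  | _, _ => dead

/-- The accepting states. A good word ends in `m`, `d` or `dh`, and `mh d` is not good. -/
def Final : State → Prop
  | b1d => True | b1m => True | b2d => True | b2m => True | pd => True | _ => False

lemma foldl_step_dead (w : List Letter) : w.foldl step dead = dead := by
  induction w with
  | nil => rfl
  | cons a w ih => simpa [step] using ih

/-- The words of weight `n` that are accepted when starting in the state `s`. -/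
def acceptedSet (s : State) (n : ℕ) : Set (List Letter) :=
  {w | Final (w.foldl step s) ∧ weight w = n}

lemma finite_weight (n : ℕ) : {w : List Letter | weight w = n}.Finite :=
  (List.finite_length_le Letter n).subset fun w hw => by
    have := length_le_weight w
    simp only [Set.mem_ofPred_eq] at hw ⊢
    omega

lemma finite_acceptedSet (s : State) (n : ℕ) : (acceptedSet s n).Finite :=
  (finite_weight n).subset fun _ hw => hw.2

/-- The number of words of weight `n` that are accepted from the state `s`. -/
noncomputable def cnt (s : State) (n : ℕ) : ℕ := (acceptedSet s n).ncard

/-- The generating function, by weight, of the words accepted from the state `s`. -/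
noncomputable def gf (s : State) : PowerSeries ℚ := PowerSeries.mk fun n => (cnt s n : ℚ)

lemma acceptedSet_dead (n : ℕ) : acceptedSet dead n = ∅ := by
  ext w; simp [acceptedSet, foldl_step_dead, Final]

@[simp] lemma gf_dead : gf dead = 0 := by
  ext n; simp [gf, cnt, acceptedSet_dead]

lemma ncard_cons (a : Letter) (s : State) (n : ℕ) :
    ((List.cons a) '' acceptedSet (step s a) n).ncard = cnt (step s a) n :=
  Set.ncard_image_of_injective _ (List.cons_injective)

lemma acceptedSet_add_two (s : State) (n : ℕ) :
    acceptedSet s (n + 2) = ((List.cons m) '' acceptedSet (step s m) (n + 1)) ∪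
      (((List.cons d) '' acceptedSet (step s d) (n + 1)) ∪
      (((List.cons u) '' acceptedSet (step s u) (n + 1)) ∪
      (((List.cons mh) '' acceptedSet (step s mh) n) ∪
      ((List.cons dh) '' acceptedSet (step s dh) n)))) := by
  ext w
  rcases w with _ | ⟨a, w⟩
  · simp [acceptedSet]
  · cases a <;> simp [acceptedSet, wt] <;> intro _ <;> omega

lemma acceptedSet_one (s : State) :
    acceptedSet s 1 = ((List.cons m) '' acceptedSet (step s m) 0) ∪
      (((List.cons d) '' acceptedSet (step s d) 0) ∪
      ((List.cons u) '' acceptedSet (step s u) 0)) := by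
  ext w
  rcases w with _ | ⟨a, w⟩
  · simp [acceptedSet]
  · cases a <;> simp [acceptedSet, wt] <;> intro _ <;> omega

lemma disjoint_cons {a : Letter} {s : State} {n : ℕ} {T : Set (List Letter)}
    (h : ∀ w, a :: w ∉ T) : Disjoint ((List.cons a) '' acceptedSet s n) T := by
  rw [Set.disjoint_left]
  rintro _ ⟨w, _, rfl⟩
  exact h w

lemma cnt_add_two (s : State) (n : ℕ) :
    cnt s (n + 2) = cnt (step s m) (n + 1) + (cnt (step s d) (n + 1) + (cnt (step s u) (n + 1)
      + (cnt (step s mh) n + cnt (step s dh) n))) := by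
  have hf := fun a k => (finite_acceptedSet (step s a) k).image (List.cons a)
  rw [cnt, acceptedSet_add_two,
    Set.ncard_union_eq (disjoint_cons (by simp)) (hf _ _)
      ((hf _ _).union ((hf _ _).union ((hf _ _).union (hf _ _)))),
    Set.ncard_union_eq (disjoint_cons (by simp)) (hf _ _)
      ((hf _ _).union ((hf _ _).union (hf _ _))),
    Set.ncard_union_eq (disjoint_cons (by simp)) (hf _ _) ((hf _ _).union (hf _ _)),
    Set.ncard_union_eq (disjoint_cons (by simp)) (hf _ _) (hf _ _)]
  simp only [ncard_cons]

lemma cnt_one (s : State) :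
    cnt s 1 = cnt (step s m) 0 + (cnt (step s d) 0 + cnt (step s u) 0) := by
  have hf := fun a k => (finite_acceptedSet (step s a) k).image (List.cons a)
  rw [cnt, acceptedSet_one,
    Set.ncard_union_eq (disjoint_cons (by simp)) (hf _ _) ((hf _ _).union (hf _ _)),
    Set.ncard_union_eq (disjoint_cons (by simp)) (hf _ _) (hf _ _)]
  simp only [ncard_cons]

lemma weight_eq_zero (w : List Letter) : weight w = 0 ↔ w = [] := by
  constructor
  · intro h
    have := length_le_weight w
    exact List.length_eq_zero_iff.1 (by omega)
  · rintro rfl; rfl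

lemma cnt_zero_of_final {s : State} (h : Final s) : cnt s 0 = 1 := by
  have : acceptedSet s 0 = {[]} := by
    ext w
    simp only [acceptedSet, weight_eq_zero, Set.mem_ofPred_eq, Set.mem_singleton_iff]
    exact ⟨fun h => h.2, fun hw => ⟨by subst hw; exact h, hw⟩⟩
  simp [cnt, this]

lemma cnt_zero_of_not_final {s : State} (h : ¬ Final s) : cnt s 0 = 0 := by
  have : acceptedSet s 0 = ∅ := by
    ext w
    simp only [acceptedSet, weight_eq_zero, Set.mem_ofPred_eq, Set.mem_empty_iff_false, iff_false]
    rintro ⟨h1, rfl⟩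
    exact h h1
  simp [cnt, this]

open PowerSeries in
/-- The transfer equation of a state, from removing the first letter of an accepted word. -/
lemma gf_eq (s : State) :
    gf s = C (cnt s 0 : ℚ) + X * (gf (step s m) + gf (step s d) + gf (step s u)) +
      X ^ 2 * (gf (step s mh) + gf (step s dh)) := by
  ext n
  rcases n with _ | _ | n
  · simp [gf]
  · rw [map_add, map_add, PowerSeries.coeff_C, coeff_succ_X_mul, coeff_X_pow_mul']
    simp [gf, cnt_one]; ring
  · rw [map_add, map_add, PowerSeries.coeff_C, coeff_succ_X_mul, pow_two, mul_assoc,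
      coeff_succ_X_mul, coeff_succ_X_mul]
    simp [gf, cnt_add_two]; ring

open PowerSeries in
lemma gf_final {s : State} (h : Final s) :
    gf s = 1 + X * (gf (step s m) + gf (step s d) + gf (step s u)) +
      X ^ 2 * (gf (step s mh) + gf (step s dh)) := by
  rw [gf_eq, cnt_zero_of_final h]; simp

open PowerSeries in
lemma gf_not_final {s : State} (h : ¬ Final s) :
    gf s = X * (gf (step s m) + gf (step s d) + gf (step s u)) +
      X ^ 2 * (gf (step s mh) + gf (step s dh)) := by
  rw [gf_eq, cnt_zero_of_not_final h]; simp

open PowerSeries in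
/-- The generating function of the accepted words, in the form in which it is used: the right-hand
side is the numerator of the enumeration of simple permutations minus the contribution
`X + 2 * X ^ 2` of the lengths `1` and `2`. -/
lemma gf_s0_mul :
    gf s0 * ((1 - 2 * X) * (1 - X - X ^ 2) ^ 2) =
      (X - 2 * X ^ 2 - 5 * X ^ 3 + 12 * X ^ 4 + X ^ 5 - 8 * X ^ 6 - 3 * X ^ 7)
        - (X + 2 * X ^ 2) * ((1 - 2 * X) * (1 - X - X ^ 2) ^ 2) := by
  have e0 := gf_not_final (s := s0) (by simp [Final])
  have e1 := gf_not_final (s := am) (by simp [Final])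
  have e2 := gf_not_final (s := a1) (by simp [Final])
  have e3 := gf_not_final (s := a1') (by simp [Final])
  have e4 := gf_not_final (s := a2) (by simp [Final])
  have e5 := gf_not_final (s := a1d) (by simp [Final])
  have e6 := gf_final (s := b1d) (by simp [Final])
  have e7 := gf_final (s := b1m) (by simp [Final])
  have e8 := gf_final (s := b2d) (by simp [Final])
  have e9 := gf_final (s := b2m) (by simp [Final])
  have e10 := gf_not_final (s := b2h) (by simp [Final])
  have e11 := gf_not_final (s := pu) (by simp [Final])
  have e12 := gf_final (s := pd) (by simp [Final])
  simp only [step, gf_dead, add_zero, zero_add] at e0 e1 e2 e3 e4 e5 e6 e7 e8 e9 e10 e11 e12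
  have hX : (1 + X : PowerSeries ℚ) ≠ 0 := by
    intro h
    have := congrArg (PowerSeries.coeff 0) h
    simp at this
  have hX' : (1 - X : PowerSeries ℚ) ≠ 0 := by
    intro h
    have := congrArg (PowerSeries.coeff 0) h
    simp at this
  generalize (X : PowerSeries ℚ) = x at *
  -- Eliminate the states backwards, from the accepting end to the start. Power series form a
  -- domain, so the common factors `1 + x` and `1 - x` that turn up can be cancelled.
  have k1 : gf b2m = gf b2d := mul_left_cancel₀ hX (by linear_combination e9 - e8)
  have k2 : gf b2h * (1 - x) = x * gf b2d :=
    mul_left_cancel₀ hX (by linear_combination e10)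
  have k3 : gf b2d * (1 - 2 * x) = 1 - x := by
    linear_combination (1 - x) * e8 + x * (1 - x) * k1 + x ^ 2 * k2
  have k4 : gf b2h * (1 - 2 * x) = x :=
    mul_left_cancel₀ hX' (by linear_combination (1 - 2 * x) * k2 + x * k3)
  have k5 : gf b1m = gf b1d := mul_left_cancel₀ hX (by linear_combination e7 - e6)
  have k6 : gf pd * (1 + x) * (1 - x - x ^ 2) = 1 := by
    linear_combination e12 + x * e11
  have k7 : 1 + x * gf pu = gf pd * (1 - x ^ 2) := by linear_combination -e12
  have k8 : gf b1d * (1 - x - x ^ 2) = gf pd * (1 - x ^ 2) + x ^ 2 * gf b2h := by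
    linear_combination e6 + x * k5 + k7
  have k9 : gf b1d * ((1 - 2 * x) * (1 - x - x ^ 2) ^ 2) =
      (1 - x) * (1 - 2 * x) + x ^ 3 * (1 - x - x ^ 2) := by
    linear_combination (1 - 2 * x) * (1 - x - x ^ 2) * k8 + (1 - 2 * x) * (1 - x) * k6
      + x ^ 2 * (1 - x - x ^ 2) * k4
  have k10 : gf a1d = gf b1d - gf pd * (1 - x ^ 2) := by
    linear_combination e5 - e6 - k7
  have k11 : gf a2 * (1 + x) * (1 - 2 * x) = x :=
    mul_left_cancel₀ hX' (by linear_combination (1 - 2 * x) * e4 + x * k3)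
  have k12 : gf s0 = x ^ 4 * gf b1d + x ^ 3 * gf a1d + x ^ 4 * ((1 + x) * gf a2) := by
    linear_combination e0 + x * e1 + x ^ 3 * e3 + x ^ 2 * e2
  linear_combination ((1 - 2 * x) * (1 - x - x ^ 2) ^ 2) * k12 + (x ^ 4 + x ^ 3) * k9
    + x ^ 3 * ((1 - 2 * x) * (1 - x - x ^ 2) ^ 2) * k10
    - x ^ 3 * (1 - x) * (1 - 2 * x) * (1 - x - x ^ 2) * k6
    + x ^ 4 * (1 - x - x ^ 2) ^ 2 * k11

end

/-! ### Good words are the words accepted by the automaton -/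

section

open Letter State

/-- The words that encode simple permutations in the class. Writing "an `M`" for a letter `m` or
`mh` and "a `D`" for a letter `d` or `dh`: the first letter is an `M`; a later `m` directly follows
a `D`; a `d` never directly follows a `D`; a `u` is directly followed by a `D`; the letters `dh`
and `u` occur only after a `d`; no `M` follows a `u`; and if there is a `u`, then there is only one
`mh`. The word does not begin with `m d` or `mh d u`, it ends in `m` or a `D`, it contains a `d`,
and it is not the word `mh d`, whose permutation `312` is not simple. -/
structure GoodWord (w : List Letter) : Prop where
  first : w[0]? = some m ∨ w[0]? = some mh
  m_prev : ∀ j : ℕ, w[j + 1]? = some m → w[j]? = some d ∨ w[j]? = some dh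
  d_prev : ∀ j : ℕ, w[j + 1]? = some d → ¬ (w[j]? = some d ∨ w[j]? = some dh)
  u_next : ∀ j : ℕ, w[j]? = some u → w[j + 1]? = some d ∨ w[j + 1]? = some dh
  dh_after : ∀ j : ℕ, w[j]? = some dh → ∃ i < j, w[i]? = some d
  u_after : ∀ j : ℕ, w[j]? = some u → ∃ i < j, w[i]? = some d
  u_last : ∀ i j : ℕ, w[i]? = some u → i < j → ¬ (w[j]? = some m ∨ w[j]? = some mh)
  u_mh : ∀ j i k : ℕ, w[j]? = some u → w[i]? = some mh → w[k]? = some mh → i = k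
  not_md : w[0]? = some m → w[1]? ≠ some d
  not_mdu : w[0]? = some mh → w[1]? = some d → w[2]? ≠ some u
  last : ∃ l : ℕ, w.length = l + 1 ∧ (w[l]? = some d ∨ w[l]? = some dh ∨ w[l]? = some m)
  exists_d : ∃ j : ℕ, w[j]? = some d
  ne_md : w ≠ [mh, d]

/-- Whether a `d` has been read. -/
def hasD : State → Prop
  | a1d => True | b1d => True | b1m => True | b2d => True | b2m => True | b2h => True
  | pu => True | pd => True | _ => False

/-- Whether a `u` has been read. -/
def hasU : State → Prop
  | pu => True | pd => True | _ => False

/-- The number of letters `mh` read, cut off at `2`. The values at states reached after a `u` and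
at `dead` are `1`: a `u` requires exactly one `mh`, and `dead` plays no role. -/
def hats : State → ℕ
  | s0 => 0 | am => 0 | a2 => 2 | b2d => 2 | b2m => 2 | b2h => 2 | _ => 1

/-- The class (see `letterCls`) of the last letter read, and `0` if there is none. -/
def cls : State → ℕ
  | am => 1 | b1m => 1 | b2m => 1
  | a1 => 4 | a1' => 4 | a2 => 4 | b2h => 4
  | a1d => 2 | b1d => 2 | b2d => 2 | pd => 2
  | pu => 3 | _ => 0

/-- Letters up to the distinction between `d` and `dh`, which does not affect what may follow. -/
def letterCls : Letter → ℕ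
  | m => 1 | mh => 4 | d => 2 | dh => 2 | u => 3

lemma step_features {s : State} {a : Letter} (h : step s a ≠ dead) :
    (hasD (step s a) ↔ hasD s ∨ a = d) ∧ (hasU (step s a) ↔ hasU s ∨ a = u) ∧
      hats (step s a) = (if a = mh then min 2 (hats s + 1) else hats s) ∧
      cls (step s a) = letterCls a := by
  cases s <;> cases a <;> simp_all [step, hasD, hasU, hats, cls, letterCls]

/-- Which letters the automaton allows in a state, in terms of the features of the state. -/
lemma step_ne_dead_iff (s : State) (a : Letter) : step s a ≠ dead ↔ s ≠ dead ∧
    ((a = m → s = s0 ∨ (cls s = 2 ∧ ¬ hasU s)) ∧ (a = mh → ¬ hasU s) ∧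
     (a = d → (cls s = 1 ∨ cls s = 3 ∨ cls s = 4) ∧ s ≠ am) ∧ (a = dh → hasD s) ∧
     (a = u → hasD s ∧ hats s = 1 ∧ cls s ≠ 3 ∧ s ≠ a1d)) := by
  cases s <;> cases a <;> simp [step, hasD, hasU, hats, cls]

lemma final_iff (s : State) : Final s ↔ hasD s ∧ s ≠ a1d ∧ (cls s = 2 ∨ cls s = 1) := by
  cases s <;> simp [Final, hasD, cls]

lemma step_eq_am (s : State) (a : Letter) : step s a = am ↔ s = s0 ∧ a = m := by
  cases s <;> cases a <;> simp [step]

lemma step_eq_a1 (s : State) (a : Letter) : step s a = a1 ↔ s = s0 ∧ a = mh := by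
  cases s <;> cases a <;> simp [step]

lemma step_eq_c (s : State) (a : Letter) : step s a = a1d ↔ s = a1 ∧ a = d := by
  cases s <;> cases a <;> simp [step]

lemma step_ne_s0 (s : State) (a : Letter) : step s a ≠ s0 := by
  cases s <;> cases a <;> simp [step]

/-- The state reached after the first `j` letters. -/
def stateAt (w : List Letter) (j : ℕ) : State := (w.take j).foldl step s0

@[simp] lemma stateAt_zero (w : List Letter) : stateAt w 0 = s0 := by simp [stateAt]

lemma stateAt_succ {w : List Letter} {j : ℕ} {a : Letter} (h : w[j]? = some a) :
    stateAt w (j + 1) = step (stateAt w j) a := by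
  rw [stateAt, List.take_add_one, h, List.foldl_append]
  simp [stateAt]

lemma exists_letter {w : List Letter} {j : ℕ} (h : j < w.length) : ∃ a, w[j]? = some a :=
  ⟨w[j], List.getElem?_eq_getElem h⟩

lemma lt_length {w : List Letter} {j : ℕ} {a : Letter} (h : w[j]? = some a) : j < w.length := by
  by_contra hc
  rw [List.getElem?_eq_none (by omega)] at h
  simp at h

lemma stateAt_ne_dead {w : List Letter} (h : stateAt w w.length ≠ dead) {j : ℕ}
    (hj : j ≤ w.length) : stateAt w j ≠ dead := by
  intro hd
  apply h
  rw [stateAt, ← List.take_append_drop j (w.take w.length), List.foldl_append]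
  rw [List.take_take, min_eq_left hj]
  rw [show (w.take j).foldl step s0 = stateAt w j from rfl, hd, foldl_step_dead]

/-- What the state after `j` letters remembers of these letters, as long as it is not `dead`. -/
lemma stateAt_features {w : List Letter} {j : ℕ} (hj : j ≤ w.length)
    (h : ∀ i ≤ j, stateAt w i ≠ dead) :
    (hasD (stateAt w j) ↔ ∃ i < j, w[i]? = some d) ∧
    (hasU (stateAt w j) ↔ ∃ i < j, w[i]? = some u) ∧
    (hats (stateAt w j) = 0 ↔ ∀ i < j, w[i]? ≠ some mh) ∧
    (hats (stateAt w j) ≤ 1 ↔ ∀ i k : ℕ, i < k → k < j → w[i]? = some mh → w[k]? ≠ some mh) := by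
  induction j with
  | zero => simp [hasD, hasU, hats]
  | succ j ih =>
    obtain ⟨i1, i2, i3, i4⟩ := ih (by omega) fun i hi => h i (by omega)
    obtain ⟨a, ha⟩ := exists_letter (w := w) (j := j) (by omega)
    have hd := h (j + 1) le_rfl
    rw [stateAt_succ ha] at hd ⊢
    obtain ⟨f1, f2, f3, -⟩ := step_features hd
    refine ⟨?_, ?_, ?_, ?_⟩
    · rw [f1, i1]
      constructor
      · rintro (⟨i, hi, h'⟩ | rfl)
        · exact ⟨i, by omega, h'⟩
        · exact ⟨j, by omega, ha⟩
      · rintro ⟨i, hi, h'⟩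
        rcases Nat.lt_succ_iff_lt_or_eq.1 hi with hi | rfl
        · exact Or.inl ⟨i, hi, h'⟩
        · right; simpa [ha] using h'
    · rw [f2, i2]
      constructor
      · rintro (⟨i, hi, h'⟩ | rfl)
        · exact ⟨i, by omega, h'⟩
        · exact ⟨j, by omega, ha⟩
      · rintro ⟨i, hi, h'⟩
        rcases Nat.lt_succ_iff_lt_or_eq.1 hi with hi | rfl
        · exact Or.inl ⟨i, hi, h'⟩
        · right; simpa [ha] using h'
    · rw [f3]
      by_cases hm : a = mh
      · subst hm
        simp only [if_true]
        constructor
        · intro hh; omega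
        · intro hh; exact absurd ha (hh j (by omega))
      · rw [if_neg hm, i3]
        constructor
        · intro hh i hi
          rcases Nat.lt_succ_iff_lt_or_eq.1 hi with hi | rfl
          · exact hh i hi
          · simpa [ha] using hm
        · intro hh i hi
          exact hh i (by omega)
    · rw [f3]
      by_cases hm : a = mh
      · subst hm
        simp only [if_true]
        have : min 2 (hats (stateAt w j) + 1) ≤ 1 ↔ hats (stateAt w j) = 0 := by omega
        rw [this, i3]
        constructor
        · intro hh i k hik hk hi
          exact absurd hi (hh i (by omega))
        · intro hh i hi hmi
          exact hh i j hi (by omega) hmi ha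
      · rw [if_neg hm, i4]
        constructor
        · intro hh i k hik hk hi
          rcases Nat.lt_succ_iff_lt_or_eq.1 hk with hk | rfl
          · exact hh i k hik hk hi
          · simpa [ha] using hm
        · intro hh i k hik hk hi
          exact hh i k hik (by omega) hi

lemma stateAt_eq_s0 {w : List Letter} {j : ℕ} (hj : j ≤ w.length) :
    stateAt w j = s0 ↔ j = 0 := by
  rcases j with _ | j
  · simp
  · obtain ⟨a, ha⟩ := exists_letter (w := w) (j := j) (by omega)
    simp [stateAt_succ ha, step_ne_s0]

lemma stateAt_eq_am {w : List Letter} {j : ℕ} (hj : j ≤ w.length) :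
    stateAt w j = am ↔ j = 1 ∧ w[0]? = some m := by
  rcases j with _ | j
  · simp
  · obtain ⟨a, ha⟩ := exists_letter (w := w) (j := j) (by omega)
    rw [stateAt_succ ha, step_eq_am, stateAt_eq_s0 (by omega)]
    constructor
    · rintro ⟨rfl, rfl⟩; exact ⟨rfl, ha⟩
    · rintro ⟨h1, h2⟩
      obtain rfl : j = 0 := by omega
      simp_all

lemma stateAt_eq_c {w : List Letter} {j : ℕ} (hj : j ≤ w.length) :
    stateAt w j = a1d ↔ j = 2 ∧ w[0]? = some mh ∧ w[1]? = some d := by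
  rcases j with _ | _ | j
  · simp
  · obtain ⟨a, ha⟩ := exists_letter (w := w) (j := 0) (by omega)
    rw [stateAt_succ ha, step_eq_c]
    simp
  · obtain ⟨a, ha⟩ := exists_letter (w := w) (j := j + 1) (by omega)
    obtain ⟨b, hb⟩ := exists_letter (w := w) (j := j) (by omega)
    rw [stateAt_succ ha, step_eq_c, stateAt_succ hb, step_eq_a1, stateAt_eq_s0 (by omega)]
    constructor
    · rintro ⟨⟨rfl, rfl⟩, rfl⟩; exact ⟨rfl, hb, ha⟩
    · rintro ⟨h1, h2, h3⟩
      obtain rfl : j = 0 := by omega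
      simp_all

lemma stateAt_length (w : List Letter) : stateAt w w.length = w.foldl step s0 := by
  simp [stateAt]

lemma eq_pair {w : List Letter} (hl : w.length = 2) {a b : Letter} (h0 : w[0]? = some a)
    (h1 : w[1]? = some b) : w = [a, b] := by
  match w, hl with
  | [x, y], _ => simp_all

lemma GoodWord.alive {w : List Letter} (hw : GoodWord w) {j : ℕ} (hj : j ≤ w.length) :
    stateAt w j ≠ dead := by
  induction j using Nat.strong_induction_on with
  | _ j ih =>
  rcases j with _ | j
  · simp
  have alive : ∀ i ≤ j, stateAt w i ≠ dead := fun i hi => ih i (by omega) (by omega)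
  obtain ⟨f1, f2, f3, f4⟩ := stateAt_features (by omega) alive
  obtain ⟨a, ha⟩ := exists_letter (w := w) (j := j) (by omega)
  rw [stateAt_succ ha, step_ne_dead_iff]
  have hcls : ∀ (i : ℕ) (b : Letter), j = i + 1 → w[i]? = some b →
      cls (stateAt w j) = letterCls b := by
    intro i b hi hb
    have := alive j le_rfl
    subst hi
    rw [stateAt_succ hb] at this ⊢
    exact (step_features this).2.2.2
  have hU : (w[j]? = some m ∨ w[j]? = some mh) → ¬ hasU (stateAt w j) := by
    rw [f2]
    rintro h ⟨i, hi, hu⟩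
    exact hw.u_last i j hu hi h
  refine ⟨alive j le_rfl, ?_, ?_, ?_, ?_, ?_⟩
  · rintro rfl
    rcases j with _ | i
    · left; simp
    · right
      refine ⟨?_, hU (Or.inl ha)⟩
      rcases hw.m_prev i ha with h | h <;> rw [hcls i _ rfl h] <;> rfl
  · rintro rfl
    exact hU (Or.inr ha)
  · rintro rfl
    rcases j with _ | i
    · have := hw.first
      simp [ha] at this
    · obtain ⟨b, hb⟩ := exists_letter (w := w) (j := i) (by omega)
      refine ⟨?_, ?_⟩
      · rw [hcls i _ rfl hb]
        have := hw.d_prev i ha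
        cases b <;> simp_all [letterCls]
      · rw [Ne, stateAt_eq_am (by omega)]
        rintro ⟨h1, h2⟩
        obtain rfl : i = 0 := by omega
        exact hw.not_md h2 ha
  · rintro rfl
    rw [f1]
    exact hw.dh_after j ha
  · rintro rfl
    refine ⟨f1.2 (hw.u_after j ha), ?_, ?_, ?_⟩
    · have h1 : hats (stateAt w j) ≤ 1 := f4.2 fun i k hik _ hi hk => by
        have := hw.u_mh j i k ha hi hk
        omega
      have h0 : hats (stateAt w j) ≠ 0 := by
        rw [Ne, f3]
        intro hno
        obtain ⟨i, hi, hd⟩ := hw.u_after j ha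
        -- Without an `mh` the word would start with `m`, and only `mh` can follow that.
        have hfirst := hw.first.resolve_right (hno 0 (by omega))
        have hmh : w[1]? = some mh := by
          obtain ⟨b, hb⟩ := exists_letter (w := w) (j := 1) (by omega)
          cases b
          · have := hw.m_prev 0 hb
            simp [hfirst] at this
          · exact hb
          · exact absurd hb (hw.not_md hfirst)
          · obtain ⟨i', hi', hd'⟩ := hw.dh_after 1 hb
            obtain rfl : i' = 0 := by omega
            simp [hfirst] at hd'
          · obtain ⟨i', hi', hd'⟩ := hw.u_after 1 hb
            obtain rfl : i' = 0 := by omega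
            simp [hfirst] at hd'
        rcases Nat.lt_or_ge 1 j with h | h
        · exact hno 1 h hmh
        · obtain rfl : j = 1 := by omega
          exact absurd (ha.symm.trans hmh) (by simp)
      omega
    · rcases j with _ | i
      · simp [cls]
      · obtain ⟨b, hb⟩ := exists_letter (w := w) (j := i) (by omega)
        rw [hcls i _ rfl hb]
        have := hw.u_next i
        cases b <;> simp_all [letterCls]
    · rw [Ne, stateAt_eq_c (by omega)]
      rintro ⟨rfl, h1, h2⟩
      exact hw.not_mdu h1 h2 ha

lemma final_of_goodWord {w : List Letter} (hw : GoodWord w) : Final (w.foldl step s0) := by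
  have alive : ∀ i ≤ w.length, stateAt w i ≠ dead := fun i hi => hw.alive hi
  obtain ⟨f1, -⟩ := stateAt_features le_rfl alive
  rw [← stateAt_length, final_iff]
  refine ⟨?_, ?_, ?_⟩
  · obtain ⟨j, hj⟩ := hw.exists_d
    exact f1.2 ⟨j, lt_length hj, hj⟩
  · rw [Ne, stateAt_eq_c le_rfl]
    rintro ⟨h1, h2, h3⟩
    exact hw.ne_md (eq_pair h1 h2 h3)
  · obtain ⟨l, hl, h⟩ := hw.last
    have hne := alive _ le_rfl
    rw [hl] at hne ⊢
    rcases h with h | h | h <;> rw [stateAt_succ h] at hne ⊢ <;>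
      rw [(step_features hne).2.2.2] <;> simp [letterCls]

lemma goodWord_of_final {w : List Letter} (hf : Final (w.foldl step s0)) : GoodWord w := by
  have hne : stateAt w w.length ≠ dead := by
    rw [stateAt_length]; intro h; rw [h] at hf; exact hf
  have alive : ∀ i ≤ w.length, stateAt w i ≠ dead := fun i hi => stateAt_ne_dead hne hi
  have feat := fun j (hj : j ≤ w.length) => stateAt_features hj fun i hi => alive i (by omega)
  have ok : ∀ (j : ℕ) (a : Letter), w[j]? = some a → _ := fun j a h =>
    ((step_ne_dead_iff (stateAt w j) a).1
      (by rw [← stateAt_succ h]; exact alive _ (lt_length h))).2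
  have hcls : ∀ (i : ℕ) (b : Letter), w[i]? = some b → cls (stateAt w (i + 1)) = letterCls b := by
    intro i b hb
    have := alive (i + 1) (lt_length hb)
    rw [stateAt_succ hb] at this ⊢
    exact (step_features this).2.2.2
  rw [← stateAt_length, final_iff] at hf
  obtain ⟨hD, hc, hlast⟩ := hf
  have hpos : 0 < w.length := by
    rcases Nat.eq_zero_or_pos w.length with h | h
    · rw [h] at hD; simp [hasD] at hD
    · exact h
  have noU : ∀ i j : ℕ, w[i]? = some u → i < j → j ≤ w.length → hasU (stateAt w j) :=
    fun i j hu hij hj => ((feat j hj).2.1).2 ⟨i, hij, hu⟩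
  constructor
  · obtain ⟨a, ha⟩ := exists_letter hpos
    have h1 := ok 0 a ha
    rw [stateAt_zero] at h1
    rw [ha]
    cases a <;> simp [cls, hasD] at h1 ⊢
  · intro j h
    obtain ⟨b, hb⟩ := exists_letter (w := w) (j := j) (by have := lt_length h; omega)
    have h1 := (ok _ _ h).1 rfl
    rw [stateAt_eq_s0 (lt_length h).le, hcls j b hb] at h1
    have h2 := (h1.resolve_left (by omega)).1
    rw [hb]
    cases b <;> simp [letterCls] at h2 ⊢
  · intro j h hb
    have h1 := ((ok _ _ h).2.2.1 rfl).1
    rcases hb with hb | hb <;> rw [hcls j _ hb] at h1 <;> simp [letterCls] at h1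
  · intro j h
    have hj := lt_length h
    rcases Nat.lt_or_ge (j + 1) w.length with hj' | hj'
    · obtain ⟨b, hb⟩ := exists_letter hj'
      have h1 := ok _ _ hb
      have h2 := noU j (j + 1) h (by omega) (by omega)
      have h3 := hcls j _ h
      rw [hb]
      rw [h3, stateAt_eq_s0 (by omega)] at h1
      cases b <;> simp [letterCls, h2] at h1 ⊢
    · have : w.length = j + 1 := by omega
      rw [this, hcls j _ h] at hlast
      simp [letterCls] at hlast
  · intro j h
    exact (feat j (lt_length h).le).1.1 ((ok _ _ h).2.2.2.1 rfl)
  · intro j h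
    exact (feat j (lt_length h).le).1.1 ((ok _ _ h).2.2.2.2 rfl).1
  · intro i j h hij hm
    rcases hm with hm | hm
    · have h1 := (ok _ _ hm).1 rfl
      rw [stateAt_eq_s0 (lt_length hm).le] at h1
      rcases h1 with h1 | h1
      · omega
      · exact h1.2 (noU i j h hij (lt_length hm).le)
    · exact (ok _ _ hm).2.1 rfl (noU i j h hij (lt_length hm).le)
  · have key : ∀ j i k : ℕ, w[j]? = some u → w[i]? = some mh → w[k]? = some mh → ¬ i < k := by
      intro j i k hj hi hk hik
      have h1 := ((ok _ _ hj).2.2.2.2 rfl).2.1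
      have h2 := ((feat j (lt_length hj).le).2.2.2).1 (by omega)
      rcases lt_trichotomy k j with h | h | h
      · exact h2 i k hik h hi hk
      · subst h; simp [hj] at hk
      · exact (ok _ _ hk).2.1 rfl (noU j k hj h (lt_length hk).le)
    intro j i k hj hi hk
    have h1 := key j i k hj hi hk
    have h2 := key j k i hj hk hi
    omega
  · intro h0 h1
    have := ((ok _ _ h1).2.2.1 rfl).2
    rw [Ne, stateAt_eq_am (lt_length h1).le] at this
    exact this ⟨rfl, h0⟩
  · intro h0 h1 h2
    have := ((ok _ _ h2).2.2.2.2 rfl).2.2.2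
    rw [Ne, stateAt_eq_c (lt_length h2).le] at this
    exact this ⟨rfl, h0, h1⟩
  · obtain ⟨l, hl⟩ : ∃ l, w.length = l + 1 := ⟨w.length - 1, by omega⟩
    refine ⟨l, hl, ?_⟩
    obtain ⟨b, hb⟩ := exists_letter (w := w) (j := l) (by omega)
    rw [hl, hcls l b hb] at hlast
    rw [hb]
    cases b <;> simp [letterCls] at hlast ⊢
  · obtain ⟨i, -, hi⟩ := (feat _ le_rfl).1.1 hD
    exact ⟨i, hi⟩
  · rintro rfl
    simp [stateAt, step] at hc

lemma goodWord_iff (w : List Letter) : GoodWord w ↔ Final (w.foldl step s0) :=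
  ⟨final_of_goodWord, goodWord_of_final⟩

lemma ncard_goodWord (n : ℕ) : {w | GoodWord w ∧ weight w = n}.ncard = cnt s0 n := by
  simp only [goodWord_iff]
  rfl

end

/-! ### From words to permutations -/

section

open Letter
open Equiv (Perm)

/-- The kinds of entries: `M` for the left-to-right maxima of the main block, `D` and `U` for its
other entries (those with no smaller, respectively some smaller entry before them that is not a
left-to-right maximum), `E` for the decreasing entries after the main block, `F` for the
left-to-right maxima before it. -/
inductive Kind
  | M | D | U | E | F
  deriving DecidableEq

open Kind

/-- The kinds of the entries that a letter stands for. -/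
def kinds : Letter → Finset Kind
  | m => {M} | mh => {M, E} | d => {D} | dh => {D, F} | u => {U}

lemma card_kinds (a : Letter) : (kinds a).card = wt a := by cases a <;> rfl

/-- A point: an entry, named by the index of its letter in the word and by its kind. -/
abbrev Pt : Type := Σ _ : ℕ, Kind

/-- The kinds of the entries that belong to the letter with index `j`; none if `j` is too large. -/
def kindsAt (w : List Letter) (j : ℕ) : Finset Kind :=
  match w[j]? with
  | some a => kinds a
  | none => ∅

/-- The set of points of a word. -/
def pts (w : List Letter) : Finset Pt := (Finset.range w.length).sigma (kindsAt w)

lemma sum_card_kindsAt (w : List Letter) :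
    ∑ j ∈ Finset.range w.length, (kindsAt w j).card = weight w := by
  induction w with
  | nil => rfl
  | cons a w ih =>
    rw [List.length_cons, Finset.sum_range_succ', weight_cons, ← ih, add_comm]
    congr 1
    simp [kindsAt, card_kinds]

lemma card_pts (w : List Letter) : (pts w).card = weight w := by
  rw [pts, Finset.card_sigma, sum_card_kindsAt]

lemma mem_pts {w : List Letter} {j : ℕ} {κ : Kind} : (⟨j, κ⟩ : Pt) ∈ pts w ↔ κ ∈ kindsAt w j := by
  simp only [pts, Finset.mem_sigma, Finset.mem_range, and_iff_right_iff_imp]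
  intro h
  by_contra hc
  simp [kindsAt, List.getElem?_eq_none (not_lt.1 hc)] at h

lemma mem_pts_M {w : List Letter} {j : ℕ} :
    (⟨j, M⟩ : Pt) ∈ pts w ↔ w[j]? = some m ∨ w[j]? = some mh := by
  rw [mem_pts, kindsAt]
  rcases w[j]? with _ | a
  · simp
  · cases a <;> simp [kinds]

lemma mem_pts_D {w : List Letter} {j : ℕ} :
    (⟨j, D⟩ : Pt) ∈ pts w ↔ w[j]? = some d ∨ w[j]? = some dh := by
  rw [mem_pts, kindsAt]
  rcases w[j]? with _ | a
  · simp
  · cases a <;> simp [kinds]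

lemma mem_pts_U {w : List Letter} {j : ℕ} : (⟨j, U⟩ : Pt) ∈ pts w ↔ w[j]? = some u := by
  rw [mem_pts, kindsAt]
  rcases w[j]? with _ | a
  · simp
  · cases a <;> simp [kinds]

lemma mem_pts_E {w : List Letter} {j : ℕ} : (⟨j, E⟩ : Pt) ∈ pts w ↔ w[j]? = some mh := by
  rw [mem_pts, kindsAt]
  rcases w[j]? with _ | a
  · simp
  · cases a <;> simp [kinds]

lemma mem_pts_F {w : List Letter} {j : ℕ} : (⟨j, F⟩ : Pt) ∈ pts w ↔ w[j]? = some dh := by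
  rw [mem_pts, kindsAt]
  rcases w[j]? with _ | a
  · simp
  · cases a <;> simp [kinds]

lemma lt_of_mem_pts {w : List Letter} {j : ℕ} {κ : Kind} (h : (⟨j, κ⟩ : Pt) ∈ pts w) :
    j < w.length := by
  simp only [pts, Finset.mem_sigma, Finset.mem_range] at h
  exact h.1

/-- The position of a point, up to order isomorphism. The main block occupies the indices of the
word; the points of kind `E` follow it and those of kind `F` precede it, both in the reverse order
of their letters. -/
def pos (w : List Letter) : Pt → ℤ
  | ⟨j, M⟩ => j
  | ⟨j, D⟩ => j
  | ⟨j, U⟩ => j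
  | ⟨j, E⟩ => 2 * w.length - j
  | ⟨j, F⟩ => -1 - j

/-- The value of a point, up to order isomorphism. Values of kind `M` increase from left to right
above `0`, and those of kind `D` decrease below `0`. An `E` is directly below its `M` and an `F`
directly above its `D`. The points of kind `U` increase and are directly below the `E` of the first
letter `mh`: their second coordinates are indices, hence smaller than the length of the word, which
is the second coordinate of an `E`. -/
def val (w : List Letter) : Pt → ℤ ×ₗ ℤ
  | ⟨j, M⟩ => toLex (2 * j + 1, 0)
  | ⟨j, D⟩ => toLex (-2 * j - 2, 0)
  | ⟨j, U⟩ => toLex (2 * (w.idxOf mh : ℕ), j)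
  | ⟨j, E⟩ => toLex (2 * j, w.length)
  | ⟨j, F⟩ => toLex (-2 * j - 1, 0)

lemma pos_injOn (w : List Letter) : Set.InjOn (pos w) (pts w : Set Pt) := by
  rintro ⟨i, κ⟩ hx ⟨j, κ'⟩ hy h
  rw [Finset.mem_coe] at hx hy
  have hi := lt_of_mem_pts hx
  have hj := lt_of_mem_pts hy
  cases κ <;> cases κ' <;> simp only [pos] at h <;>
    first
    | (exfalso; omega)
    | (obtain rfl : i = j := by omega
       first
       | rfl
       | (rw [mem_pts, kindsAt] at hx hy
          revert hx hy
          rcases w[i]? with _ | a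
          · simp
          · cases a <;> simp [kinds]))

lemma val_injOn (w : List Letter) : Set.InjOn (val w) (pts w : Set Pt) := by
  rintro ⟨i, κ⟩ hx ⟨j, κ'⟩ hy h
  rw [Finset.mem_coe] at hx hy
  have hi := lt_of_mem_pts hx
  have hj := lt_of_mem_pts hy
  cases κ <;> cases κ' <;> simp only [val, EmbeddingLike.apply_eq_iff_eq, Prod.mk.injEq] at h <;>
    first
    | (exfalso; omega)
    | (obtain rfl : i = j := by omega
       rfl)

/-- A finite set listed in increasing order of an injective key. -/
lemma exists_enumeration {α β : Type*} [LinearOrder β] (s : Finset α) (k : α → β)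
    (hk : Set.InjOn k (s : Set α)) {n : ℕ} (hn : s.card = n) :
    ∃ g : Fin n → α, (∀ i, g i ∈ s) ∧ (∀ x ∈ s, ∃ i, g i = x) ∧ StrictMono (k ∘ g) := by
  classical
  have hc : (s.image k).card = n := by rw [Finset.card_image_of_injOn hk, hn]
  have hex : ∀ i : Fin n, ∃ x ∈ s, k x = (s.image k).orderEmbOfFin hc i := fun i => by
    exact Finset.mem_image.1 (Finset.orderEmbOfFin_mem (s.image k) hc i)
  choose g hg hkg using hex
  refine ⟨g, hg, fun x hx => ?_, fun i j hij => ?_⟩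
  · have : k x ∈ Set.range ((s.image k).orderEmbOfFin hc) := by
      rw [Finset.range_orderEmbOfFin]
      simpa using ⟨x, hx, rfl⟩
    obtain ⟨i, hi⟩ := this
    exact ⟨i, hk (hg i) hx (by rw [hkg, hi])⟩
  · simpa [hkg] using hij

/-- `π` is the permutation of the word `w`: its entries correspond to the points of `w` by a
bijection that preserves the order of positions and the order of values. -/
def Realizes {n : ℕ} (π : Perm (Fin n)) (w : List Letter) : Prop :=
  ∃ g : Fin n → Pt, (∀ i, g i ∈ pts w) ∧ (∀ x ∈ pts w, ∃ i, g i = x) ∧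
    StrictMono (pos w ∘ g) ∧ ∀ i j, π i < π j → val w (g i) < val w (g j)

lemma exists_realizes {w : List Letter} {n : ℕ} (hn : weight w = n) :
    ∃ π : Perm (Fin n), Realizes π w := by
  obtain ⟨g, g1, g2, g3⟩ := exists_enumeration (pts w) (pos w) (pos_injOn w)
    (n := n) (by rw [card_pts, hn])
  obtain ⟨f, f1, f2, f3⟩ := exists_enumeration (pts w) (val w) (val_injOn w)
    (n := n) (by rw [card_pts, hn])
  choose π hπ using fun i => f2 (g i) (g1 i)
  have hinj : Function.Injective π := by
    intro i j hij
    have : g i = g j := by rw [← hπ i, ← hπ j, hij]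
    exact g3.injective (by simp [this])
  refine ⟨Equiv.ofBijective π (Finite.injective_iff_bijective.1 hinj), g, g1, g2, g3, ?_⟩
  intro i j hij
  rw [← hπ i, ← hπ j]
  exact f3 hij

lemma Realizes.weight_eq {n : ℕ} {π : Perm (Fin n)} {w : List Letter} (h : Realizes π w) :
    weight w = n := by
  obtain ⟨g, g1, g2, g3, -⟩ := h
  have hg : Function.Injective g := fun i j hij => g3.injective (by simp [hij])
  rw [← card_pts]
  have : pts w = Finset.univ.image g := by
    ext x
    simp only [Finset.mem_image, Finset.mem_univ, true_and]
    exact ⟨g2 x, by rintro ⟨i, rfl⟩; exact g1 i⟩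
  rw [this, Finset.card_image_of_injective _ hg]
  simp

lemma perm_eq_of_lt_imp {n : ℕ} {π σ : Perm (Fin n)} (h : ∀ i j, π i < π j → σ i < σ j) :
    π = σ := by
  have h1 : StrictMono fun i => σ (π.symm i) := fun i j hij => h _ _ (by simpa using hij)
  have h2 : (fun i => σ (π.symm i)) = id := by
    refine (StrictMono.range_inj h1 strictMono_id).1 ?_
    rw [Set.range_id, Set.range_eq_univ]
    exact σ.surjective.comp π.symm.surjective
  ext i
  have := congrFun h2 (π i)
  simp at this
  rw [this]

lemma Realizes.perm_unique {n : ℕ} {π σ : Perm (Fin n)} {w : List Letter} (h : Realizes π w)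
    (h' : Realizes σ w) : π = σ := by
  obtain ⟨g, g1, g2, g3, g4⟩ := h
  obtain ⟨f, f1, f2, f3, f4⟩ := h'
  have hr : pos w ∘ g = pos w ∘ f := by
    refine (StrictMono.range_inj g3 f3).1 ?_
    ext z
    constructor
    · rintro ⟨i, rfl⟩
      obtain ⟨j, hj⟩ := f2 _ (g1 i)
      exact ⟨j, by simp [hj]⟩
    · rintro ⟨i, rfl⟩
      obtain ⟨j, hj⟩ := g2 _ (f1 i)
      exact ⟨j, by simp [hj]⟩
  have hgf : ∀ i, g i = f i := fun i => pos_injOn w (g1 i) (f1 i) (congrFun hr i)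
  refine perm_eq_of_lt_imp fun i j hij => ?_
  have h1 := g4 i j hij
  rw [hgf, hgf] at h1
  rcases lt_trichotomy (σ i) (σ j) with h | h | h
  · exact h
  · rw [σ.injective h] at h1; exact absurd h1 (lt_irrefl _)
  · exact absurd (f4 _ _ h) h1.asymm

end

/-! ### Permutations of good words avoid the patterns and are simple -/

section

open Letter Kind
open Equiv (Perm)

section
variable {w : List Letter}

/-- The letter with index `j` stands for a point of kind `M`. -/
abbrev MAt (w : List Letter) (j : ℕ) : Prop := w[j]? = some m ∨ w[j]? = some mh

/-- The letter with index `j` stands for a point of kind `D`. -/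
abbrev DAt (w : List Letter) (j : ℕ) : Prop := w[j]? = some d ∨ w[j]? = some dh

lemma letter_cases {j : ℕ} (hj : j < w.length) : MAt w j ∨ DAt w j ∨ w[j]? = some u := by
  obtain ⟨a, ha⟩ := exists_letter hj
  cases a <;> simp [MAt, DAt, ha]

lemma not_mAt_of_dAt {j : ℕ} (h : DAt w j) : ¬ MAt w j := by
  rcases h with h | h <;> simp only [MAt, h] <;> simp

lemma idxOf_mh_le {j : ℕ} (hj : w[j]? = some mh) : w.idxOf mh ≤ j := by
  by_contra hc
  have := List.not_of_lt_findIdx (p := (· == mh)) (not_le.1 hc)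
  rw [List.getElem?_eq_getElem (lt_length hj)] at hj
  simp at hj
  simp [hj] at this

/-- In a good word the first letter that is not `m` or `mh` is a `d`. -/
lemma GoodWord.exists_first_d (hw : GoodWord w) : ∃ j₀ : ℕ, w[j₀]? = some d ∧
    (∀ i < j₀, MAt w i) ∧ (∀ i, DAt w i → j₀ ≤ i) ∧ (∀ i : ℕ, w[i]? = some dh → j₀ < i) ∧
    ∀ i : ℕ, w[i]? = some u → j₀ < i := by
  classical
  have hex := hw.exists_d
  have hmin : ∀ i : ℕ, w[i]? = some d → Nat.find hex ≤ i := fun i hi => Nat.find_min' hex hi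
  have hdh : ∀ i : ℕ, w[i]? = some dh → Nat.find hex < i := fun i hi => by
    obtain ⟨k, hk, hkd⟩ := hw.dh_after i hi
    exact (hmin k hkd).trans_lt hk
  have hu : ∀ i : ℕ, w[i]? = some u → Nat.find hex < i := fun i hi => by
    obtain ⟨k, hk, hkd⟩ := hw.u_after i hi
    exact (hmin k hkd).trans_lt hk
  refine ⟨Nat.find hex, Nat.find_spec hex, fun i hi => ?_, ?_, hdh, hu⟩
  · have hl := lt_length (Nat.find_spec hex)
    rcases letter_cases (w := w) (j := i) (by omega) with h | (h | h) | h
    · exact h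
    · have := hmin i h; omega
    · have := hdh i h; omega
    · have := hu i h; omega
  · rintro i (h | h)
    · exact hmin i h
    · exact (hdh i h).le

/-- A good word begins with `mh` or with `m mh`. -/
lemma GoodWord.first_mh (hw : GoodWord w) {j₀ : ℕ} (hj₀ : w[j₀]? = some d)
    (hbefore : ∀ i < j₀, MAt w i) :
    w[w.idxOf mh]? = some mh ∧ (∀ j : ℕ, w[j]? = some mh → w.idxOf mh ≤ j) ∧ w.idxOf mh < j₀ ∧
    (w.idxOf mh = 0 ∨ w.idxOf mh = 1 ∧ w[0]? = some m) := by
  have hfirst : ∀ j : ℕ, w[j]? = some mh → w.idxOf mh ≤ j := fun j hj => idxOf_mh_le hj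
  have hmem : ∀ j : ℕ, w[j]? = some mh → w[w.idxOf mh]? = some mh := by
    intro j hj
    have : mh ∈ w := List.mem_of_getElem? hj
    rw [List.getElem?_eq_getElem (List.idxOf_lt_length_iff.2 this)]
    simp
  have hpos : 0 < j₀ := by
    rcases Nat.eq_zero_or_pos j₀ with rfl | h
    · have := hw.first; simp [hj₀] at this
    · exact h
  rcases hw.first with h0 | h0
  · have h1 : 1 < j₀ := by
      rcases Nat.lt_or_ge 1 j₀ with h | h
      · exact h
      · obtain rfl : j₀ = 1 := by omega
        exact absurd hj₀ (hw.not_md h0)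
    have h1' : w[1]? = some mh := by
      rcases hbefore 1 h1 with h | h
      · have := hw.m_prev 0 h
        simp [h0] at this
      · exact h
    have h2 := hfirst 1 h1'
    have h3 := hmem 1 h1'
    refine ⟨h3, hfirst, by omega, ?_⟩
    rcases Nat.eq_zero_or_pos (w.idxOf mh) with h | h
    · rw [h, h0] at h3; simp at h3
    · exact Or.inr ⟨by omega, h0⟩
  · have h2 := hfirst 0 h0
    exact ⟨hmem 0 h0, hfirst, by omega, Or.inl (by omega)⟩

/-- In the permutation of a good word, the first entry of a `312`-pattern is of kind `M` and the
last one is of kind `U` or `E`. -/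
lemma pattern_312 (hw : GoodWord w) {c a b : Pt} (hc : c ∈ pts w) (ha : a ∈ pts w) (hb : b ∈ pts w)
    (h1 : pos w c < pos w a) (h2 : pos w a < pos w b) (h3 : val w a < val w b)
    (h4 : val w b < val w c) :
    ∃ i, c = ⟨i, M⟩ ∧ ((∃ k, b = ⟨k, U⟩ ∧ w.idxOf mh ≤ i) ∨ ∃ k, b = ⟨k, E⟩ ∧ k ≤ i) := by
  obtain ⟨i, κc⟩ := c
  obtain ⟨j, κa⟩ := a
  obtain ⟨k, κb⟩ := b
  have hi := lt_of_mem_pts hc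
  have hj := lt_of_mem_pts ha
  have hk := lt_of_mem_pts hb
  have hmu : ∀ p q, (⟨p, M⟩ : Pt) ∈ pts w → (⟨q, U⟩ : Pt) ∈ pts w → p < q := by
    intro p q hp hq
    rw [mem_pts_M] at hp
    rw [mem_pts_U] at hq
    by_contra hlt
    rcases Nat.lt_or_ge q p with h | h
    · exact hw.u_last q p hq h hp
    · obtain rfl : p = q := by omega
      simp [hq] at hp
  cases κc <;> cases κa <;> cases κb <;>
    simp only [val, pos, Prod.Lex.toLex_lt_toLex] at h1 h2 h3 h4 <;>
    first
    | (exfalso; omega)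
    | exact ⟨i, rfl, Or.inl ⟨k, rfl, by omega⟩⟩
    | exact ⟨i, rfl, Or.inr ⟨k, rfl, by omega⟩⟩
    | (have := hmu _ _ hb hc; exfalso; omega)
    | (have := hmu _ _ ha hc; exfalso; omega)
    | (have := idxOf_mh_le (mem_pts_E.1 hb); exfalso; omega)

/-- The condition on `312`-patterns that is equivalent to avoiding `3124` and `4312`. -/
lemma between_of_pattern_312 (hw : GoodWord w) {c a b s : Pt} (hc : c ∈ pts w) (ha : a ∈ pts w)
    (hb : b ∈ pts w) (hs : s ∈ pts w) (h1 : pos w c < pos w a) (h2 : pos w a < pos w b)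
    (h3 : val w a < val w b) (h4 : val w b < val w c) (h5 : val w c < val w s) :
    pos w c < pos w s ∧ pos w s < pos w b := by
  obtain ⟨i, rfl, hb'⟩ := pattern_312 hw hc ha hb h1 h2 h3 h4
  obtain ⟨k, κ⟩ := s
  have hk := lt_of_mem_pts hs
  have hi := lt_of_mem_pts hc
  rcases hb' with ⟨l, rfl, hl⟩ | ⟨l, rfl, hl⟩
  · have hl' := lt_of_mem_pts hb
    rw [mem_pts_U] at hb
    cases κ <;> simp only [val, pos, Prod.Lex.toLex_lt_toLex] at h1 h2 h3 h4 h5 ⊢ <;>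
      try omega
    · have : ¬ l < k := fun h => hw.u_last l k hb h (mem_pts_M.1 hs)
      have : l ≠ k := by rintro rfl; have := mem_pts_M.1 hs; simp [hb] at this
      omega
    · have hk := mem_pts_E.1 hs
      obtain ⟨j₀, hj₀, hbefore, -⟩ := hw.exists_first_d
      have := hw.u_mh l k _ hb hk (hw.first_mh hj₀ hbefore).1
      omega
  · have hl' := lt_of_mem_pts hb
    cases κ <;> simp only [val, pos, Prod.Lex.toLex_lt_toLex] at h1 h2 h3 h4 h5 ⊢ <;>
      try omega
    have hk' := mem_pts_U.1 hs
    have : ¬ k < i := fun h => hw.u_last k i hk' h (mem_pts_M.1 hc)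
    have : k ≠ i := by rintro rfl; have := mem_pts_M.1 hc; simp [hk'] at this
    omega

end

open PermPattern in
lemma Realizes.mem_av {n : ℕ} {π : Perm (Fin n)} {w : List Letter} (h : Realizes π w)
    (hw : GoodWord w) : π ∈ Av {⟨4, p3124⟩, ⟨4, p4312⟩} n := by
  obtain ⟨g, g1, g2, g3, g4⟩ := h
  rintro τ hτ ⟨f, hf, hfτ⟩
  simp only [Set.mem_insert_iff, Set.mem_singleton_iff] at hτ
  have hp : ∀ i j, i < j → pos w (g (f i)) < pos w (g (f j)) := fun i j hij => g3 (hf hij)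
  rcases hτ with rfl | rfl
  · have hv : ∀ i j : Fin 4, p3124 i < p3124 j → val w (g (f i)) < val w (g (f j)) :=
      fun i j hij => g4 _ _ ((hfτ i j).1 hij)
    have := between_of_pattern_312 hw (g1 (f 0)) (g1 (f 1)) (g1 (f 2)) (g1 (f 3))
      (hp 0 1 (by decide)) (hp 1 2 (by decide)) (hv 1 2 (by decide)) (hv 2 0 (by decide))
      (hv 0 3 (by decide))
    exact absurd this.2 (hp 2 3 (by decide)).asymm
  · have hv : ∀ i j : Fin 4, p4312 i < p4312 j → val w (g (f i)) < val w (g (f j)) :=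
      fun i j hij => g4 _ _ ((hfτ i j).1 hij)
    have := between_of_pattern_312 hw (g1 (f 1)) (g1 (f 2)) (g1 (f 3)) (g1 (f 0))
      (hp 1 2 (by decide)) (hp 2 3 (by decide)) (hv 2 3 (by decide)) (hv 3 1 (by decide))
      (hv 1 0 (by decide))
    exact absurd this.1 (hp 0 1 (by decide)).asymm

section
variable {w : List Letter} {S : Set Pt}

lemma GoodWord.pos_of_not_mAt (hw : GoodWord w) {i : ℕ} (h : ¬ MAt w i) : 0 < i := by
  rcases Nat.eq_zero_or_pos i with rfl | h'
  · exact absurd hw.first h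
  · exact h'

/-- A set of points of `w` that is convex both in position and in value. -/
structure Biconvex (w : List Letter) (S : Set Pt) : Prop where
  sub : ∀ x ∈ S, x ∈ pts w
  pos_between : ∀ x ∈ S, ∀ y ∈ S, ∀ z ∈ pts w, pos w x < pos w z → pos w z < pos w y → z ∈ S
  val_between : ∀ x ∈ S, ∀ y ∈ S, ∀ z ∈ pts w, val w x < val w z → val w z < val w y → z ∈ S

namespace Biconvex

variable (hS : Biconvex w S) (hw : GoodWord w)

include hS hw in
lemma of_DM {i j : ℕ} (hi : (⟨i, D⟩ : Pt) ∈ S) (hj : (⟨j, M⟩ : Pt) ∈ S) :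
    ∃ e, (⟨e, E⟩ : Pt) ∈ S := by
  obtain ⟨j₀, hj₀, hbefore, hD, -⟩ := hw.exists_first_d
  obtain ⟨h1, h2, h3, h4⟩ := hw.first_mh hj₀ hbefore
  have hi0 := hD i (mem_pts_D.1 (hS.sub _ hi))
  have hM : ∃ k, w.idxOf mh ≤ k ∧ (⟨k, M⟩ : Pt) ∈ S := by
    rcases Nat.lt_or_ge j (w.idxOf mh) with h | h
    · refine ⟨_, le_rfl, hS.pos_between _ hj _ hi _ (mem_pts_M.2 (Or.inr h1)) ?_ ?_⟩ <;>
        simp only [pos] <;> omega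
    · exact ⟨j, h, hj⟩
  obtain ⟨k, hk, hkS⟩ := hM
  refine ⟨_, hS.val_between _ hi _ hkS _ (mem_pts_E.2 h1) ?_ ?_⟩ <;>
    simp only [val, Prod.Lex.toLex_lt_toLex] <;> omega

include hS hw in
lemma of_FM {i j : ℕ} (hi : (⟨i, F⟩ : Pt) ∈ S) (hj : (⟨j, M⟩ : Pt) ∈ S) :
    ∃ e, (⟨e, E⟩ : Pt) ∈ S := by
  obtain ⟨j₀, hj₀, hbefore, hD, hdh, -⟩ := hw.exists_first_d
  have hi0 := hdh i (mem_pts_F.1 (hS.sub _ hi))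
  refine hS.of_DM hw (i := j₀) (hS.val_between _ hi _ hj _ (mem_pts_D.2 (Or.inl hj₀)) ?_ ?_) hj <;>
    simp only [val, Prod.Lex.toLex_lt_toLex] <;> omega

include hS hw in
lemma of_MM {i j : ℕ} (hij : i < j) (hi : (⟨i, M⟩ : Pt) ∈ S) (hj : (⟨j, M⟩ : Pt) ∈ S) :
    ∃ e, (⟨e, E⟩ : Pt) ∈ S := by
  rcases mem_pts_M.1 (hS.sub _ hj) with h | h
  · obtain ⟨k, rfl⟩ : ∃ k, j = k + 1 := ⟨j - 1, by omega⟩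
    have hk := hw.m_prev k h
    have hik : i ≠ k := by
      rintro rfl
      exact not_mAt_of_dAt hk (mem_pts_M.1 (hS.sub _ hi))
    refine hS.of_DM hw (i := k) (hS.pos_between _ hi _ hj _ (mem_pts_D.2 hk) ?_ ?_) hj <;>
      simp only [pos] <;> omega
  · refine ⟨j, hS.val_between _ hi _ hj _ (mem_pts_E.2 h) ?_ ?_⟩ <;>
      simp only [val, Prod.Lex.toLex_lt_toLex] <;> omega

include hS hw in
lemma of_FD {i j : ℕ} (hi : (⟨i, F⟩ : Pt) ∈ S) (hj : (⟨j, D⟩ : Pt) ∈ S) :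
    ∃ e, (⟨e, E⟩ : Pt) ∈ S := by
  have hj0 : 0 < j := hw.pos_of_not_mAt (by
    rcases mem_pts_D.1 (hS.sub _ hj) with h | h <;> simp [MAt, h])
  refine hS.of_DM hw hj (j := 0) (hS.pos_between _ hi _ hj _ (mem_pts_M.2 hw.first) ?_ ?_) <;>
    simp only [pos] <;> omega

include hS hw in
lemma of_FF {i j : ℕ} (hij : i < j) (hi : (⟨i, F⟩ : Pt) ∈ S) (hj : (⟨j, F⟩ : Pt) ∈ S) :
    ∃ e, (⟨e, E⟩ : Pt) ∈ S := by
  refine hS.of_FD hw (j := i) hi (hS.val_between _ hj _ hi _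
    (mem_pts_D.2 (Or.inr (mem_pts_F.1 (hS.sub _ hi)))) ?_ ?_) <;>
    simp only [val, Prod.Lex.toLex_lt_toLex] <;> omega

include hS hw in
lemma of_UM {k j : ℕ} (hk : (⟨k, U⟩ : Pt) ∈ S) (hj : (⟨j, M⟩ : Pt) ∈ S) :
    ∃ e, (⟨e, E⟩ : Pt) ∈ S := by
  obtain ⟨j₀, hj₀, hbefore, hD, hdh, hu⟩ := hw.exists_first_d
  obtain ⟨h1, h2, h3, h4⟩ := hw.first_mh hj₀ hbefore
  have hkL := lt_of_mem_pts (hS.sub _ hk)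
  have hk0 := hu k (mem_pts_U.1 (hS.sub _ hk))
  have hM : ∃ l, w.idxOf mh ≤ l ∧ (⟨l, M⟩ : Pt) ∈ S := by
    rcases Nat.lt_or_ge j (w.idxOf mh) with h | h
    · refine ⟨_, le_rfl, hS.pos_between _ hj _ hk _ (mem_pts_M.2 (Or.inr h1)) ?_ ?_⟩ <;>
        simp only [pos] <;> omega
    · exact ⟨j, h, hj⟩
  obtain ⟨l, hl, hlS⟩ := hM
  refine ⟨_, hS.val_between _ hk _ hlS _ (mem_pts_E.2 h1) ?_ ?_⟩ <;>
    simp only [val, Prod.Lex.toLex_lt_toLex, true_and] <;> omega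

include hS hw in
lemma of_UF {k j : ℕ} (hk : (⟨k, U⟩ : Pt) ∈ S) (hj : (⟨j, F⟩ : Pt) ∈ S) :
    ∃ e, (⟨e, E⟩ : Pt) ∈ S := by
  have hk0 : 0 < k := hw.pos_of_not_mAt (by simp [MAt, mem_pts_U.1 (hS.sub _ hk)])
  refine hS.of_UM hw hk (j := 0) (hS.pos_between _ hj _ hk _ (mem_pts_M.2 hw.first) ?_ ?_) <;>
    simp only [pos] <;> omega

include hS hw in
lemma of_UD {k i : ℕ} (hk : (⟨k, U⟩ : Pt) ∈ S) (hi : (⟨i, D⟩ : Pt) ∈ S) :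
    ∃ e, (⟨e, E⟩ : Pt) ∈ S := by
  obtain ⟨j₀, hj₀, hbefore, hD, hdh, hu⟩ := hw.exists_first_d
  obtain ⟨h1, h2, h3, h4⟩ := hw.first_mh hj₀ hbefore
  have hku := mem_pts_U.1 (hS.sub _ hk)
  have hkL := lt_length hku
  have hk0 := hu k hku
  have hi0 := hD i (mem_pts_D.1 (hS.sub _ hi))
  rcases h4 with h4 | ⟨h4, h0⟩
  · have hd0 : (⟨j₀, D⟩ : Pt) ∈ S := by
      rcases Nat.lt_or_ge j₀ i with h | h
      · refine hS.val_between _ hi _ hk _ (mem_pts_D.2 (Or.inl hj₀)) ?_ ?_ <;>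
          simp only [val, Prod.Lex.toLex_lt_toLex] <;> omega
      · obtain rfl : i = j₀ := by omega
        exact hi
    by_cases hMex : ∃ t, j₀ < t ∧ t < k ∧ MAt w t
    · obtain ⟨t, ht1, ht2, ht⟩ := hMex
      refine hS.of_DM hw hi (j := t) (hS.pos_between _ hd0 _ hk _ (mem_pts_M.2 ht) ?_ ?_) <;>
        simp only [pos] <;> omega
    by_cases hFex : ∃ t : ℕ, j₀ < t ∧ t < k ∧ w[t]? = some dh
    · obtain ⟨t, ht1, ht2, ht⟩ := hFex
      have htD : (⟨t, D⟩ : Pt) ∈ S := by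
        refine hS.pos_between _ hd0 _ hk _ (mem_pts_D.2 (Or.inr ht)) ?_ ?_ <;>
          simp only [pos] <;> omega
      refine hS.of_FD hw (i := t) (hS.val_between _ htD _ hd0 _ (mem_pts_F.2 ht) ?_ ?_) htD <;>
        simp only [val, Prod.Lex.toLex_lt_toLex] <;> omega
    -- Only letters `u` are left between the first `d` and the index `k`: the word begins with
    -- `mh d u`.
    exfalso
    have hu1 : w[j₀ + 1]? = some u := by
      rcases Nat.lt_or_ge (j₀ + 1) k with h | h
      · rcases letter_cases (w := w) (j := j₀ + 1) (by omega) with h' | (h' | h') | h'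
        · exact absurd ⟨_, by omega, h, h'⟩ hMex
        · exact absurd (Or.inl hj₀) (hw.d_prev j₀ h')
        · exact absurd ⟨_, by omega, h, h'⟩ hFex
        · exact h'
      · obtain rfl : k = j₀ + 1 := by omega
        exact hku
    rcases Nat.lt_or_ge 1 j₀ with h | h
    · rcases hbefore 1 h with h' | h'
      · exact absurd hw.first (not_mAt_of_dAt (hw.m_prev 0 h'))
      · have := hw.u_mh k 1 _ hku h' h1
        omega
    · obtain rfl : j₀ = 1 := by omega
      rw [h4] at h1
      exact hw.not_mdu h1 hj₀ hu1
  · refine hS.of_DM hw hi (j := 0) (hS.val_between _ hi _ hk _ (mem_pts_M.2 hw.first) ?_ ?_) <;>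
      simp only [val, Prod.Lex.toLex_lt_toLex] <;> omega

include hS hw in
lemma of_UU {k l : ℕ} (hkl : k < l) (hk : (⟨k, U⟩ : Pt) ∈ S) (hl : (⟨l, U⟩ : Pt) ∈ S) :
    ∃ e, (⟨e, E⟩ : Pt) ∈ S := by
  have hd := hw.u_next k (mem_pts_U.1 (hS.sub _ hk))
  have hne : k + 1 ≠ l := by
    rintro rfl
    have := mem_pts_U.1 (hS.sub _ hl)
    simp [this] at hd
  refine hS.of_UD hw hk (i := k + 1) (hS.pos_between _ hk _ hl _ (mem_pts_D.2 hd) ?_ ?_) <;>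
    simp only [pos] <;> omega

include hS hw in
lemma of_DD {i j : ℕ} (hij : i < j) (hi : (⟨i, D⟩ : Pt) ∈ S) (hj : (⟨j, D⟩ : Pt) ∈ S) :
    ∃ e, (⟨e, E⟩ : Pt) ∈ S := by
  rcases mem_pts_D.1 (hS.sub _ hj) with h | h
  · obtain ⟨k, rfl⟩ : ∃ k, j = k + 1 := ⟨j - 1, by omega⟩
    have hkd := hw.d_prev k h
    have hik : i ≠ k := by
      rintro rfl
      exact hkd (mem_pts_D.1 (hS.sub _ hi))
    have hkL := lt_length h
    rcases letter_cases (w := w) (j := k) (by omega) with h' | h' | h'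
    · refine hS.of_DM hw hi (j := k) (hS.pos_between _ hi _ hj _ (mem_pts_M.2 h') ?_ ?_) <;>
        simp only [pos] <;> omega
    · exact absurd h' hkd
    · refine hS.of_UD hw (k := k) (hS.pos_between _ hi _ hj _ (mem_pts_U.2 h') ?_ ?_) hi <;>
        simp only [pos] <;> omega
  · refine hS.of_FD hw (i := j) (hS.val_between _ hj _ hi _ (mem_pts_F.2 h) ?_ ?_) hi <;>
      simp only [val, Prod.Lex.toLex_lt_toLex] <;> omega

include hS hw in
/-- A biconvex set with at least two points contains a point of kind `E`. For two points that are
not of kind `E` themselves, the lemmas above show this for each pair of kinds. -/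
lemma exists_E_of_ne {x y : Pt} (hx : x ∈ S) (hy : y ∈ S) (hxy : x ≠ y) :
    ∃ e, (⟨e, E⟩ : Pt) ∈ S := by
  obtain ⟨i, κ⟩ := x
  obtain ⟨j, κ'⟩ := y
  rcases lt_trichotomy i j with h | h | h
  · cases κ <;> cases κ' <;>
    first
    | exact ⟨_, hx⟩ | exact ⟨_, hy⟩
    | exact hS.of_DM hw hx hy | exact hS.of_DM hw hy hx
    | exact hS.of_FM hw hx hy | exact hS.of_FM hw hy hx
    | exact hS.of_FD hw hx hy | exact hS.of_FD hw hy hx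
    | exact hS.of_UM hw hx hy | exact hS.of_UM hw hy hx
    | exact hS.of_UF hw hx hy | exact hS.of_UF hw hy hx
    | exact hS.of_UD hw hx hy | exact hS.of_UD hw hy hx
    | exact hS.of_MM hw h hx hy | exact hS.of_DD hw h hx hy
    | exact hS.of_UU hw h hx hy | exact hS.of_FF hw h hx hy
  · subst h
    cases κ <;> cases κ' <;>
    first
    | exact absurd rfl hxy
    | exact ⟨_, hx⟩ | exact ⟨_, hy⟩
    | exact hS.of_DM hw hx hy | exact hS.of_DM hw hy hx
    | exact hS.of_FM hw hx hy | exact hS.of_FM hw hy hx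
    | exact hS.of_FD hw hx hy | exact hS.of_FD hw hy hx
    | exact hS.of_UM hw hx hy | exact hS.of_UM hw hy hx
    | exact hS.of_UF hw hx hy | exact hS.of_UF hw hy hx
    | exact hS.of_UD hw hx hy | exact hS.of_UD hw hy hx
  · cases κ <;> cases κ' <;>
    first
    | exact ⟨_, hx⟩ | exact ⟨_, hy⟩
    | exact hS.of_DM hw hx hy | exact hS.of_DM hw hy hx
    | exact hS.of_FM hw hx hy | exact hS.of_FM hw hy hx
    | exact hS.of_FD hw hx hy | exact hS.of_FD hw hy hx
    | exact hS.of_UM hw hx hy | exact hS.of_UM hw hy hx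
    | exact hS.of_UF hw hx hy | exact hS.of_UF hw hy hx
    | exact hS.of_UD hw hx hy | exact hS.of_UD hw hy hx
    | exact hS.of_MM hw h hy hx | exact hS.of_DD hw h hy hx
    | exact hS.of_UU hw h hy hx | exact hS.of_FF hw h hy hx

end Biconvex

/-- The last letter standing for a `D` and the last one standing for an `M`; their points are the
minimum and the maximum of the permutation. If the last `M` comes after the last `D`, then it
follows it directly and its letter is `m`. -/
lemma GoodWord.exists_last (hw : GoodWord w) : ∃ jd jm, DAt w jd ∧ MAt w jm ∧
    (∀ j, DAt w j → j ≤ jd) ∧ (∀ j, MAt w j → j ≤ jm) ∧ jd ≠ jm ∧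
    (jd < jm → jm = jd + 1 ∧ w[jm]? = some m) ∧ (∀ j : ℕ, w[j]? = some u → j < jd) := by
  classical
  have hex : ∀ P : ℕ → Prop, (∃ j, P j) → (∀ j, P j → j < w.length) →
      ∃ j, P j ∧ ∀ i, P i → i ≤ j := by
    intro P hP hb
    obtain ⟨j, hj⟩ := hP
    have h := Nat.findGreatest_spec (P := P) (hb j hj).le hj
    exact ⟨_, h, fun i hi => Nat.le_findGreatest (hb i hi).le hi⟩
  have hlt : ∀ {a b : Letter} (j : ℕ), w[j]? = some a ∨ w[j]? = some b → j < w.length := by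
    intro a b j h
    rcases h with h | h <;> exact lt_length h
  obtain ⟨jd, hjd, hjd'⟩ := hex (DAt w) (hw.exists_d.imp fun j h => Or.inl h) (hlt ·)
  obtain ⟨jm, hjm, hjm'⟩ := hex (MAt w) ⟨0, hw.first⟩ (hlt ·)
  have hne : jd ≠ jm := by
    rintro rfl
    exact not_mAt_of_dAt hjd hjm
  obtain ⟨l, hl, hlast⟩ := hw.last
  refine ⟨jd, jm, hjd, hjm, hjd', hjm', hne, ?_, ?_⟩
  · intro hlt'
    have hjml := hlt jm hjm
    rcases hlast with h | h | h
    · have := hjd' l (Or.inl h); omega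
    · have := hjd' l (Or.inr h); omega
    · have h1 := hjm' l (Or.inl h)
      obtain rfl : jm = l := by omega
      obtain ⟨k, rfl⟩ : ∃ k, jm = k + 1 := ⟨jm - 1, by omega⟩
      have := hjd' k (hw.m_prev k h)
      exact ⟨by omega, h⟩
  · intro j hj
    rcases hw.u_next j hj with h | h
    · have := hjd' (j + 1) (Or.inl h); omega
    · have := hjd' (j + 1) (Or.inr h); omega

/-- A biconvex set with at least two points contains the minimum. The hypotheses on `jd` and `jm`
are those provided by `GoodWord.exists_last`. -/
lemma Biconvex.min_mem (hS : Biconvex w S) (hw : GoodWord w) {x y : Pt} (hx : x ∈ S) (hy : y ∈ S)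
    (hxy : x ≠ y) {jd jm : ℕ} (hd : DAt w jd) (hm : MAt w jm) (hd' : ∀ j, DAt w j → j ≤ jd)
    (hm' : ∀ j, MAt w j → j ≤ jm) (hne : jd ≠ jm)
    (hdm : jd < jm → jm = jd + 1 ∧ w[jm]? = some m) (hu : ∀ j : ℕ, w[j]? = some u → j < jd) :
    (⟨jd, D⟩ : Pt) ∈ S := by
  have hdL : jd < w.length := by rcases hd with h | h <;> exact lt_length h
  -- An `E` together with any other point encloses the last `D`.
  have key : ∀ e j κ, (⟨e, E⟩ : Pt) ∈ S → (⟨j, κ⟩ : Pt) ∈ S → (⟨e, E⟩ : Pt) ≠ ⟨j, κ⟩ →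
      (⟨jd, D⟩ : Pt) ∈ S := by
    intro e j κ he hj hej
    have heL := lt_of_mem_pts (hS.sub _ he)
    have hjL := lt_of_mem_pts (hS.sub _ hj)
    have heE := mem_pts_E.1 (hS.sub _ he)
    have hM : ∀ i, (⟨i, M⟩ : Pt) ∈ S → i < jd → (⟨jd, D⟩ : Pt) ∈ S := by
      intro i hi hlt
      refine hS.pos_between _ hi _ he _ (mem_pts_D.2 hd) ?_ ?_ <;> simp only [pos] <;> omega
    have hmh : ∀ i : ℕ, w[i]? = some mh → i < jd := by
      intro i hi
      have h1 := hm' i (Or.inr hi)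
      by_contra hc
      have h2 : i ≠ jd := by
        rintro rfl
        rcases hd with h | h <;> simp [hi] at h
      obtain ⟨h3, h4⟩ := hdm (by omega)
      obtain rfl : i = jm := by omega
      simp [hi] at h4
    cases κ
    · rcases Nat.lt_or_ge j jd with h | h
      · exact hM j hj h
      · have h1 := hmh e heE
        refine hM e (hS.val_between _ he _ hj _ (mem_pts_M.2 (Or.inr heE)) ?_ ?_) h1 <;>
          simp only [val, Prod.Lex.toLex_lt_toLex] <;> omega
    · have := hd' j (mem_pts_D.1 (hS.sub _ hj))
      rcases Nat.lt_or_ge j jd with h | h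
      · refine hS.pos_between _ hj _ he _ (mem_pts_D.2 hd) ?_ ?_ <;> simp only [pos] <;> omega
      · obtain rfl : j = jd := by omega
        exact hj
    · have := hu j (mem_pts_U.1 (hS.sub _ hj))
      refine hS.pos_between _ hj _ he _ (mem_pts_D.2 hd) ?_ ?_ <;> simp only [pos] <;> omega
    · have hjE := mem_pts_E.1 (hS.sub _ hj)
      have hej' : e ≠ j := by rintro rfl; exact hej rfl
      rcases Nat.lt_or_ge e j with h | h
      · refine hM e (hS.val_between _ he _ hj _ (mem_pts_M.2 (Or.inr heE)) ?_ ?_) (hmh e heE) <;>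
          simp only [val, Prod.Lex.toLex_lt_toLex] <;> omega
      · refine hM j (hS.val_between _ hj _ he _ (mem_pts_M.2 (Or.inr hjE)) ?_ ?_) (hmh j hjE) <;>
          simp only [val, Prod.Lex.toLex_lt_toLex] <;> omega
    · refine hS.pos_between _ hj _ he _ (mem_pts_D.2 hd) ?_ ?_ <;> simp only [pos] <;> omega
  obtain ⟨e, he⟩ := hS.exists_E_of_ne hw hx hy hxy
  by_cases h : (⟨e, E⟩ : Pt) = x
  · exact key e y.1 y.2 he hy (by rw [h]; exact hxy)
  · exact key e x.1 x.2 he hx h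

/-- A biconvex set with at least two points contains the minimum and the maximum, hence
all points. -/
lemma Biconvex.eq_pts (hS : Biconvex w S) (hw : GoodWord w) {x y : Pt} (hx : x ∈ S) (hy : y ∈ S)
    (hxy : x ≠ y) : ∀ z ∈ pts w, z ∈ S := by
  classical
  obtain ⟨jd, jm, hd, hm, hd', hm', hne, hdm, hu⟩ := hw.exists_last
  have hmin := hS.min_mem hw hx hy hxy hd hm hd' hm' hne hdm hu
  obtain ⟨e, he⟩ := hS.exists_E_of_ne hw hx hy hxy
  have hdL : jd < w.length := by rcases hd with h | h <;> exact lt_length h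
  have hmL : jm < w.length := by rcases hm with h | h <;> exact lt_length h
  obtain ⟨j₀, hj₀, hbefore, hD, hdh, hu₀⟩ := hw.exists_first_d
  obtain ⟨h1, h2, h3, h4⟩ := hw.first_mh hj₀ hbefore
  have hjd0 := hD jd hd
  have heL := lt_of_mem_pts (hS.sub _ he)
  have hmax : (⟨jm, M⟩ : Pt) ∈ S := by
    rcases Nat.lt_or_ge jd jm with hlt | hge
    · refine hS.pos_between _ hmin _ he _ (mem_pts_M.2 hm) ?_ ?_ <;> simp only [pos] <;> omega
    have hlt : jm < jd := by omega
    -- Any point of `S` to the left of the maximum suffices.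
    have hleft : ∀ z ∈ S, pos w z < jm → (⟨jm, M⟩ : Pt) ∈ S := by
      intro z hz hzp
      refine hS.pos_between _ hz _ hmin _ (mem_pts_M.2 hm) ?_ ?_ <;> simp only [pos] at hzp ⊢ <;>
        omega
    have hbelow : ∀ i l : ℕ, MAt w i → w[l]? = some mh → i < l → (⟨jm, M⟩ : Pt) ∈ S := by
      intro i l hi hl hil
      have hlm := hm' l (Or.inr hl)
      have hlL := lt_length hl
      have hle : l ≤ e ∨ e < l := by omega
      have hlE : (⟨l, E⟩ : Pt) ∈ S ∨ l ≤ e := by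
        rcases hle with h | h
        · exact Or.inr h
        · left
          refine hS.pos_between _ hmin _ he _ (mem_pts_E.2 hl) ?_ ?_ <;> simp only [pos] <;> omega
      have hiS : (⟨i, M⟩ : Pt) ∈ S := by
        rcases hlE with h | h
        · refine hS.val_between _ hmin _ h _ (mem_pts_M.2 hi) ?_ ?_ <;>
            simp only [val, Prod.Lex.toLex_lt_toLex] <;> omega
        · refine hS.val_between _ hmin _ he _ (mem_pts_M.2 hi) ?_ ?_ <;>
            simp only [val, Prod.Lex.toLex_lt_toLex] <;> omega
      exact hleft _ hiS (by simp only [pos]; omega)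
    rcases h4 with h4 | ⟨h4, h0⟩
    swap
    · exact hbelow 0 1 hw.first (by rw [← h4]; exact h1) (by omega)
    rw [h4] at h1
    by_cases hF : ∃ i : ℕ, w[i]? = some dh
    · obtain ⟨i, hi⟩ := hF
      have := hd' i (Or.inr hi)
      refine hleft ⟨i, F⟩ (hS.val_between _ hmin _ he _ (mem_pts_F.2 hi) ?_ ?_) ?_ <;>
        simp only [val, pos, Prod.Lex.toLex_lt_toLex] <;> omega
    by_cases hE : ∃ i : ℕ, 0 < i ∧ w[i]? = some mh
    · obtain ⟨i, hi, hi'⟩ := hE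
      exact hbelow 0 i hw.first hi' hi
    -- With no `F`, and no `E` but the one of the first letter, the word begins with `mh d m`.
    have hj01 : j₀ = 1 := by
      by_contra hc
      rcases hbefore 1 (by omega) with h | h
      · have := hw.m_prev 0 h
        simp [h1] at this
      · exact hE ⟨1, by omega, h⟩
    subst hj01
    have hD0 : (⟨1, D⟩ : Pt) ∈ S := by
      rcases Nat.lt_or_ge 1 jd with h | h
      · refine hS.val_between _ hmin _ he _ (mem_pts_D.2 (Or.inl hj₀)) ?_ ?_ <;>
          simp only [val, Prod.Lex.toLex_lt_toLex] <;> omega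
      · obtain rfl : jd = 1 := by omega
        exact hmin
    have h2L : 2 < w.length := by
      by_contra hc
      exact hw.ne_md (eq_pair (by omega) h1 hj₀)
    have hm2 : MAt w 2 := by
      rcases letter_cases h2L with h | (h | h) | h
      · exact h
      · exact absurd (Or.inl hj₀) (hw.d_prev 1 h)
      · exact absurd ⟨2, h⟩ hF
      · exact absurd h (hw.not_mdu h1 hj₀)
    have := hm' 2 hm2
    exact hleft _ hD0 (by simp only [pos]; omega)
  rintro ⟨j, κ⟩ hz
  have hjL := lt_of_mem_pts hz
  by_cases hz1 : (⟨j, κ⟩ : Pt) = ⟨jd, D⟩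
  · rw [hz1]; exact hmin
  by_cases hz2 : (⟨j, κ⟩ : Pt) = ⟨jm, M⟩
  · rw [hz2]; exact hmax
  have hhm := hm' _ (Or.inr h1)
  refine hS.val_between _ hmin _ hmax _ hz ?_ ?_
  · cases κ <;> simp only [val, Prod.Lex.toLex_lt_toLex]
    · omega
    · have := hd' j (mem_pts_D.1 hz)
      have : j ≠ jd := by rintro rfl; exact hz1 rfl
      omega
    · omega
    · omega
    · have := hd' j (Or.inr (mem_pts_F.1 hz))
      omega
  · cases κ <;> simp only [val, Prod.Lex.toLex_lt_toLex]
    · have := hm' j (mem_pts_M.1 hz)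
      have : j ≠ jm := by rintro rfl; exact hz2 rfl
      omega
    · omega
    · omega
    · have := hm' j (Or.inr (mem_pts_E.1 hz))
      omega
    · omega

end

open PermPattern in
lemma Realizes.isSimple {n : ℕ} {π : Perm (Fin n)} {w : List Letter} (h : Realizes π w)
    (hw : GoodWord w) : IsSimple π := by
  obtain ⟨g, g1, g2, g3, g4⟩ := h
  have hpos : ∀ i j, pos w (g i) < pos w (g j) → i < j := fun i j hij => g3.lt_iff_lt.1 hij
  have hval : ∀ i j, val w (g i) < val w (g j) → π i < π j := by
    intro i j hij
    rcases lt_trichotomy (π i) (π j) with h | h | h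
    · exact h
    · rw [π.injective h] at hij; exact absurd hij (lt_irrefl _)
    · exact absurd (g4 _ _ h) hij.asymm
  rintro I ⟨hne, ⟨a, b, hab⟩, c, d, hcd⟩
  have hImem : ∀ i, i ∈ I ↔ c ≤ π i ∧ π i ≤ d := by
    intro i
    rw [← Finset.mem_Icc, ← hcd, Finset.mem_image]
    constructor
    · intro hi; exact ⟨i, hi, rfl⟩
    · rintro ⟨j, hj, hji⟩; rwa [← π.injective hji]
  have hS : Biconvex w (g '' I) := by
    refine ⟨?_, ?_, ?_⟩
    · rintro _ ⟨i, -, rfl⟩; exact g1 i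
    · rintro _ ⟨i, hi, rfl⟩ _ ⟨j, hj, rfl⟩ z hz h1 h2
      obtain ⟨k, rfl⟩ := g2 z hz
      rw [Finset.mem_coe, hab, Finset.mem_Icc] at hi hj
      refine ⟨k, ?_, rfl⟩
      rw [Finset.mem_coe, hab, Finset.mem_Icc]
      exact ⟨hi.1.trans (hpos _ _ h1).le, (hpos _ _ h2).le.trans hj.2⟩
    · rintro _ ⟨i, hi, rfl⟩ _ ⟨j, hj, rfl⟩ z hz h1 h2
      obtain ⟨k, rfl⟩ := g2 z hz
      rw [Finset.mem_coe, hImem] at hi hj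
      refine ⟨k, ?_, rfl⟩
      rw [Finset.mem_coe, hImem]
      exact ⟨hi.1.trans (hval _ _ h1).le, (hval _ _ h2).le.trans hj.2⟩
  by_contra hcard
  push Not at hcard
  have h2 : 1 < I.card := by have := hne.card_pos; omega
  obtain ⟨i, hi, j, hj, hij⟩ := Finset.one_lt_card.1 h2
  have hgi : g i ≠ g j := fun h => hij (g3.injective (by simp [h]))
  apply hcard.2
  have : I = Finset.univ := by
    ext k
    simp only [Finset.mem_univ, iff_true]
    obtain ⟨l, hl, hlk⟩ := hS.eq_pts hw ⟨i, hi, rfl⟩ ⟨j, hj, rfl⟩ hgi (g k) (g1 k)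
    have : l = k := g3.injective (by simp [hlk])
    rw [← this]; exact hl
  rw [this]; simp

end

/-! ### The shape of a simple permutation in the class -/

section

/-- `p` is the one-line notation on `{0, …, n - 1}` of a simple permutation of length
`n ≥ 3` that avoids `3124` and `4312`, and `q` is its inverse. The values of `p` and `q`
at other arguments are irrelevant. `sep` says that each block `a, …, b` of at least two,
but not all, positions is separated in value by an entry outside it, and `av` says that
all entries larger than the first entry `c` of a `312`-pattern at positions `c`, `a`, `b`
lie between its first and its last entry. -/
structure SimpleAvoider (n : ℕ) (p q : ℕ → ℕ) : Prop where
  three_le : 3 ≤ n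
  p_lt : ∀ i < n, p i < n
  q_lt : ∀ v < n, q v < n
  q_p : ∀ i < n, q (p i) = i
  p_q : ∀ v < n, p (q v) = v
  sep : ∀ a b, a < b → b < n → (0 < a ∨ b + 1 < n) → ∃ s < n, (s < a ∨ b < s) ∧
    ∃ i j, a ≤ i ∧ i ≤ b ∧ a ≤ j ∧ j ≤ b ∧ p i < p s ∧ p s < p j
  av : ∀ c a b s, c < a → a < b → b < n → s < n → p a < p b → p b < p c → p c < p s →
    c < s ∧ s < b

/-- The entry at position `i` is a left-to-right maximum. -/
def IsMax (p : ℕ → ℕ) (i : ℕ) : Prop := ∀ j < i, p j < p i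

lemma exists_greatest {P : ℕ → Prop} {a b : ℕ} (ha : P a) (hab : a ≤ b) :
    ∃ k, a ≤ k ∧ k ≤ b ∧ P k ∧ ∀ j, k < j → j ≤ b → ¬ P j := by
  classical
  refine ⟨Nat.findGreatest P b, Nat.le_findGreatest hab ha, Nat.findGreatest_le b,
    Nat.findGreatest_spec hab ha, fun j h1 h2 h3 => ?_⟩
  have := Nat.le_findGreatest h2 h3
  omega

lemma exists_least {P : ℕ → Prop} {b : ℕ} (hb : P b) :
    ∃ k, k ≤ b ∧ P k ∧ ∀ j < k, ¬ P j := by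
  classical
  exact ⟨Nat.find ⟨b, hb⟩, Nat.find_min' _ hb, Nat.find_spec ⟨b, hb⟩,
    fun j hj => Nat.find_min _ hj⟩

namespace SimpleAvoider

variable {n : ℕ} {p q : ℕ → ℕ} (H : SimpleAvoider n p q)

include H

lemma ne {i j : ℕ} (hi : i < n) (hj : j < n) (hij : i ≠ j) : p i ≠ p j := by
  intro h
  apply hij
  rw [← H.q_p i hi, h, H.q_p j hj]

lemma eq {i j : ℕ} (hi : i < n) (hj : j < n) (hij : p i = p j) : i = j := by
  rw [← H.q_p i hi, hij, H.q_p j hj]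

lemma not_isMax {i : ℕ} (hi : i < n) (h : ¬ IsMax p i) : ∃ j < i, p i < p j := by
  simp only [IsMax, not_forall, not_lt] at h
  obtain ⟨j, hj, hle⟩ := h
  exact ⟨j, hj, lt_of_le_of_ne hle (H.ne hi (by omega) (by omega))⟩

/-- Adjacent entries are not adjacent in value. -/
lemma no_bond {i : ℕ} (hi : i + 1 < n) : p (i + 1) ≠ p i + 1 ∧ p i ≠ p (i + 1) + 1 := by
  have h3 := H.three_le
  obtain ⟨s, hs, hs', x, y, h1, h2, h3, h4, h5, h6⟩ :=
    H.sep i (i + 1) (by omega) hi (by omega)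
  have hx : x = i ∨ x = i + 1 := by omega
  have hy : y = i ∨ y = i + 1 := by omega
  rcases hx with rfl | rfl <;> rcases hy with rfl | rfl <;> omega

/-- The minimum is neither the first nor the last entry. -/
lemma z_facts : q 0 < n ∧ p (q 0) = 0 ∧ 0 < q 0 ∧ q 0 + 1 < n := by
  have h3 := H.three_le
  have h1 := H.q_lt 0 (by omega)
  have h2 := H.p_q 0 (by omega)
  refine ⟨h1, h2, ?_, ?_⟩
  · obtain ⟨s, hs, hs', x, y, a1, a2, a3, a4, a5, a6⟩ :=
      H.sep 1 (n - 1) (by omega) (by omega) (by omega)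
    obtain rfl : s = 0 := by omega
    rcases Nat.eq_zero_or_pos (q 0) with h | h
    · rw [h] at h2; omega
    · exact h
  · obtain ⟨s, hs, hs', x, y, a1, a2, a3, a4, a5, a6⟩ :=
      H.sep 0 (n - 2) (by omega) (by omega) (by omega)
    obtain rfl : s = n - 1 := by omega
    by_contra hc
    have : q 0 = n - 1 := by omega
    rw [this] at h2
    omega

/-- The maximum is neither the first nor the last entry. -/
lemma t_facts : q (n - 1) < n ∧ p (q (n - 1)) = n - 1 ∧ 0 < q (n - 1) ∧ q (n - 1) + 1 < n := by
  have h3 := H.three_le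
  have h1 := H.q_lt (n - 1) (by omega)
  have h2 := H.p_q (n - 1) (by omega)
  refine ⟨h1, h2, ?_, ?_⟩
  · obtain ⟨s, hs, hs', x, y, a1, a2, a3, a4, a5, a6⟩ :=
      H.sep 1 (n - 1) (by omega) (by omega) (by omega)
    obtain rfl : s = 0 := by omega
    have := H.p_lt y (by omega)
    rcases Nat.eq_zero_or_pos (q (n - 1)) with h | h
    · rw [h] at h2; omega
    · exact h
  · obtain ⟨s, hs, hs', x, y, a1, a2, a3, a4, a5, a6⟩ :=
      H.sep 0 (n - 2) (by omega) (by omega) (by omega)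
    obtain rfl : s = n - 1 := by omega
    have := H.p_lt y (by omega)
    by_contra hc
    have : q (n - 1) = n - 1 := by omega
    rw [this] at h2
    omega

/-- The entries after the minimum decrease. -/
lemma anti_after {i j : ℕ} (hi : q 0 < i) (hij : i < j) (hj : j < n) : p j < p i := by
  obtain ⟨hz, hz0, hz1, hz2⟩ := H.z_facts
  by_contra hlt
  have hne := H.ne (show i < n by omega) hj (by omega)
  have hasc : p i < p j := by omega
  -- A cut `k` splits the entries after the minimum into a larger left part and a smaller right
  -- part. Take the smallest block between consecutive cuts that contains both `i` and `j`. Some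
  -- entry `s` outside separates it; `s` comes before the minimum, since the entries between the
  -- minimum and the block are larger, and those after the block smaller, than the block. The
  -- minimum and `s` then forbid an ascent from below `p s` to above `p s`, so there is a cut
  -- inside the block.
  let Cut : ℕ → Prop := fun k => ∀ x y, q 0 < x → x < k → k ≤ y → y < n → p y < p x
  obtain ⟨a, ha1, ha2, hacut, ha⟩ := exists_greatest (P := Cut) (a := q 0 + 1) (b := i)
    (fun x y h1 h2 _ _ => by omega) hi
  obtain ⟨b, hb1, ⟨hb2, hbcut⟩, hb⟩ := exists_least (P := fun k => i < k ∧ Cut k) (b := n)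
    ⟨by omega, fun x y _ _ h3 h4 => by omega⟩
  have hjb : j < b := by
    by_contra hc
    have := hbcut i j hi hb2 (by omega) hj
    omega
  obtain ⟨s, hs, hs', x, y, h1, h2, h3, h4, h5, h6⟩ :=
    H.sep a (b - 1) (by omega) (by omega) (by omega)
  have hsz : s < q 0 := by
    by_contra hc
    have h0 : s ≠ q 0 := by
      rintro rfl
      omega
    rcases hs' with hs' | hs'
    · have := hacut s y (by omega) hs' h3 (by omega)
      omega
    · have := hbcut x s (by omega) (by omega) (by omega) hs
      omega
  have hnoasc : ∀ x y, a ≤ x → x < y → y < b → p x < p s → ¬ p s < p y := by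
    intro x y hx hxy hy h1 h2
    have hx0 := H.ne (show q 0 < n by omega) (show x < n by omega) (by omega)
    have := H.av s (q 0) x y hsz (by omega) (by omega) (by omega) (by omega) h1 h2
    omega
  obtain ⟨k, hk1, ⟨hk2, hk3⟩, hk⟩ :=
    exists_least (P := fun k => a ≤ k ∧ p k < p s) (b := x) ⟨h1, h5⟩
  have hkb : k < b := by omega
  have hcut : Cut k := by
    intro x' y' hx1 hx2 hy1 hy2
    rcases Nat.lt_or_ge x' a with hxa | hxa
    · exact hacut x' y' hx1 hxa (by omega) hy2
    rcases Nat.lt_or_ge y' b with hyb | hyb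
    · have e1 := hk x' hx2
      have e2 := H.ne (show x' < n by omega) hs (by omega)
      have e3 : ¬ p s < p y' := by
        rcases Nat.lt_or_ge k y' with h | h
        · exact hnoasc k y' hk2 h hyb hk3
        · obtain rfl : y' = k := by omega
          omega
      have e4 : ¬ p x' < p s := fun h => e1 ⟨hxa, h⟩
      have e5 := H.ne hy2 hs (by omega)
      omega
    · exact hbcut x' y' hx1 (by omega) hyb hy2
  have hak : a ≠ k := by
    rintro rfl
    rcases Nat.lt_or_ge a y with h | h
    · exact hnoasc a y le_rfl h (by omega) hk3 h6
    · obtain rfl : y = a := by omega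
      omega
  rcases Nat.lt_or_ge i k with h | h
  · exact hb k hkb ⟨h, hcut⟩
  · exact ha k (by omega) h hcut

/-- The first position `e₀` after both the minimum and the maximum; the entries from there on are
those of kind `E`. There is at least one, and no entry but the maximum lies between the minimum and
`e₀`. -/
lemma exists_block : ∃ e₀, e₀ < n ∧ q 0 < e₀ ∧ q (n - 1) < e₀ ∧
    (∀ i < e₀, i ≤ q 0 ∨ i = q (n - 1)) ∧ (e₀ - 1 = q 0 ∨ e₀ - 1 = q (n - 1)) := by
  obtain ⟨hz, hz0, hz1, hz2⟩ := H.z_facts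
  obtain ⟨ht, ht0, ht1, ht2⟩ := H.t_facts
  have h3 := H.three_le
  rcases lt_trichotomy (q (n - 1)) (q 0) with h | h | h
  · exact ⟨q 0 + 1, by omega, by omega, by omega, by omega, by omega⟩
  · rw [h] at ht0; omega
  · have : q (n - 1) = q 0 + 1 := by
      by_contra hne
      have h1 := H.anti_after (i := q 0 + 1) (by omega) (j := q (n - 1)) (by omega) ht
      have h2 := H.p_lt (q 0 + 1) (by omega)
      omega
    exact ⟨q 0 + 2, by omega, by omega, by omega, by omega, by omega⟩

lemma not_isMax_z : ¬ IsMax p (q 0) := by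
  obtain ⟨hz, hz0, hz1, hz2⟩ := H.z_facts
  intro h
  have := h 0 hz1
  omega

lemma isMax_t : IsMax p (q (n - 1)) := by
  obtain ⟨ht, ht0, ht1, ht2⟩ := H.t_facts
  intro j hj
  have h1 := H.p_lt j (by omega)
  have h2 := H.ne (show j < n by omega) ht (by omega)
  omega

lemma not_isMax_of_t_lt {i : ℕ} (hi : i < n) (h : q (n - 1) < i) : ¬ IsMax p i := by
  obtain ⟨ht, ht0, ht1, ht2⟩ := H.t_facts
  intro hm
  have h1 := hm _ h
  have h2 := H.p_lt i hi
  omega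

/-- A `312`-pattern starts with a left-to-right maximum. -/
lemma no_312 {c a b : ℕ} (hca : c < a) (hab : a < b) (hb : b < n) (hc : ¬ IsMax p c)
    (h1 : p a < p b) (h2 : p b < p c) : False := by
  obtain ⟨m, hm, hlt⟩ := H.not_isMax (by omega) hc
  have := H.av c a b m hca hab hb (by omega) h1 h2 hlt
  omega

omit H in
lemma isMax_lt {i j : ℕ} (hi : IsMax p i) (hj : IsMax p j) : p i < p j ↔ i < j := by
  constructor
  · intro h
    by_contra hc
    rcases Nat.lt_or_ge j i with h' | h'
    · have := hi j h'; omega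
    · obtain rfl : i = j := by omega
      omega
  · exact fun h => hj i h

end SimpleAvoider

/-- A simple permutation in the class together with the position `e₀` where the entries of kind `E`
begin; see `SimpleAvoider.exists_block`. -/
structure Layout (n : ℕ) (p q : ℕ → ℕ) (e₀ : ℕ) : Prop extends SimpleAvoider n p q where
  e₀_lt : e₀ < n
  z_lt : q 0 < e₀
  t_lt : q (n - 1) < e₀
  lt_e₀ : ∀ i < e₀, i ≤ q 0 ∨ i = q (n - 1)
  e₀_pred : e₀ - 1 = q 0 ∨ e₀ - 1 = q (n - 1)

/-- The entry at position `i` is of kind `U`. -/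
def IsU (p : ℕ → ℕ) (e₀ i : ℕ) : Prop :=
  i < e₀ ∧ ¬ IsMax p i ∧ ∃ j < i, ¬ IsMax p j ∧ p j < p i

/-- The entry at position `i` is of kind `D`. -/
def IsD (p : ℕ → ℕ) (e₀ i : ℕ) : Prop :=
  i < e₀ ∧ ¬ IsMax p i ∧ ¬ ∃ j < i, ¬ IsMax p j ∧ p j < p i

namespace Layout

open SimpleAvoider

variable {n : ℕ} {p q : ℕ → ℕ} {e₀ : ℕ} (H : Layout n p q e₀)

include H

lemma le_z {i : ℕ} (hi : i < e₀) (hm : ¬ IsMax p i) : i ≤ q 0 := by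
  rcases H.lt_e₀ i hi with h | rfl
  · exact h
  · exact absurd H.isMax_t hm

lemma z_lt_of_E {e : ℕ} (he : e₀ ≤ e) : q 0 < e := by
  have := H.z_lt; omega

lemma anti_E {e f : ℕ} (he : e₀ ≤ e) (hef : e < f) (hf : f < n) : p f < p e :=
  H.anti_after (H.z_lt_of_E he) hef hf

/-- Entries of kind `D` and `U` are smaller than those of kind `E`. -/
lemma lt_E {i e : ℕ} (hi : i < e₀) (hm : ¬ IsMax p i) (he : e₀ ≤ e) (hn : e < n) : p i < p e := by
  have hiz := H.le_z hi hm
  have hez := H.z_lt_of_E he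
  obtain ⟨hz, hz0, hz1, hz2⟩ := H.z_facts
  have hne := H.ne (show i < n by omega) hn (by omega)
  have hne' := H.ne (show e < n by omega) hz (by omega)
  by_contra hc
  have hiz' : i ≠ q 0 := by rintro rfl; omega
  exact H.no_312 (c := i) (a := q 0) (b := e) (by omega) hez hn hm (by omega) (by omega)

/-- An ascent of two entries that are not left-to-right maxima, neither of kind `E`, has a larger
entry before it. -/
lemma exists_above {i j : ℕ} (hij : i < j) (hj : j < e₀) (hi : ¬ IsMax p i)
    (hj' : ¬ IsMax p j) (hlt : p i < p j) : ∃ a < i, p j < p a := by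
  have he0 := H.e₀_lt
  by_contra hc
  push Not at hc
  -- Let `k` be the first lower entry of a counterexample, and `a` the first entry larger than it.
  -- Then the block `a, …, k` has minimum `p k` and lies below `p j`, and nothing can separate it:
  -- an entry before it is smaller, and one after it completes a forbidden pattern with the last
  -- entry.
  let Bad : ℕ → Prop := fun i => ∃ j, i < j ∧ j < e₀ ∧ ¬ IsMax p i ∧ ¬ IsMax p j ∧ p i < p j ∧
    ∀ a < i, p a ≤ p j
  have hbad : Bad i := ⟨j, hij, hj, hi, hj', hlt, hc⟩
  clear hc hij hi hj' hlt hj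
  obtain ⟨k, -, ⟨j, hkj, hj, hk, hjm, hlt, hle⟩, hmin⟩ := exists_least (P := Bad) hbad
  obtain ⟨m, hm, hmk⟩ := H.not_isMax (show k < n by omega) hk
  obtain ⟨a, ham, hak, ha⟩ := exists_least (P := fun a => p k < p a) hmk
  have hge : ∀ x, a ≤ x → x ≤ k → p k ≤ p x := by
    intro x hx hxk
    by_contra hc
    have hxk' : x ≠ k := by rintro rfl; omega
    have hxa : x ≠ a := by rintro rfl; omega
    refine hmin x (by omega) ⟨j, by omega, hj, ?_, hjm, by omega, fun b hb => hle b (by omega)⟩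
    intro hmx
    have := hmx a (by omega)
    omega
  obtain ⟨s, hs, hs', x, y, h1, h2, h3, h4, h5, h6⟩ :=
    H.sep a k (by omega) (by omega) (by omega)
  have hsk : p k < p s := (hge x h1 h2).trans_lt h5
  rcases hs' with hs' | hs'
  · exact ha s hs' hsk
  · have hyk : y ≠ k := by rintro rfl; omega
    have hyj := lt_of_le_of_ne (hle y (by omega)) (H.ne (by omega) (by omega) (by omega))
    have hnE := H.lt_E hj hjm (e := n - 1) (by omega) (by omega)
    have := H.av y k s (n - 1) (by omega) hs' hs (by omega) hsk h6 (by omega)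
    omega

/-- An entry `j` of kind `U` is the last entry of a `312`-pattern `m`, `i`, `j`. Hence it comes
after the maximum, and all entries of kind `E` are smaller than the first entry of the pattern. -/
lemma U_data {j : ℕ} (hj : IsU p e₀ j) : ∃ i m, i < j ∧ ¬ IsMax p i ∧ p i < p j ∧ m < i ∧
    p j < p m ∧ q (n - 1) < j ∧ ∀ e, e₀ ≤ e → e < n → p e < p m := by
  obtain ⟨hje, hjm, i, hij, him, hlt⟩ := hj
  obtain ⟨m, hmi, hm⟩ := H.exists_above hij hje him hjm hlt
  have he0 := H.e₀_lt
  obtain ⟨ht, ht0, ht1, ht2⟩ := H.t_facts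
  have hav := H.av m i j
  refine ⟨i, m, hij, him, hlt, hmi, hm, ?_, ?_⟩
  · rcases Nat.lt_or_ge (p m) (p (q (n - 1))) with h | h
    · exact (hav _ hmi hij (by omega) ht hlt hm h).2
    · have h1 := H.p_lt m (by omega)
      have := H.eq (show m < n by omega) ht (by omega)
      omega
  · intro e he hen
    by_contra hc
    have hne := H.ne (show m < n by omega) hen (by omega)
    have := hav e hmi hij (by omega) hen hlt hm (by omega)
    omega

/-- No left-to-right maximum has a value between an entry of kind `U` and one of kind `E`. -/
lemma no_max_between {j e x : ℕ} (hj : IsU p e₀ j) (he : e₀ ≤ e) (hen : e < n) (hx : x < n)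
    (hxm : IsMax p x) (h1 : p j < p x) : p e < p x := by
  obtain ⟨i, m, hij, him, hlt, hmi, hm, -, hE⟩ := H.U_data hj
  have hje := hj.1
  by_contra hc
  have hme := hE e he hen
  have hxm' : x < m := by
    by_contra hc'
    rcases Nat.lt_or_ge m x with h | h
    · have := hxm m h; omega
    · obtain rfl : x = m := by omega
      omega
  have hne := H.ne hx hen (by omega)
  have := H.av x i j e (by omega) hij (by omega) hen hlt h1 (by omega)
  omega

/-- If there is an entry of kind `U`, only one entry is of kind `E`: nothing could separate the
first two of them. -/
lemma e₀_eq_of_U {j : ℕ} (hj : IsU p e₀ j) : e₀ = n - 1 := by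
  have he0 := H.e₀_lt
  by_contra hc
  have hz := H.z_lt
  obtain ⟨s, hs, hs', x, y, h1, h2, h3, h4, h5, h6⟩ :=
    H.sep e₀ (e₀ + 1) (by omega) (by omega) (by omega)
  have hanti := H.anti_E (e := e₀) le_rfl (f := e₀ + 1) (by omega) (by omega)
  have hx : p (e₀ + 1) < p s := by
    have : x = e₀ ∨ x = e₀ + 1 := by omega
    rcases this with rfl | rfl <;> omega
  have hy : p s < p e₀ := by
    have : y = e₀ ∨ y = e₀ + 1 := by omega
    rcases this with rfl | rfl <;> omega
  rcases hs' with hs' | hs'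
  · by_cases hm : IsMax p s
    · have := H.no_max_between hj le_rfl he0 hs hm
        ((H.lt_E hj.1 hj.2.1 (e := e₀ + 1) (by omega) (by omega)).trans hx)
      omega
    · have := H.lt_E hs' hm (e := e₀ + 1) (by omega) (by omega)
      omega
  · have := H.anti_E (e := e₀ + 1) (by omega) hs' hs
    omega

lemma D_lt_U {i j : ℕ} (hi : IsD p e₀ i) (hj : IsU p e₀ j) : p i < p j := by
  have he0 := H.e₀_lt
  obtain ⟨hi1, hi2, hi3⟩ := hi
  have hji : j ≠ i := by
    rintro rfl
    exact hi3 hj.2.2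
  obtain ⟨hje, hjm, k, hkj, hkm, hlt⟩ := hj
  have hne := H.ne (show i < n by omega) (show j < n by omega) hji.symm
  by_contra hc
  rcases lt_trichotomy i k with h | rfl | h
  · exact H.no_312 h hkj (by omega) hi2 hlt (by omega)
  · omega
  · exact hi3 ⟨k, h, hkm, by omega⟩

lemma D_anti {i j : ℕ} (hi : IsD p e₀ i) (hj : IsD p e₀ j) : p i < p j ↔ j < i := by
  have he0 := H.e₀_lt
  have key : ∀ {i j}, IsD p e₀ i → IsD p e₀ j → j < i → p i < p j := by
    intro i j hi hj hij
    have hne := H.ne (show i < n by have := hi.1; omega) (show j < n by have := hj.1; omega)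
      (by omega)
    by_contra hc
    exact hi.2.2 ⟨j, hij, hj.2.1, by omega⟩
  constructor
  · intro h
    by_contra hc
    rcases Nat.lt_or_ge i j with h' | h'
    · have := key hj hi h'; omega
    · obtain rfl : i = j := by omega
      omega
  · exact key hi hj

omit H in
lemma U_or_D {i : ℕ} (hi : i < e₀) (hm : ¬ IsMax p i) : IsU p e₀ i ∨ IsD p e₀ i := by
  by_cases h : ∃ j < i, ¬ IsMax p j ∧ p j < p i
  · exact Or.inl ⟨hi, hm, h⟩
  · exact Or.inr ⟨hi, hm, h⟩

omit H in
lemma not_U_of_D {i : ℕ} (h : IsD p e₀ i) : ¬ IsU p e₀ i := fun h' => h.2.2 h'.2.2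

/-- No two entries of kind `U` are adjacent: a maximal run of them would be separated by another
entry of kind `U`, and an entry of kind `D` next to the run then makes a `312`-pattern that starts
with an entry of kind `U`. -/
lemma not_U_succ {k : ℕ} (hk : IsU p e₀ k) : ¬ IsU p e₀ (k + 1) := by
  intro hk1
  have he0 := H.e₀_lt
  obtain ⟨-, -, -, -, -, -, -, htk, -⟩ := H.U_data hk
  obtain ⟨a, hak, haU, ha⟩ := exists_least (P := fun a => ∀ x, a ≤ x → x ≤ k → IsU p e₀ x) (b := k)
    (fun x h1 h2 => by obtain rfl : x = k := by omega
                       exact hk)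
  obtain ⟨b, hkb, hbe, hbU, hb⟩ := exists_greatest
    (P := fun b => ∀ x, k + 1 ≤ x → x ≤ b → IsU p e₀ x) (a := k + 1) (b := e₀)
    (fun x h1 h2 => by obtain rfl : x = k + 1 := by omega
                       exact hk1) (by have := hk1.1; omega)
  have hU : ∀ x, a ≤ x → x ≤ b → IsU p e₀ x := by
    intro x h1 h2
    rcases Nat.lt_or_ge k x with h | h
    · exact hbU x h h2
    · exact haU x h1 h
  have hbe' := (hU b (by omega) le_rfl).1
  have hbnot : ¬ IsU p e₀ (b + 1) := by
    intro h
    refine hb (b + 1) (by omega) (by omega) fun x h1 h2 => ?_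
    rcases Nat.lt_or_ge b x with h' | h'
    · obtain rfl : x = b + 1 := by omega
      exact h
    · exact hbU x h1 h'
  have hanot : 0 < a → ¬ IsU p e₀ (a - 1) := by
    intro h0 h
    refine ha (a - 1) (by omega) fun x h1 h2 => ?_
    rcases Nat.lt_or_ge x a with h' | h'
    · obtain rfl : x = a - 1 := by omega
      exact h
    · exact haU x h' h2
  obtain ⟨s, hs, hs', x, y, h1, h2, h3, h4, h5, h6⟩ :=
    H.sep a b (by omega) (by omega) (by omega)
  have hx := hU x h1 h2
  have hy := hU y h3 h4
  have hyE := H.lt_E hy.1 hy.2.1 (e := n - 1) (by omega) (by omega)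
  have hsm : ¬ IsMax p s := by
    intro hm
    have := H.no_max_between hx (e := n - 1) (by omega) (by omega) hs hm h5
    omega
  have hse : s < e₀ := by
    by_contra hc
    have := H.lt_E hy.1 hy.2.1 (e := s) (by omega) hs
    omega
  have hsU : IsU p e₀ s := by
    rcases U_or_D hse hsm with h | h
    · exact h
    · have := H.D_lt_U h hx
      omega
  rcases hs' with hs' | hs'
  · have hne : s ≠ a - 1 := by
      rintro rfl
      exact hanot (by omega) hsU
    obtain ⟨-, -, -, -, -, -, -, hts, -⟩ := H.U_data hsU
    have haD : IsD p e₀ (a - 1) :=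
      (U_or_D (by omega) (H.not_isMax_of_t_lt (by omega) (by omega))).resolve_left
        (hanot (by omega))
    exact H.no_312 (c := s) (a := a - 1) (b := x) (by omega) (by omega) (by omega) hsm
      (H.D_lt_U haD hx) h5
  · have hne : s ≠ b + 1 := by
      rintro rfl
      exact hbnot hsU
    have hbD : IsD p e₀ (b + 1) :=
      (U_or_D (by omega) (H.not_isMax_of_t_lt (by omega) (by omega))).resolve_left hbnot
    exact H.no_312 (c := y) (a := b + 1) (b := s) (by omega) (by omega) hs hy.2.1
      (H.D_lt_U hbD hsU) h6

lemma U_lt_z {k : ℕ} (hk : IsU p e₀ k) : k < q 0 := by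
  have h1 := H.le_z hk.1 hk.2.1
  obtain ⟨-, hz0, -⟩ := H.z_facts
  rcases Nat.lt_or_ge k (q 0) with h | h
  · exact h
  · obtain rfl : k = q 0 := by omega
    obtain ⟨-, -, j, -, -, hj⟩ := hk
    omega

lemma D_succ_of_U {k : ℕ} (hk : IsU p e₀ k) : IsD p e₀ (k + 1) := by
  have h1 := H.U_lt_z hk
  have h2 := H.z_lt
  have he0 := H.e₀_lt
  obtain ⟨-, -, -, -, -, -, -, ht, -⟩ := H.U_data hk
  exact (U_or_D (by omega) (H.not_isMax_of_t_lt (by omega) (by omega))).resolve_left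
    (H.not_U_succ hk)

lemma U_mono {j k : ℕ} (hj : IsU p e₀ j) (hk : IsU p e₀ k) : p j < p k ↔ j < k := by
  have he0 := H.e₀_lt
  have key : ∀ {j k}, IsU p e₀ j → IsU p e₀ k → j < k → p j < p k := by
    intro j k hj hk hjk
    have hD := H.D_succ_of_U hj
    have hke := hk.1
    have hne := H.ne (show j < n by omega) (show k < n by omega) (by omega)
    have hne' : j + 1 ≠ k := by
      rintro rfl
      exact not_U_of_D hD hk
    by_contra hc
    exact H.no_312 (c := j) (a := j + 1) (b := k) (by omega) (by omega) (by omega) hj.2.1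
      (H.D_lt_U hD hk) (by omega)
  constructor
  · intro h
    by_contra hc
    rcases Nat.lt_or_ge k j with h' | h'
    · have := key hk hj h'; omega
    · obtain rfl : j = k := by omega
      omega
  · exact key hj hk

end Layout

end

/-! ### The word of a simple permutation is good -/

section

open Letter

/-- A layout together with the position `j₀` of the first entry that is not a left-to-right maximum
and the position `k` of the first entry larger than it. The main block consists of the positions
from `k` to `e₀ - 1`, and the entries before it are those of kind `F`. -/
structure Frame (n : ℕ) (p q : ℕ → ℕ) (e₀ j₀ k : ℕ) : Prop extends Layout n p q e₀ where
  not_max_j₀ : ¬ IsMax p j₀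
  max_of_lt_j₀ : ∀ i < j₀, IsMax p i
  k_gt : p j₀ < p k
  le_of_lt_k : ∀ i < k, p i ≤ p j₀
  j₀_le : j₀ ≤ q 0

lemma Layout.exists_frame {n : ℕ} {p q : ℕ → ℕ} {e₀ : ℕ} (H : Layout n p q e₀) :
    ∃ j₀ k, Frame n p q e₀ j₀ k := by
  obtain ⟨hz, -⟩ := H.z_facts
  obtain ⟨j₀, hj, hj1, hj2⟩ := exists_least (P := fun i => ¬ IsMax p i) H.not_isMax_z
  obtain ⟨m, hm, hlt⟩ := H.not_isMax (show j₀ < n by omega) hj1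
  obtain ⟨k, hk, hk1, hk2⟩ := exists_least (P := fun i => p j₀ < p i) hlt
  exact ⟨j₀, k, H, hj1, fun i hi => not_not.1 (hj2 i hi), hk1, fun i hi => not_lt.1 (hk2 i hi), hj⟩

namespace Frame

open SimpleAvoider

variable {n : ℕ} {p q : ℕ → ℕ} {e₀ j₀ k : ℕ} (H : Frame n p q e₀ j₀ k)

include H

lemma bounds : k < j₀ ∧ j₀ ≤ q 0 ∧ q 0 < e₀ ∧ e₀ < n := by
  have h1 := H.z_lt
  have h2 := H.e₀_lt
  have h3 := H.j₀_le
  refine ⟨?_, h3, h1, h2⟩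
  obtain ⟨m, hm, hlt⟩ := H.not_isMax (show j₀ < n by omega) H.not_max_j₀
  by_contra hc
  have := H.le_of_lt_k m (by omega)
  omega

lemma j₀_le_of_not_max {i : ℕ} (h : ¬ IsMax p i) : j₀ ≤ i := by
  by_contra hc
  exact h (H.max_of_lt_j₀ i (by omega))

lemma D_j₀ : IsD p e₀ j₀ := by
  obtain ⟨b1, b2, b3, b4⟩ := H.bounds
  refine ⟨by omega, H.not_max_j₀, ?_⟩
  rintro ⟨j, hj, hjm, -⟩
  exact hjm (H.max_of_lt_j₀ j hj)

lemma D_z : IsD p e₀ (q 0) := by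
  obtain ⟨b1, b2, b3, b4⟩ := H.bounds
  obtain ⟨-, hz0, -⟩ := H.z_facts
  refine ⟨b3, H.not_isMax_z, ?_⟩
  rintro ⟨j, hj, hjm, hlt⟩
  omega

lemma D_le {i : ℕ} (hi : IsD p e₀ i) : p i ≤ p j₀ := by
  rcases Nat.lt_or_ge j₀ i with h | h
  · exact ((H.D_anti hi H.D_j₀).2 h).le
  · have := H.j₀_le_of_not_max hi.2.1
    obtain rfl : i = j₀ := by omega
    exact le_rfl

lemma max_of_lt_k {i : ℕ} (hi : i < k) : IsMax p i := by
  have := H.bounds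
  exact H.max_of_lt_j₀ i (by omega)

lemma lt_of_lt_k {i : ℕ} (hi : i < k) : p i < p j₀ := by
  obtain ⟨b1, b2, b3, b4⟩ := H.bounds
  exact lt_of_le_of_ne (H.le_of_lt_k i hi) (H.ne (by omega) (by omega) (by omega))

lemma lt_max {i : ℕ} (hi : k ≤ i) (hm : IsMax p i) : p j₀ < p i := by
  have h := H.k_gt
  rcases Nat.lt_or_ge k i with h' | h'
  · exact h.trans (hm k h')
  · obtain rfl : k = i := by omega
    exact h

lemma lt_U {i : ℕ} (hi : IsU p e₀ i) : p j₀ < p i := H.D_lt_U H.D_j₀ hi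

lemma j₀_lt_E {i : ℕ} (hi : e₀ ≤ i) (hn : i < n) : p j₀ < p i :=
  H.lt_E H.D_j₀.1 H.not_max_j₀ hi hn

/-- Every entry below the first `D` is of kind `F` or `D`. -/
lemma below {x : ℕ} (hx : x < n) (h : p x < p j₀) : x < k ∨ IsD p e₀ x := by
  rcases Nat.lt_or_ge x e₀ with he | he
  · by_cases hm : IsMax p x
    · rcases Nat.lt_or_ge x k with hk | hk
      · exact Or.inl hk
      · have := H.lt_max hk hm; omega
    · rcases Layout.U_or_D he hm with h' | h'
      · have := H.lt_U h'; omega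
      · exact Or.inr h'
  · have := H.j₀_lt_E he hx; omega

/-- Every entry above the first `D` is of kind `M`, `U` or `E`. -/
lemma above {x : ℕ} (h : p j₀ < p x) :
    (k ≤ x ∧ x < e₀ ∧ IsMax p x) ∨ IsU p e₀ x ∨ e₀ ≤ x := by
  rcases Nat.lt_or_ge x e₀ with he | he
  · by_cases hm : IsMax p x
    · refine Or.inl ⟨?_, he, hm⟩
      by_contra hc
      have := H.lt_of_lt_k (i := x) (by omega)
      omega
    · rcases Layout.U_or_D he hm with h' | h'
      · exact Or.inr (Or.inl h')
      · have := H.D_le h'; omega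
  · exact Or.inr (Or.inr he)

lemma max_k : IsMax p k := H.max_of_lt_j₀ k H.bounds.1

/-- The entry directly below an `F` in value is of kind `D`. -/
lemma F_pred {i : ℕ} (hi : i < k) : IsD p e₀ (q (p i - 1)) ∧ p (q (p i - 1)) + 1 = p i := by
  obtain ⟨b1, b2, b3, b4⟩ := H.bounds
  obtain ⟨hz, hz0, -⟩ := H.z_facts
  have hne := H.ne (show i < n by omega) hz (by omega)
  have hpi := H.p_lt i (by omega)
  have hp := H.p_q (p i - 1) (by omega)
  have hq := H.q_lt (p i - 1) (by omega)
  refine ⟨?_, by omega⟩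
  have hlt := H.lt_of_lt_k hi
  rcases H.below hq (by omega) with h | h
  · exfalso
    have hm1 := H.max_of_lt_k h
    have hm2 := H.max_of_lt_k hi
    have h1 := (isMax_lt hm1 hm2).1 (by omega)
    rcases Nat.lt_or_ge (q (p i - 1)) (i - 1) with h' | h'
    · have h2 := (isMax_lt hm1 (H.max_of_lt_k (i := i - 1) (by omega))).2 h'
      have h3 := (isMax_lt (H.max_of_lt_k (i := i - 1) (by omega)) hm2).2 (by omega)
      omega
    · have h2 : q (p i - 1) = i - 1 := by omega
      have h3 := (H.no_bond (i := i - 1) (by omega)).1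
      rw [Nat.sub_add_cancel (by omega), ← h2] at h3
      omega
  · exact h

/-- The entry directly above an `E` in value is of kind `M`. -/
lemma E_succ {e : ℕ} (he : e₀ ≤ e) (hn : e < n) : k ≤ q (p e + 1) ∧ q (p e + 1) < e₀ ∧
    IsMax p (q (p e + 1)) ∧ p (q (p e + 1)) = p e + 1 := by
  obtain ⟨ht, ht0, ht1, ht2⟩ := H.t_facts
  have hte := H.t_lt
  have hne := H.ne hn ht (by omega)
  have hpe := H.p_lt e hn
  have hp := H.p_q (p e + 1) (by omega)
  have hq := H.q_lt (p e + 1) (by omega)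
  have hj := H.j₀_lt_E he hn
  rcases H.above (x := q (p e + 1)) (by omega) with h | h | h
  · exact ⟨h.1, h.2.1, h.2.2, hp⟩
  · have := H.lt_E h.1 h.2.1 he hn
    omega
  · exfalso
    have hlt : q (p e + 1) < e := by
      by_contra hc
      rcases Nat.lt_or_ge e (q (p e + 1)) with h' | h'
      · have := H.anti_E he h' hq; omega
      · have : q (p e + 1) = e := by omega
        rw [this] at hp; omega
    rcases Nat.lt_or_ge (q (p e + 1)) (e - 1) with h' | h'
    · have h2 := H.anti_E h h' (by omega)
      have h3 := H.anti_E (e := e - 1) (by omega) (f := e) (by omega) hn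
      omega
    · have h2 : q (p e + 1) = e - 1 := by omega
      have h3 := (H.no_bond (i := e - 1) (by omega)).2
      rw [Nat.sub_add_cancel (by omega), ← h2] at h3
      omega

end Frame

open Classical in
/-- The letter of the entry at position `i` of the main block. A letter has a hat if the entry
directly below a left-to-right maximum is of kind `E`, or the entry directly above a `D` is of kind
`F`. In the main block the subtraction in `p i - 1` is not truncated, because a left-to-right
maximum there is larger than the first `D`; and `p i + 1` is a value, because no `D` is the
maximum. -/
noncomputable def letterOf (p q : ℕ → ℕ) (e₀ k i : ℕ) : Letter :=
  if IsMax p i then (if e₀ ≤ q (p i - 1) then mh else m)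
  else if IsU p e₀ i then u
  else if q (p i + 1) < k then dh else d

/-- The word of a permutation: the letters of its main block `k, …, e₀ - 1` from left to right. -/
noncomputable def wordOf (p q : ℕ → ℕ) (e₀ k : ℕ) : List Letter :=
  (List.range (e₀ - k)).map fun j => letterOf p q e₀ k (k + j)

section
variable {p q : ℕ → ℕ} {e₀ k : ℕ}

lemma wordOf_length : (wordOf p q e₀ k).length = e₀ - k := by simp [wordOf]

lemma wordOf_get {j : ℕ} {a : Letter} :
    (wordOf p q e₀ k)[j]? = some a ↔ k + j < e₀ ∧ letterOf p q e₀ k (k + j) = a := by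
  rw [wordOf, List.getElem?_map]
  rcases Nat.lt_or_ge j (e₀ - k) with h | h
  · rw [List.getElem?_range h]
    simp only [Option.map_some, Option.some.injEq]
    exact ⟨fun h' => ⟨by omega, h'⟩, fun h' => h'.2⟩
  · rw [List.getElem?_eq_none (by simpa using h)]
    simp only [Option.map_none, reduceCtorEq, false_iff]
    omega

lemma letterOf_mh {i : ℕ} : letterOf p q e₀ k i = mh ↔ IsMax p i ∧ e₀ ≤ q (p i - 1) := by
  unfold letterOf
  split_ifs <;> simp_all

lemma letterOf_m {i : ℕ} : letterOf p q e₀ k i = m ↔ IsMax p i ∧ q (p i - 1) < e₀ := by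
  unfold letterOf
  split_ifs <;> simp_all

lemma letterOf_u {i : ℕ} : letterOf p q e₀ k i = u ↔ IsU p e₀ i := by
  unfold letterOf
  split_ifs with h1 h2 h3 h4 <;> simp_all [IsU]

lemma letterOf_d {i : ℕ} (hi : i < e₀) :
    letterOf p q e₀ k i = d ↔ IsD p e₀ i ∧ k ≤ q (p i + 1) := by
  have : IsD p e₀ i ↔ ¬ IsMax p i ∧ ¬ IsU p e₀ i := by
    exact ⟨fun h => ⟨h.2.1, Layout.not_U_of_D h⟩, fun h => (Layout.U_or_D hi h.1).resolve_left h.2⟩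
  rw [this]
  unfold letterOf
  split_ifs with h1 h2 h3 h4 <;> simp_all

lemma letterOf_dh {i : ℕ} (hi : i < e₀) :
    letterOf p q e₀ k i = dh ↔ IsD p e₀ i ∧ q (p i + 1) < k := by
  have : IsD p e₀ i ↔ ¬ IsMax p i ∧ ¬ IsU p e₀ i := by
    exact ⟨fun h => ⟨h.2.1, Layout.not_U_of_D h⟩, fun h => (Layout.U_or_D hi h.1).resolve_left h.2⟩
  rw [this]
  unfold letterOf
  split_ifs with h1 h2 h3 h4 <;> simp_all

lemma wordOf_mAt {j : ℕ} : MAt (wordOf p q e₀ k) j ↔ k + j < e₀ ∧ IsMax p (k + j) := by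
  rw [MAt, wordOf_get, wordOf_get, letterOf_m, letterOf_mh]
  constructor
  · rintro (h | h)
    · exact ⟨h.1, h.2.1⟩
    · exact ⟨h.1, h.2.1⟩
  · rintro ⟨h1, h2⟩
    rcases Nat.lt_or_ge (q (p (k + j) - 1)) e₀ with h | h
    · exact Or.inl ⟨h1, h2, h⟩
    · exact Or.inr ⟨h1, h2, h⟩

lemma wordOf_d {j : ℕ} : (wordOf p q e₀ k)[j]? = some d ↔
    IsD p e₀ (k + j) ∧ k ≤ q (p (k + j) + 1) := by
  rw [wordOf_get]
  constructor
  · rintro ⟨h1, h2⟩; exact (letterOf_d h1).1 h2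
  · intro h; exact ⟨h.1.1, (letterOf_d h.1.1).2 h⟩

lemma wordOf_dh {j : ℕ} : (wordOf p q e₀ k)[j]? = some dh ↔
    IsD p e₀ (k + j) ∧ q (p (k + j) + 1) < k := by
  rw [wordOf_get]
  constructor
  · rintro ⟨h1, h2⟩; exact (letterOf_dh h1).1 h2
  · intro h; exact ⟨h.1.1, (letterOf_dh h.1.1).2 h⟩

lemma wordOf_dAt {j : ℕ} : DAt (wordOf p q e₀ k) j ↔ IsD p e₀ (k + j) := by
  rw [DAt, wordOf_d, wordOf_dh]
  constructor
  · rintro (h | h)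
    · exact h.1
    · exact h.1
  · intro h
    rcases Nat.lt_or_ge (q (p (k + j) + 1)) k with h' | h'
    · exact Or.inr ⟨h, h'⟩
    · exact Or.inl ⟨h, h'⟩

lemma wordOf_u {j : ℕ} : (wordOf p q e₀ k)[j]? = some u ↔ IsU p e₀ (k + j) := by
  rw [wordOf_get, letterOf_u]
  exact ⟨fun h => h.2, fun h => ⟨h.1, h⟩⟩

lemma wordOf_m {j : ℕ} : (wordOf p q e₀ k)[j]? = some m ↔
    k + j < e₀ ∧ IsMax p (k + j) ∧ q (p (k + j) - 1) < e₀ := by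
  rw [wordOf_get, letterOf_m]

lemma wordOf_mh {j : ℕ} : (wordOf p q e₀ k)[j]? = some mh ↔
    k + j < e₀ ∧ IsMax p (k + j) ∧ e₀ ≤ q (p (k + j) - 1) := by
  rw [wordOf_get, letterOf_mh]

end

namespace Frame

open SimpleAvoider

variable {n : ℕ} {p q : ℕ → ℕ} {e₀ j₀ k : ℕ} (H : Frame n p q e₀ j₀ k)

include H

/-- If an `M` is not directly above an `E` in value, then the entry directly below it is
again an `M`, provided that some entry `y`, not below the first `D`, shows that there is
still room for it. -/
lemma pred_plain {x y : ℕ} (hx : x < e₀) (hm : IsMax p x) (hq : q (p x - 1) < e₀)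
    (hyj : p j₀ ≤ p y) (hy : p y + 1 < p x) :
    IsMax p (q (p x - 1)) ∧ q (p x - 1) < x ∧ p y < p (q (p x - 1)) ∧ k ≤ q (p x - 1) := by
  obtain ⟨b1, b2, b3, b4⟩ := H.bounds
  have hpx := H.p_lt x (by omega)
  have hp := H.p_q (p x - 1) (by omega)
  have hqn := H.q_lt (p x - 1) (by omega)
  rcases H.above (x := q (p x - 1)) (by omega) with h | h | h
  · refine ⟨h.2.2, (isMax_lt h.2.2 hm).1 (by omega), by omega, h.1⟩
  · exfalso
    have h1 := H.no_max_between h (e := n - 1) (by omega) (by omega) (show x < n by omega) hm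
      (by omega)
    have h2 := H.lt_E h.1 h.2.1 (e := n - 1) (by omega) (by omega)
    omega
  · omega

/-- The first `D` has no hat, because an `F` is smaller than it. -/
lemma d_j₀ : (wordOf p q e₀ k)[j₀ - k]? = some d := by
  obtain ⟨b1, b2, b3, b4⟩ := H.bounds
  rw [wordOf_d, Nat.add_sub_cancel' (by omega)]
  refine ⟨H.D_j₀, ?_⟩
  by_contra hc
  have h1 := H.lt_of_lt_k (not_le.1 hc)
  have h2 := H.k_gt
  have h3 := H.p_lt k (by omega)
  have h4 := H.p_q (p j₀ + 1) (by omega)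
  omega

/-- The word of a simple permutation in the class is good: the local conditions hold because
adjacent entries are not adjacent in value (`SimpleAvoider.no_bond`), the other ones by the
relative order of the kinds. -/
lemma goodWord : GoodWord (wordOf p q e₀ k) := by
  obtain ⟨b1, b2, b3, b4⟩ := H.bounds
  obtain ⟨hz, hz0, hz1, hz2⟩ := H.z_facts
  obtain ⟨ht, ht0, ht1, ht2⟩ := H.t_facts
  have hte := H.t_lt
  constructor
  · exact wordOf_mAt.2 ⟨by omega, H.max_k⟩
  · intro j h
    obtain ⟨h1, h2, h3⟩ := wordOf_m.1 h
    rw [← add_assoc] at h1 h2 h3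
    refine wordOf_dAt.2 ?_
    by_contra hD
    by_cases hm : IsMax p (k + j)
    · have hlt := h2 (k + j) (by omega)
      have hb := (H.no_bond (i := k + j) (by omega)).1
      obtain ⟨g1, g2, g3, g4⟩ := H.pred_plain h1 h2 h3 (y := k + j)
        (H.lt_max (by omega) hm).le (by omega)
      have := (isMax_lt hm g1).1 g3
      omega
    · have hU := (Layout.U_or_D (by omega) hm).resolve_right hD
      obtain ⟨-, -, -, -, -, -, -, htU, -⟩ := H.U_data hU
      exact H.not_isMax_of_t_lt (by omega) (by omega) h2
  · intro j h h'
    obtain ⟨h1, h2⟩ := wordOf_d.1 h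
    rw [← add_assoc] at h1 h2
    have h3 := wordOf_dAt.1 h'
    have h1e := h1.1
    have hlt := (H.D_anti h1 h3).2 (by omega)
    have hb := (H.no_bond (i := k + j) (by omega)).2
    have hpk := H.p_lt (k + j) (by omega)
    have hp := H.p_q (p (k + j + 1) + 1) (by omega)
    have hqn := H.q_lt (p (k + j + 1) + 1) (by omega)
    have hle := H.D_le h3
    rcases H.below hqn (by omega) with h4 | h4
    · omega
    · have := (H.D_anti h1 h4).1 (by omega)
      have := (H.D_anti h4 h3).1 (by omega)
      omega
  · intro j h
    exact wordOf_dAt.2 (H.D_succ_of_U (wordOf_u.1 h))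
  · intro j h
    obtain ⟨h1, h2⟩ := wordOf_dh.1 h
    refine ⟨j₀ - k, ?_, H.d_j₀⟩
    have h3 := H.j₀_le_of_not_max h1.2.1
    have h4 : j₀ - k ≠ j := by
      rintro rfl
      have := H.d_j₀
      rw [h] at this
      simp at this
    omega
  · intro j h
    obtain ⟨h1, h2, i, hi, him, -⟩ := wordOf_u.1 h
    have h3 := H.j₀_le_of_not_max him
    exact ⟨j₀ - k, by omega, H.d_j₀⟩
  · intro i j h hij hm
    obtain ⟨h1, h2⟩ := wordOf_mAt.1 hm
    obtain ⟨-, -, -, -, -, -, -, htU, -⟩ := H.U_data (wordOf_u.1 h)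
    exact H.not_isMax_of_t_lt (by omega) (by omega) h2
  · intro j i l hj hi hl
    have he := H.e₀_eq_of_U (wordOf_u.1 hj)
    have key : ∀ i : ℕ, (wordOf p q e₀ k)[i]? = some mh → p (k + i) = p (n - 1) + 1 := by
      intro i hi
      obtain ⟨h1, h2, h3⟩ := wordOf_mh.1 hi
      have hpk := H.p_lt (k + i) (by omega)
      have h4 := H.lt_max (by omega) h2
      have hp := H.p_q (p (k + i) - 1) (by omega)
      have hq := H.q_lt (p (k + i) - 1) (by omega)
      have : q (p (k + i) - 1) = n - 1 := by omega
      rw [this] at hp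
      omega
    have h1 := key i hi
    have h2 := key l hl
    have h3 := (wordOf_mh.1 hi).1
    have h4 := (wordOf_mh.1 hl).1
    have := H.eq (i := k + i) (j := k + l) (by omega) (by omega) (by omega)
    omega
  · intro h0 h1
    obtain ⟨g1, g2, g3⟩ := wordOf_m.1 h0
    have hD := wordOf_dAt.1 (Or.inl h1)
    have hj : k + 1 = j₀ := by
      have := H.j₀_le_of_not_max hD.2.1
      omega
    rw [add_zero] at g1 g2 g3
    have hb := (H.no_bond (i := k) (by omega)).2
    rw [hj] at hb
    have hk := H.k_gt
    obtain ⟨f1, f2, f3, f4⟩ := H.pred_plain g1 g2 g3 (y := j₀) le_rfl (by omega)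
    omega
  · intro h0 h1 h2
    obtain ⟨g1, g2, g3⟩ := wordOf_mh.1 h0
    have hD := wordOf_dAt.1 (Or.inl h1)
    have hU := wordOf_u.1 h2
    have hj : k + 1 = j₀ := by
      have := H.j₀_le_of_not_max hD.2.1
      omega
    rw [add_zero] at g1 g2 g3
    have he := H.e₀_eq_of_U hU
    have hUe := hU.1
    have hUlt := H.lt_E hU.1 hU.2.1 (e := n - 1) (by omega) (by omega)
    have hpk := H.p_lt k (by omega)
    have hk := H.k_gt
    have hp := H.p_q (p k - 1) (by omega)
    have hq := H.q_lt (p k - 1) (by omega)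
    have hqn : q (p k - 1) = n - 1 := by omega
    rw [hqn] at hp
    have hb := (H.no_bond (i := k + 1) (by omega)).1
    have hlt := H.lt_U hU
    rw [hj] at hb
    rw [show k + 2 = j₀ + 1 by omega] at *
    have hp' := H.p_q (p j₀ + 1) (by omega)
    have hq' := H.q_lt (p j₀ + 1) (by omega)
    rcases H.above (x := q (p j₀ + 1)) (by omega) with h | h | h
    · have : p k ≤ p (q (p j₀ + 1)) := by
        rcases Nat.lt_or_ge k (q (p j₀ + 1)) with h' | h'
        · exact (h.2.2 k h').le
        · rw [show q (p j₀ + 1) = k by omega]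
      omega
    · have h4 := (H.U_mono h hU).1 (by omega)
      have h5 := H.j₀_le_of_not_max h.2.1
      have h6 : q (p j₀ + 1) ≠ j₀ := by
        intro h7
        rw [h7] at h
        exact Layout.not_U_of_D H.D_j₀ h
      omega
    · have := H.lt_E hU.1 hU.2.1 h hq'
      omega
  · refine ⟨e₀ - 1 - k, by rw [wordOf_length]; omega, ?_⟩
    have hk' : k + (e₀ - 1 - k) = e₀ - 1 := by omega
    rw [← or_assoc]
    rcases H.e₀_pred with h | h
    · left
      refine wordOf_dAt.2 ?_
      rw [hk', h]
      exact H.D_z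
    · right
      refine wordOf_m.2 ?_
      rw [hk']
      refine ⟨by omega, by rw [h]; exact H.isMax_t, ?_⟩
      by_contra hc
      rw [h, ht0] at hc
      have h3 := H.three_le
      have hp := H.p_q (n - 1 - 1) (by omega)
      have hq := H.q_lt (n - 1 - 1) (by omega)
      have hqe : q (n - 1 - 1) = e₀ := by
        by_contra hne
        have h4 := H.anti_E (e := e₀) le_rfl (f := q (n - 1 - 1)) (by omega) hq
        have h5 := H.p_lt e₀ b4
        have h6 : p e₀ = p (q (n - 1)) := by omega
        have := H.eq b4 ht h6
        omega
      rw [hqe] at hp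
      have hb := (H.no_bond (i := e₀ - 1) (by omega)).2
      rw [Nat.sub_add_cancel (by omega), h] at hb
      omega
  · exact ⟨_, H.d_j₀⟩
  · intro hw
    have hl := congrArg List.length hw
    rw [wordOf_length] at hl
    simp only [List.length_cons, List.length_nil] at hl
    have hzk : q 0 = k + 1 := by omega
    have hjz : j₀ = k + 1 := by omega
    have htk : q (n - 1) = k := by
      rcases H.above (x := q (n - 1))
          (by have := H.k_gt; have := H.p_lt k (by omega); omega) with h | h | h
      · have : q (n - 1) ≠ k + 1 := by
          intro h'
          rw [h', ← hzk] at h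
          exact H.not_isMax_z h.2.2
        omega
      · exact absurd H.isMax_t h.2.1
      · omega
    obtain ⟨f1, f2⟩ := H.F_pred (i := 0) (by omega)
    have f3 := H.j₀_le_of_not_max f1.2.1
    have f4 := f1.1
    have f5 : q (p 0 - 1) = q 0 := by omega
    rw [f5, hz0] at f2
    have h1 : (wordOf p q e₀ k)[1]? = some d := by rw [hw]; rfl
    have h2 := (wordOf_d.1 h1).2
    rw [← hzk, hz0, f2, H.q_p 0 (by omega)] at h2
    omega

end Frame

end

/-! ### Every simple permutation in the class comes from its word -/

section

open Letter Kind
open Equiv (Perm)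

open Classical in
/-- The point of the word that corresponds to the entry at position `i`. Entries before
and after the main block belong to the letter of the entry directly below, respectively
above them in value. -/
noncomputable def pointOf (p q : ℕ → ℕ) (e₀ k i : ℕ) : Pt :=
  if i < k then ⟨q (p i - 1) - k, F⟩
  else if i < e₀ then ⟨i - k, if IsMax p i then M else if IsU p e₀ i then U else D⟩
  else ⟨q (p i + 1) - k, E⟩

namespace Frame

open SimpleAvoider

variable {n : ℕ} {p q : ℕ → ℕ} {e₀ j₀ k : ℕ} (H : Frame n p q e₀ j₀ k)

include H

omit H in
lemma pointOf_F {i : ℕ} (hi : i < k) : pointOf p q e₀ k i = ⟨q (p i - 1) - k, F⟩ := by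
  simp [pointOf, hi]

omit H in
lemma pointOf_M {i : ℕ} (h1 : k ≤ i) (h2 : i < e₀) (h3 : IsMax p i) :
    pointOf p q e₀ k i = ⟨i - k, M⟩ := by
  simp [pointOf, not_lt.2 h1, h2, h3]

lemma le_of_U {i : ℕ} (h : IsU p e₀ i) : k ≤ i := by
  have := H.j₀_le_of_not_max h.2.1
  have := H.bounds
  omega

lemma le_of_D {i : ℕ} (h : IsD p e₀ i) : k ≤ i := by
  have := H.j₀_le_of_not_max h.2.1
  have := H.bounds
  omega

lemma pointOf_U {i : ℕ} (h : IsU p e₀ i) : pointOf p q e₀ k i = ⟨i - k, U⟩ := by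
  simp [pointOf, not_lt.2 (H.le_of_U h), h.1, h.2.1, h]

lemma pointOf_D {i : ℕ} (h : IsD p e₀ i) : pointOf p q e₀ k i = ⟨i - k, D⟩ := by
  simp [pointOf, not_lt.2 (H.le_of_D h), h.1, h.2.1, Layout.not_U_of_D h]

lemma pointOf_E {i : ℕ} (h : e₀ ≤ i) : pointOf p q e₀ k i = ⟨q (p i + 1) - k, E⟩ := by
  have := H.bounds
  simp [pointOf, not_lt.2 h, show ¬ i < k by omega]

omit H in
lemma point_cases (p : ℕ → ℕ) (e₀ k i : ℕ) :
    i < k ∨ (k ≤ i ∧ i < e₀ ∧ IsMax p i) ∨ IsU p e₀ i ∨ IsD p e₀ i ∨ e₀ ≤ i := by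
  rcases Nat.lt_or_ge i k with h | h
  · exact Or.inl h
  rcases Nat.lt_or_ge i e₀ with h' | h'
  · by_cases hm : IsMax p i
    · exact Or.inr (Or.inl ⟨h, h', hm⟩)
    · exact Or.inr (Or.inr ((Layout.U_or_D h' hm).imp id Or.inl))
  · exact Or.inr (Or.inr (Or.inr (Or.inr h')))

lemma mh_of_E {e : ℕ} (he : e₀ ≤ e) (hn : e < n) :
    (wordOf p q e₀ k)[q (p e + 1) - k]? = some mh := by
  obtain ⟨h1, h2, h3, h4⟩ := H.E_succ he hn
  rw [wordOf_mh, Nat.add_sub_cancel' h1, h4, Nat.add_sub_cancel, H.q_p e hn]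
  exact ⟨h2, h3, he⟩

lemma dh_of_F {i : ℕ} (hi : i < k) : (wordOf p q e₀ k)[q (p i - 1) - k]? = some dh := by
  obtain ⟨h1, h2⟩ := H.F_pred hi
  have hb := H.bounds
  have := H.le_of_D h1
  rw [wordOf_dh, Nat.add_sub_cancel' this, h2, H.q_p i (by omega)]
  exact ⟨h1, hi⟩

/-- If there is an entry of kind `U`, then the first `mh` belongs to the only `E`. -/
lemma idxOf_eq_of_U {j e : ℕ} (hj : IsU p e₀ j) (he : e₀ ≤ e) (hn : e < n) :
    (wordOf p q e₀ k).idxOf mh = q (p e + 1) - k := by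
  have hw := H.goodWord
  obtain ⟨i, hi, hbefore, -⟩ := hw.exists_first_d
  have hju : (wordOf p q e₀ k)[j - k]? = some u := by
    rw [wordOf_u, Nat.add_sub_cancel' (H.le_of_U hj)]
    exact hj
  exact hw.u_mh _ _ _ hju (hw.first_mh hi hbefore).1 (H.mh_of_E he hn)

lemma pointOf_mem {i : ℕ} (hi : i < n) : pointOf p q e₀ k i ∈ pts (wordOf p q e₀ k) := by
  rcases point_cases p e₀ k i with h | ⟨h1, h2, h3⟩ | h | h | h
  · rw [pointOf_F h, mem_pts_F]
    exact H.dh_of_F h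
  · rw [pointOf_M h1 h2 h3, mem_pts_M]
    refine wordOf_mAt.2 ?_
    rw [Nat.add_sub_cancel' h1]
    exact ⟨h2, h3⟩
  · rw [H.pointOf_U h, mem_pts_U, wordOf_u, Nat.add_sub_cancel' (H.le_of_U h)]
    exact h
  · rw [H.pointOf_D h, mem_pts_D]
    refine wordOf_dAt.2 ?_
    rw [Nat.add_sub_cancel' (H.le_of_D h)]
    exact h
  · rw [H.pointOf_E h, mem_pts_E]
    exact H.mh_of_E h hi

lemma pointOf_surj {x : Pt} (hx : x ∈ pts (wordOf p q e₀ k)) :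
    ∃ i < n, pointOf p q e₀ k i = x := by
  obtain ⟨j, κ⟩ := x
  have hb := H.bounds
  cases κ
  · rw [mem_pts_M] at hx
    obtain ⟨h1, h2⟩ := wordOf_mAt.1 hx
    exact ⟨k + j, by omega, by rw [pointOf_M (by omega) h1 h2, Nat.add_sub_cancel_left]⟩
  · rw [mem_pts_D] at hx
    have h1 := wordOf_dAt.1 hx
    have := h1.1
    exact ⟨k + j, by omega, by rw [H.pointOf_D h1, Nat.add_sub_cancel_left]⟩
  · rw [mem_pts_U, wordOf_u] at hx
    have := hx.1
    exact ⟨k + j, by omega, by rw [H.pointOf_U hx, Nat.add_sub_cancel_left]⟩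
  · rw [mem_pts_E, wordOf_mh] at hx
    obtain ⟨h1, h2, h3⟩ := hx
    have h4 := H.lt_max (by omega) h2
    have h5 := H.p_lt (k + j) (by omega)
    have h6 := H.p_q (p (k + j) - 1) (by omega)
    refine ⟨q (p (k + j) - 1), H.q_lt _ (by omega), ?_⟩
    rw [H.pointOf_E h3, h6, Nat.sub_add_cancel (by omega), H.q_p _ (by omega),
      Nat.add_sub_cancel_left]
  · rw [mem_pts_F, wordOf_dh] at hx
    obtain ⟨h1, h2⟩ := hx
    have h3 := h1.1
    have h4 := H.D_le h1
    have h5 := H.k_gt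
    have h6 := H.p_lt k (by omega)
    have h7 := H.p_q (p (k + j) + 1) (by omega)
    refine ⟨q (p (k + j) + 1), by omega, ?_⟩
    rw [pointOf_F h2, h7, Nat.add_sub_cancel, H.q_p _ (by omega), Nat.add_sub_cancel_left]

/-- The map `pointOf` preserves the order of positions; the cases are those of the two kinds. -/
lemma pos_lt {i j : ℕ} (hij : i < j) (hj : j < n) :
    pos (wordOf p q e₀ k) (pointOf p q e₀ k i) < pos (wordOf p q e₀ k) (pointOf p q e₀ k j) := by
  have hb := H.bounds
  have hFD : ∀ {i}, i < k → k ≤ q (p i - 1) := fun hi => H.le_of_D (H.F_pred hi).1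
  rcases point_cases p e₀ k i with hi | ⟨hi1, hi2, hi3⟩ | hi | hi | hi <;>
    rcases point_cases p e₀ k j with hj' | ⟨hj1, hj2, hj3⟩ | hj' | hj' | hj'
  · obtain ⟨f1, f2⟩ := H.F_pred hi
    obtain ⟨g1, g2⟩ := H.F_pred hj'
    have h1 := (isMax_lt (H.max_of_lt_k hi) (H.max_of_lt_k hj')).2 hij
    have h2 := (H.D_anti f1 g1).1 (by omega)
    have := hFD hi
    have := hFD hj'
    rw [pointOf_F hi, pointOf_F hj']
    simp only [pos]; omega
  · have := hFD hi
    rw [pointOf_F hi, pointOf_M hj1 hj2 hj3]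
    simp only [pos]; omega
  · rw [pointOf_F hi, H.pointOf_U hj']
    simp only [pos]; omega
  · rw [pointOf_F hi, H.pointOf_D hj']
    simp only [pos]; omega
  · obtain ⟨f1, f2, -⟩ := H.E_succ hj' hj
    rw [pointOf_F hi, H.pointOf_E hj']
    simp only [pos, wordOf_length]; omega
  · omega
  · rw [pointOf_M hi1 hi2 hi3, pointOf_M hj1 hj2 hj3]
    simp only [pos]; omega
  · have := H.le_of_U hj'
    rw [pointOf_M hi1 hi2 hi3, H.pointOf_U hj']
    simp only [pos]; omega
  · rw [pointOf_M hi1 hi2 hi3, H.pointOf_D hj']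
    simp only [pos]; omega
  · obtain ⟨f1, f2, -⟩ := H.E_succ hj' hj
    rw [pointOf_M hi1 hi2 hi3, H.pointOf_E hj']
    simp only [pos, wordOf_length]; omega
  · have := H.le_of_U hi
    omega
  · have := H.le_of_U hi
    rw [H.pointOf_U hi, pointOf_M hj1 hj2 hj3]
    simp only [pos]; omega
  · have := H.le_of_U hi
    rw [H.pointOf_U hi, H.pointOf_U hj']
    simp only [pos]; omega
  · have := H.le_of_U hi
    rw [H.pointOf_U hi, H.pointOf_D hj']
    simp only [pos]; omega
  · obtain ⟨f1, f2, -⟩ := H.E_succ hj' hj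
    have := hi.1
    rw [H.pointOf_U hi, H.pointOf_E hj']
    simp only [pos, wordOf_length]; omega
  · have := H.le_of_D hi
    omega
  · have := H.le_of_D hi
    rw [H.pointOf_D hi, pointOf_M hj1 hj2 hj3]
    simp only [pos]; omega
  · have := H.le_of_D hi
    rw [H.pointOf_D hi, H.pointOf_U hj']
    simp only [pos]; omega
  · have := H.le_of_D hi
    rw [H.pointOf_D hi, H.pointOf_D hj']
    simp only [pos]; omega
  · obtain ⟨f1, f2, -⟩ := H.E_succ hj' hj
    have := hi.1
    rw [H.pointOf_D hi, H.pointOf_E hj']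
    simp only [pos, wordOf_length]; omega
  · omega
  · omega
  · have := hj'.1
    omega
  · have := hj'.1
    omega
  · obtain ⟨f1, f2, f3, f4⟩ := H.E_succ hi (by omega)
    obtain ⟨g1, g2, g3, g4⟩ := H.E_succ hj' hj
    have h1 := H.anti_E hi hij hj
    have h2 := (isMax_lt g3 f3).1 (by omega)
    rw [H.pointOf_E hi, H.pointOf_E hj']
    simp only [pos, wordOf_length]; omega

/-- Entries of kind `M`, `U` and `E` are larger than the first `D`. -/
lemma upper {i : ℕ} (hn : i < n) (h : (k ≤ i ∧ i < e₀ ∧ IsMax p i) ∨ IsU p e₀ i ∨ e₀ ≤ i) :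
    p j₀ < p i := by
  rcases h with h | h | h
  · exact H.lt_max h.1 h.2.2
  · exact H.lt_U h
  · exact H.j₀_lt_E h hn

/-- The map `pointOf` preserves the order of values; the cases are those of the two kinds. -/
lemma val_lt {i j : ℕ} (hi : i < n) (hj : j < n) (hij : p i < p j) :
    val (wordOf p q e₀ k) (pointOf p q e₀ k i) < val (wordOf p q e₀ k) (pointOf p q e₀ k j) := by
  have hb := H.bounds
  have hFD : ∀ {i}, i < k → k ≤ q (p i - 1) := fun hi => H.le_of_D (H.F_pred hi).1
  rcases point_cases p e₀ k i with hi' | hi' | hi' | hi' | hi' <;>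
    rcases point_cases p e₀ k j with hj' | hj' | hj' | hj' | hj'
  · obtain ⟨f1, f2⟩ := H.F_pred hi'
    obtain ⟨g1, g2⟩ := H.F_pred hj'
    have h2 := (H.D_anti f1 g1).1 (by omega)
    have := hFD hi'
    have := hFD hj'
    rw [pointOf_F hi', pointOf_F hj']
    simp only [val, Prod.Lex.toLex_lt_toLex]; omega
  · rw [pointOf_F hi', pointOf_M hj'.1 hj'.2.1 hj'.2.2]
    simp only [val, Prod.Lex.toLex_lt_toLex]; omega
  · rw [pointOf_F hi', H.pointOf_U hj']
    simp only [val, Prod.Lex.toLex_lt_toLex]; omega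
  · obtain ⟨f1, f2⟩ := H.F_pred hi'
    have h2 := (H.D_anti f1 hj').1 (by omega)
    have := hFD hi'
    have := H.le_of_D hj'
    rw [pointOf_F hi', H.pointOf_D hj']
    simp only [val, Prod.Lex.toLex_lt_toLex]; omega
  · rw [pointOf_F hi', H.pointOf_E hj']
    simp only [val, Prod.Lex.toLex_lt_toLex]; omega
  · have := H.upper hi (Or.inl hi')
    have := H.lt_of_lt_k hj'
    omega
  · have := (isMax_lt hi'.2.2 hj'.2.2).1 hij
    rw [pointOf_M hi'.1 hi'.2.1 hi'.2.2, pointOf_M hj'.1 hj'.2.1 hj'.2.2]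
    simp only [val, Prod.Lex.toLex_lt_toLex]; omega
  · obtain ⟨g1, g2, g3, g4⟩ := H.E_succ (e := n - 1) (by omega) (by omega)
    have h1 := H.lt_E hj'.1 hj'.2.1 (e := n - 1) (by omega) (by omega)
    have h2 := (isMax_lt hi'.2.2 g3).1 (by omega)
    rw [pointOf_M hi'.1 hi'.2.1 hi'.2.2, H.pointOf_U hj']
    simp only [val, Prod.Lex.toLex_lt_toLex,
      H.idxOf_eq_of_U hj' (e := n - 1) (by omega) (by omega)]
    omega
  · have := H.upper hi (Or.inl hi')
    have := H.D_le hj'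
    omega
  · obtain ⟨g1, g2, g3, g4⟩ := H.E_succ hj' hj
    have h2 := (isMax_lt hi'.2.2 g3).1 (by omega)
    rw [pointOf_M hi'.1 hi'.2.1 hi'.2.2, H.pointOf_E hj']
    simp only [val, Prod.Lex.toLex_lt_toLex]; omega
  · have := H.upper hi (Or.inr (Or.inl hi'))
    have := H.lt_of_lt_k hj'
    omega
  · obtain ⟨g1, g2, g3, g4⟩ := H.E_succ (e := n - 1) (by omega) (by omega)
    have h1 := H.no_max_between hi' (e := n - 1) (by omega) (by omega) hj hj'.2.2 hij
    have h2 : q (p (n - 1) + 1) ≤ j := by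
      by_contra hc
      have := (isMax_lt hj'.2.2 g3).2 (by omega)
      omega
    have hiL := hi'.1
    rw [H.pointOf_U hi', pointOf_M hj'.1 hj'.2.1 hj'.2.2]
    simp only [val, Prod.Lex.toLex_lt_toLex,
      H.idxOf_eq_of_U hi' (e := n - 1) (by omega) (by omega)]
    omega
  · have := (H.U_mono hi' hj').1 hij
    have := H.le_of_U hi'
    rw [H.pointOf_U hi', H.pointOf_U hj']
    simp only [val, Prod.Lex.toLex_lt_toLex, true_and]; omega
  · have := H.upper hi (Or.inr (Or.inl hi'))
    have := H.D_le hj'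
    omega
  · have := H.le_of_U hi'
    have hiL := hi'.1
    rw [H.pointOf_U hi', H.pointOf_E hj']
    simp only [val, Prod.Lex.toLex_lt_toLex, H.idxOf_eq_of_U hi' hj' hj, wordOf_length, true_and]
    omega
  · obtain ⟨f1, f2⟩ := H.F_pred hj'
    have h2 : q (p j - 1) ≤ i := by
      by_contra hc
      have := (H.D_anti f1 hi').2 (by omega)
      omega
    have := hFD hj'
    rw [H.pointOf_D hi', pointOf_F hj']
    simp only [val, Prod.Lex.toLex_lt_toLex]; omega
  · rw [H.pointOf_D hi', pointOf_M hj'.1 hj'.2.1 hj'.2.2]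
    simp only [val, Prod.Lex.toLex_lt_toLex]; omega
  · rw [H.pointOf_D hi', H.pointOf_U hj']
    simp only [val, Prod.Lex.toLex_lt_toLex]; omega
  · have := (H.D_anti hi' hj').1 hij
    have := H.le_of_D hj'
    rw [H.pointOf_D hi', H.pointOf_D hj']
    simp only [val, Prod.Lex.toLex_lt_toLex]; omega
  · rw [H.pointOf_D hi', H.pointOf_E hj']
    simp only [val, Prod.Lex.toLex_lt_toLex]; omega
  · have := H.upper hi (Or.inr (Or.inr hi'))
    have := H.lt_of_lt_k hj'
    omega
  · obtain ⟨g1, g2, g3, g4⟩ := H.E_succ hi' hi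
    have h2 : q (p i + 1) ≤ j := by
      by_contra hc
      have := (isMax_lt hj'.2.2 g3).2 (by omega)
      omega
    rw [H.pointOf_E hi', pointOf_M hj'.1 hj'.2.1 hj'.2.2]
    simp only [val, Prod.Lex.toLex_lt_toLex]; omega
  · have := H.lt_E hj'.1 hj'.2.1 hi' hi
    omega
  · have := H.upper hi (Or.inr (Or.inr hi'))
    have := H.D_le hj'
    omega
  · obtain ⟨f1, f2, f3, f4⟩ := H.E_succ hi' hi
    obtain ⟨g1, g2, g3, g4⟩ := H.E_succ hj' hj
    have h2 := (isMax_lt f3 g3).1 (by omega)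
    rw [H.pointOf_E hi', H.pointOf_E hj']
    simp only [val, Prod.Lex.toLex_lt_toLex]; omega

end Frame

/-- The one-line notation of `π` as a function on `ℕ`, extended by the identity. -/
def toFun {n : ℕ} (π : Perm (Fin n)) (i : ℕ) : ℕ := if h : i < n then π ⟨i, h⟩ else i

lemma toFun_of_lt {n : ℕ} (π : Perm (Fin n)) {i : ℕ} (h : i < n) : toFun π i = π ⟨i, h⟩ := by
  simp [toFun, h]

lemma toFun_lt {n : ℕ} (π : Perm (Fin n)) {i : ℕ} (h : i < n) : toFun π i < n := by
  rw [toFun_of_lt π h]; exact (π ⟨i, h⟩).2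

open PermPattern

/-- A block of at least two, but not all, positions of a simple permutation is separated in value
by an entry outside it. -/
lemma exists_separator {n : ℕ} {π : Perm (Fin n)} (hs : IsSimple π) {a b : Fin n} (hab : a < b)
    (hne : Finset.Icc a b ≠ Finset.univ) : ∃ s, s ∉ Finset.Icc a b ∧
      ∃ i ∈ Finset.Icc a b, ∃ j ∈ Finset.Icc a b, π i < π s ∧ π s < π j := by
  by_contra hc
  push Not at hc
  have hneI : (Finset.Icc a b).Nonempty := ⟨a, by simp [hab.le]⟩
  have him : ((Finset.Icc a b).image π).Nonempty := hneI.image _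
  have hint : IsInterval π (Finset.Icc a b) := by
    refine ⟨hneI, ⟨a, b, rfl⟩, ((Finset.Icc a b).image π).min' him,
      ((Finset.Icc a b).image π).max' him, ?_⟩
    ext v
    constructor
    · intro hv
      exact Finset.mem_Icc.2 ⟨Finset.min'_le _ _ hv, Finset.le_max' _ _ hv⟩
    · intro hv
      rw [Finset.mem_Icc] at hv
      by_contra hv'
      obtain ⟨i, hi, hi'⟩ := Finset.mem_image.1 (Finset.min'_mem _ him)
      obtain ⟨j, hj, hj'⟩ := Finset.mem_image.1 (Finset.max'_mem _ him)
      have hs : π.symm v ∉ Finset.Icc a b := fun h =>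
        hv' (Finset.mem_image.2 ⟨_, h, by simp⟩)
      have h1 : π i < π (π.symm v) := by
        rw [Equiv.apply_symm_apply]
        refine lt_of_le_of_ne (hi' ▸ hv.1) ?_
        rintro rfl
        exact hv' (Finset.mem_image.2 ⟨i, hi, rfl⟩)
      have h2 := hc _ hs i hi j hj h1
      rw [Equiv.apply_symm_apply] at h2
      have h3 : v = π j := le_antisymm (hj' ▸ hv.2) h2
      exact hv' (Finset.mem_image.2 ⟨j, hj, h3.symm⟩)
  rcases hs _ hint with h | h
  · have h2 : 1 < (Finset.Icc a b).card :=
      Finset.one_lt_card.2 ⟨a, by simp [hab.le], b, by simp [hab.le], hab.ne⟩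
    omega
  · apply hne
    rw [← Finset.card_eq_iff_eq_univ, h, Fintype.card_fin]

lemma contains_of_four {n : ℕ} {π : Perm (Fin n)} {τ : Perm (Fin 4)} {x₀ x₁ x₂ x₃ : Fin n}
    (h01 : x₀ < x₁) (h12 : x₁ < x₂) (h23 : x₂ < x₃)
    (hv : ∀ i j, τ i < τ j → π (![x₀, x₁, x₂, x₃] i) < π (![x₀, x₁, x₂, x₃] j)) :
    Contains τ π := by
  refine ⟨![x₀, x₁, x₂, x₃], ?_, fun i j => ⟨hv i j, fun h => ?_⟩⟩
  · rw [Fin.strictMono_iff_lt_succ]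
    intro i
    fin_cases i
    · exact h01
    · exact h12
    · exact h23
  · rcases lt_trichotomy (τ i) (τ j) with h' | h' | h'
    · exact h'
    · rw [τ.injective h'] at h; exact absurd h (lt_irrefl _)
    · exact absurd (hv _ _ h') h.asymm

lemma between_of_av {n : ℕ} {π : Perm (Fin n)} (h : π ∈ Av {⟨4, p3124⟩, ⟨4, p4312⟩} n)
    {c a b s : Fin n} (hca : c < a) (hab : a < b) (h1 : π a < π b) (h2 : π b < π c)
    (h3 : π c < π s) : c < s ∧ s < b := by
  have hA := h ⟨4, p3124⟩ (by simp)
  have hB := h ⟨4, p4312⟩ (by simp)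
  have hsc : s ≠ c := by rintro rfl; exact lt_irrefl _ h3
  have hsb : s ≠ b := by rintro rfl; exact lt_asymm h2 h3
  constructor
  · by_contra hc
    have hlt : s < c := lt_of_le_of_ne (not_lt.1 hc) hsc
    refine hB (contains_of_four hlt hca hab ?_)
    intro i j hij
    fin_cases i <;> fin_cases j <;> simp [p4312] at hij ⊢ <;>
      first
      | assumption
      | exact h2.trans h3
      | exact h1.trans h2
      | exact (h1.trans h2).trans h3
  · by_contra hc
    have hlt : b < s := lt_of_le_of_ne (not_lt.1 hc) hsb.symm
    refine hA (contains_of_four hca hab hlt ?_)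
    intro i j hij
    fin_cases i <;> fin_cases j <;> simp [p3124] at hij ⊢ <;>
      first
      | assumption
      | exact h2.trans h3
      | exact h1.trans h2
      | exact (h1.trans h2).trans h3

lemma simpleAvoider_of {n : ℕ} (hn : 3 ≤ n) {π : Perm (Fin n)}
    (hav : π ∈ Av {⟨4, p3124⟩, ⟨4, p4312⟩} n) (hs : IsSimple π) :
    SimpleAvoider n (toFun π) (toFun π.symm) := by
  have hinv : ∀ (σ : Perm (Fin n)) (i : ℕ), i < n → toFun σ.symm (toFun σ i) = i := by
    intro σ i hi
    rw [toFun_of_lt σ.symm (toFun_lt σ hi)]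
    simp [toFun_of_lt σ hi]
  refine ⟨hn, fun i hi => toFun_lt π hi, fun i hi => toFun_lt _ hi, hinv π, ?_, ?_, ?_⟩
  · intro v hv
    have := hinv π.symm v hv
    rwa [Equiv.symm_symm] at this
  · intro a b hab hb hne
    have hne' : Finset.Icc (⟨a, by omega⟩ : Fin n) ⟨b, hb⟩ ≠ Finset.univ := by
      intro h
      have h1 : (⟨0, by omega⟩ : Fin n) ∈ Finset.Icc (⟨a, by omega⟩ : Fin n) ⟨b, hb⟩ := by
        rw [h]; exact Finset.mem_univ _
      have h2 : (⟨n - 1, by omega⟩ : Fin n) ∈ Finset.Icc (⟨a, by omega⟩ : Fin n) ⟨b, hb⟩ := by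
        rw [h]; exact Finset.mem_univ _
      simp only [Finset.mem_Icc, Fin.mk_le_mk] at h1 h2
      omega
    obtain ⟨s, hs, i, hi, j, hj, h1, h2⟩ :=
      exists_separator hs (a := ⟨a, by omega⟩) (b := ⟨b, hb⟩) hab hne'
    simp only [Finset.mem_Icc, Fin.le_def] at hs hi hj
    refine ⟨s, s.2, by omega, i, j, hi.1, hi.2, hj.1, hj.2, ?_, ?_⟩
    · rw [toFun_of_lt π i.2, toFun_of_lt π s.2]; exact h1
    · rw [toFun_of_lt π j.2, toFun_of_lt π s.2]; exact h2
  · intro c a b s hca hab hb hs' h1 h2 h3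
    rw [toFun_of_lt π (by omega), toFun_of_lt π (by omega)] at h1 h2 h3
    exact between_of_av hav (c := ⟨c, by omega⟩) (a := ⟨a, by omega⟩) (b := ⟨b, hb⟩)
      (s := ⟨s, hs'⟩) hca hab h1 h2 h3

lemma exists_goodWord {n : ℕ} (hn : 3 ≤ n) {π : Perm (Fin n)}
    (hav : π ∈ Av {⟨4, p3124⟩, ⟨4, p4312⟩} n) (hs : IsSimple π) :
    ∃ w, GoodWord w ∧ Realizes π w := by
  have H := simpleAvoider_of hn hav hs
  obtain ⟨e₀, h1, h2, h3, h4, h5⟩ := H.exists_block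
  have HL : Layout n (toFun π) (toFun π.symm) e₀ := ⟨H, h1, h2, h3, h4, h5⟩
  obtain ⟨j₀, k, HF⟩ := HL.exists_frame
  refine ⟨wordOf (toFun π) (toFun π.symm) e₀ k, HF.goodWord,
    fun i => pointOf (toFun π) (toFun π.symm) e₀ k i, fun i => HF.pointOf_mem i.2, ?_, ?_, ?_⟩
  · intro x hx
    obtain ⟨i, hi, h⟩ := HF.pointOf_surj hx
    exact ⟨⟨i, hi⟩, h⟩
  · intro i j hij
    exact HF.pos_lt hij j.2
  · intro i j hij
    refine HF.val_lt i.2 j.2 ?_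
    rw [toFun_of_lt π i.2, toFun_of_lt π j.2]
    exact hij

end

/-! ### Uniqueness of the word, and the count -/

section

open Letter Kind
open Equiv (Perm)

/-- `x` is a left-to-right maximum among the points of `w`. -/
def LRPt (w : List Letter) (x : Pt) : Prop := ∀ y ∈ pts w, pos w y < pos w x → val w y < val w x

/-- `x` is not a left-to-right maximum and comes after the minimum; this characterizes kind `E` by
the relative order of the points. -/
def TailPt (w : List Letter) (x : Pt) : Prop :=
  ¬ LRPt w x ∧ ∃ z ∈ pts w, (∀ y ∈ pts w, ¬ val w y < val w z) ∧ pos w z < pos w x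

/-- `x` is a left-to-right maximum below the first point that is not one; this characterizes kind
`F` by the relative order of the points. -/
def HeadPt (w : List Letter) (x : Pt) : Prop :=
  LRPt w x ∧ ∃ y ∈ pts w, ¬ LRPt w y ∧ (∀ z ∈ pts w, ¬ LRPt w z → ¬ pos w z < pos w y) ∧
    val w x < val w y

/-- `x` is neither a left-to-right maximum nor after the minimum, and a smaller point that
is not a left-to-right maximum precedes it; this characterizes kind `U` by the relative
order of the points. -/
def UpPt (w : List Letter) (x : Pt) : Prop :=
  ¬ LRPt w x ∧ ¬ TailPt w x ∧ ∃ y ∈ pts w, ¬ LRPt w y ∧ pos w y < pos w x ∧ val w y < val w x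

section
variable {w : List Letter} (hw : GoodWord w)

include hw

lemma lrPt_iff {j : ℕ} {κ : Kind} (hx : (⟨j, κ⟩ : Pt) ∈ pts w) :
    LRPt w ⟨j, κ⟩ ↔ κ = M ∨ κ = F := by
  obtain ⟨j₀, hj₀, hbefore, hD, hdh, hu⟩ := hw.exists_first_d
  obtain ⟨h1, h2, h3, h4⟩ := hw.first_mh hj₀ hbefore
  have hjL := lt_of_mem_pts hx
  cases κ
  · simp only [true_or, iff_true]
    rintro ⟨i, κ⟩ hy hlt
    have hiL := lt_of_mem_pts hy
    cases κ <;> simp only [pos, val, Prod.Lex.toLex_lt_toLex] at hlt ⊢ <;> omega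
  · simp only [reduceCtorEq, or_self, iff_false]
    intro h
    have hj := hD j (mem_pts_D.1 hx)
    have := h ⟨0, M⟩ (mem_pts_M.2 hw.first) (by simp only [pos]; omega)
    simp only [val, Prod.Lex.toLex_lt_toLex] at this
    omega
  · simp only [reduceCtorEq, or_self, iff_false]
    intro h
    have hj := hu j (mem_pts_U.1 hx)
    have := h ⟨w.idxOf mh, M⟩ (mem_pts_M.2 (Or.inr h1)) (by simp only [pos]; omega)
    simp only [val, Prod.Lex.toLex_lt_toLex] at this
    omega
  · simp only [reduceCtorEq, or_self, iff_false]
    intro h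
    have := h ⟨j, M⟩ (mem_pts_M.2 (Or.inr (mem_pts_E.1 hx))) (by simp only [pos]; omega)
    simp only [val, Prod.Lex.toLex_lt_toLex] at this
    omega
  · simp only [or_true, iff_true]
    rintro ⟨i, κ⟩ hy hlt
    have hiL := lt_of_mem_pts hy
    cases κ <;> simp only [pos, val, Prod.Lex.toLex_lt_toLex] at hlt ⊢ <;> omega

lemma tailPt_iff {j : ℕ} {κ : Kind} (hx : (⟨j, κ⟩ : Pt) ∈ pts w) : TailPt w ⟨j, κ⟩ ↔ κ = E := by
  obtain ⟨jd, jm, hd, hm, hd', hm', hne, hdm, hu⟩ := hw.exists_last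
  have hjL := lt_of_mem_pts hx
  have hdL := lt_of_mem_pts (mem_pts_D.2 hd)
  have hmin : ∀ y ∈ pts w, ¬ val w y < val w ⟨jd, D⟩ := by
    rintro ⟨i, κ⟩ hy hlt
    cases κ <;> simp only [val, Prod.Lex.toLex_lt_toLex] at hlt
    · omega
    · have := hd' i (mem_pts_D.1 hy); omega
    · omega
    · omega
    · have := hd' i (Or.inr (mem_pts_F.1 hy)); omega
  rw [TailPt, lrPt_iff hw hx]
  constructor
  · rintro ⟨h1, z, hz, hzmin, hlt⟩
    obtain rfl : z = ⟨jd, D⟩ :=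
      val_injOn w hz (mem_pts_D.2 hd)
        (le_antisymm (not_lt.1 (hzmin _ (mem_pts_D.2 hd))) (not_lt.1 (hmin z hz)))
    cases κ <;> simp only [pos, reduceCtorEq, not_true_eq_false, true_or, or_true] at hlt h1 ⊢
    · have := hd' j (mem_pts_D.1 hx); omega
    · have := hu j (mem_pts_U.1 hx); omega
  · rintro rfl
    exact ⟨by simp, ⟨jd, D⟩, mem_pts_D.2 hd, hmin, by simp only [pos]; omega⟩

lemma headPt_iff {j : ℕ} {κ : Kind} (hx : (⟨j, κ⟩ : Pt) ∈ pts w) : HeadPt w ⟨j, κ⟩ ↔ κ = F := by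
  obtain ⟨j₀, hj₀, hbefore, hD, hdh, hu⟩ := hw.exists_first_d
  have hjL := lt_of_mem_pts hx
  have hj₀' : (⟨j₀, D⟩ : Pt) ∈ pts w := mem_pts_D.2 (Or.inl hj₀)
  have hjL₀ := lt_of_mem_pts hj₀'
  have hfirst : ∀ y ∈ pts w, ¬ LRPt w y → ¬ pos w y < pos w ⟨j₀, D⟩ := by
    rintro ⟨i, κ⟩ hy hn hlt
    have hiL := lt_of_mem_pts hy
    rw [lrPt_iff hw hy] at hn
    cases κ <;> simp [pos] at hlt hn
    · have := hD i (mem_pts_D.1 hy); omega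
    · have := hu i (mem_pts_U.1 hy); omega
    · omega
  have hj₀n : ¬ LRPt w ⟨j₀, D⟩ := by rw [lrPt_iff hw hj₀']; simp
  rw [HeadPt, lrPt_iff hw hx]
  constructor
  · rintro ⟨h1, y, hy, hyn, hymin, hlt⟩
    obtain rfl : y = ⟨j₀, D⟩ :=
      pos_injOn w hy hj₀' (le_antisymm (not_lt.1 (hymin _ hj₀' hj₀n)) (not_lt.1 (hfirst y hy hyn)))
    cases κ <;> simp only [val, Prod.Lex.toLex_lt_toLex, reduceCtorEq, or_self, true_or] at hlt h1 ⊢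
    omega
  · rintro rfl
    refine ⟨by simp, _, hj₀', hj₀n, hfirst, ?_⟩
    have := hdh j (mem_pts_F.1 hx)
    simp only [val, Prod.Lex.toLex_lt_toLex]
    omega

lemma upPt_iff {j : ℕ} {κ : Kind} (hx : (⟨j, κ⟩ : Pt) ∈ pts w) : UpPt w ⟨j, κ⟩ ↔ κ = U := by
  obtain ⟨j₀, hj₀, hbefore, hD, hdh, hu⟩ := hw.exists_first_d
  have hjL := lt_of_mem_pts hx
  rw [UpPt, lrPt_iff hw hx, tailPt_iff hw hx]
  constructor
  · rintro ⟨h1, h2, ⟨i, κ'⟩, hy, hyn, hp, hv⟩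
    have hiL := lt_of_mem_pts hy
    rw [lrPt_iff hw hy] at hyn
    cases κ <;> simp at h1 h2 ⊢
    cases κ' <;> simp only [pos, val, Prod.Lex.toLex_lt_toLex] at hp hv hyn <;>
      simp at hyn <;> omega
  · rintro rfl
    have hj₀' : (⟨j₀, D⟩ : Pt) ∈ pts w := mem_pts_D.2 (Or.inl hj₀)
    have := hu j (mem_pts_U.1 hx)
    refine ⟨by simp, by simp, _, hj₀', by rw [lrPt_iff hw hj₀']; simp, ?_, ?_⟩
    · simp only [pos]; omega
    · simp only [val, Prod.Lex.toLex_lt_toLex]; omega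

end

/-- The kinds of the entries in the main block. -/
def Kind.IsMain (κ : Kind) : Prop := κ = M ∨ κ = D ∨ κ = U

lemma exists_main {w : List Letter} {j : ℕ} (hj : j < w.length) :
    ∃ κ : Kind, κ.IsMain ∧ (⟨j, κ⟩ : Pt) ∈ pts w := by
  rcases letter_cases hj with h | h | h
  · exact ⟨M, Or.inl rfl, mem_pts_M.2 h⟩
  · exact ⟨D, Or.inr (Or.inl rfl), mem_pts_D.2 h⟩
  · exact ⟨U, Or.inr (Or.inr rfl), mem_pts_U.2 h⟩

lemma pos_main {w : List Letter} {κ : Kind} (h : κ.IsMain) (j : ℕ) :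
    pos w ⟨j, κ⟩ = j := by
  rcases h with rfl | rfl | rfl <;> rfl

/-- `R` relates the points of two words in a way that preserves positions and values, as happens
when the words have the same permutation. It is bijective, but `Matching.eq_of_rel` does not need
that in advance. -/
structure Matching (w w' : List Letter) (R : Pt → Pt → Prop) : Prop where
  mem : ∀ x y, R x y → x ∈ pts w ∧ y ∈ pts w'
  left : ∀ x ∈ pts w, ∃ y, R x y
  right : ∀ y ∈ pts w', ∃ x, R x y
  pos_iff : ∀ x y x' y', R x y → R x' y' → (pos w x < pos w x' ↔ pos w' y < pos w' y')
  val_iff : ∀ x y x' y', R x y → R x' y' → (val w x < val w x' ↔ val w' y < val w' y')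

namespace Matching

variable {w w' : List Letter} {R : Pt → Pt → Prop}

lemma symm (h : Matching w w' R) : Matching w' w (fun x y => R y x) where
  mem x y hr := (h.mem y x hr).symm
  left := h.right
  right := h.left
  pos_iff x y x' y' h1 h2 := (h.pos_iff y x y' x' h1 h2).symm
  val_iff x y x' y' h1 h2 := (h.val_iff y x y' x' h1 h2).symm

lemma lrPt_imp (h : Matching w w' R) {x y : Pt} (hr : R x y) (hx : LRPt w x) : LRPt w' y := by
  intro y' hy' hlt
  obtain ⟨x', hr'⟩ := h.right y' hy'
  exact (h.val_iff _ _ _ _ hr' hr).1 (hx x' (h.mem _ _ hr').1 ((h.pos_iff _ _ _ _ hr' hr).2 hlt))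

lemma lrPt_iff (h : Matching w w' R) {x y : Pt} (hr : R x y) : LRPt w x ↔ LRPt w' y :=
  ⟨h.lrPt_imp hr, h.symm.lrPt_imp hr⟩

lemma tailPt_imp (h : Matching w w' R) {x y : Pt} (hr : R x y) (hx : TailPt w x) :
    TailPt w' y := by
  obtain ⟨h1, z, hz, hmin, hlt⟩ := hx
  obtain ⟨z', hz'⟩ := h.left z hz
  refine ⟨by rwa [← h.lrPt_iff hr], z', (h.mem _ _ hz').2, fun v hv hc => ?_,
    (h.pos_iff _ _ _ _ hz' hr).1 hlt⟩
  obtain ⟨v', hv'⟩ := h.right v hv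
  exact hmin v' (h.mem _ _ hv').1 ((h.val_iff _ _ _ _ hv' hz').2 hc)

lemma tailPt_iff (h : Matching w w' R) {x y : Pt} (hr : R x y) : TailPt w x ↔ TailPt w' y :=
  ⟨h.tailPt_imp hr, h.symm.tailPt_imp hr⟩

lemma headPt_imp (h : Matching w w' R) {x y : Pt} (hr : R x y) (hx : HeadPt w x) :
    HeadPt w' y := by
  obtain ⟨h1, z, hz, hzn, hmin, hlt⟩ := hx
  obtain ⟨z', hz'⟩ := h.left z hz
  refine ⟨by rwa [← h.lrPt_iff hr], z', (h.mem _ _ hz').2, by rwa [← h.lrPt_iff hz'],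
    fun v hv hvn hc => ?_, (h.val_iff _ _ _ _ hr hz').1 hlt⟩
  obtain ⟨v', hv'⟩ := h.right v hv
  exact hmin v' (h.mem _ _ hv').1 (by rwa [h.lrPt_iff hv']) ((h.pos_iff _ _ _ _ hv' hz').2 hc)

lemma headPt_iff (h : Matching w w' R) {x y : Pt} (hr : R x y) : HeadPt w x ↔ HeadPt w' y :=
  ⟨h.headPt_imp hr, h.symm.headPt_imp hr⟩

lemma upPt_imp (h : Matching w w' R) {x y : Pt} (hr : R x y) (hx : UpPt w x) : UpPt w' y := by
  obtain ⟨h1, h2, z, hz, hzn, hp, hv⟩ := hx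
  obtain ⟨z', hz'⟩ := h.left z hz
  exact ⟨by rwa [← h.lrPt_iff hr], by rwa [← h.tailPt_iff hr], z', (h.mem _ _ hz').2,
    by rwa [← h.lrPt_iff hz'], (h.pos_iff _ _ _ _ hz' hr).1 hp, (h.val_iff _ _ _ _ hz' hr).1 hv⟩

lemma upPt_iff (h : Matching w w' R) {x y : Pt} (hr : R x y) : UpPt w x ↔ UpPt w' y :=
  ⟨h.upPt_imp hr, h.symm.upPt_imp hr⟩

lemma kind_eq (h : Matching w w' R) (hw : GoodWord w) (hw' : GoodWord w') {i j : ℕ} {κ κ' : Kind}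
    (hr : R ⟨i, κ⟩ ⟨j, κ'⟩) : κ = κ' := by
  obtain ⟨hx, hy⟩ := h.mem _ _ hr
  have h1 := h.lrPt_iff hr
  have h2 := h.tailPt_iff hr
  have h3 := h.headPt_iff hr
  have h4 := h.upPt_iff hr
  rw [SimpleAv.lrPt_iff hw hx, SimpleAv.lrPt_iff hw' hy] at h1
  rw [SimpleAv.tailPt_iff hw hx, SimpleAv.tailPt_iff hw' hy] at h2
  rw [SimpleAv.headPt_iff hw hx, SimpleAv.headPt_iff hw' hy] at h3
  rw [SimpleAv.upPt_iff hw hx, SimpleAv.upPt_iff hw' hy] at h4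
  cases κ <;> cases κ' <;> simp at h1 h2 h3 h4 ⊢

/-- Related points of the main block have the same index, since each index carries exactly one
point of the main block and positions there are indices. -/
lemma index_eq (h : Matching w w' R) (hw : GoodWord w) (hw' : GoodWord w') {i j : ℕ} {κ : Kind}
    (hκ : κ.IsMain) (hr : R ⟨i, κ⟩ ⟨j, κ⟩) : i = j := by
  induction i using Nat.strong_induction_on generalizing j κ with
  | _ i ih =>
  obtain ⟨hx, hy⟩ := h.mem _ _ hr
  have hiL := lt_of_mem_pts hx
  have hjL := lt_of_mem_pts hy
  rcases lt_trichotomy i j with hij | hij | hij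
  · obtain ⟨κ', hκ', hm⟩ := exists_main (w := w') (j := i) (by omega)
    obtain ⟨⟨l, κ''⟩, hr'⟩ := h.right _ hm
    obtain rfl := h.kind_eq hw hw' hr'
    have h1 := h.pos_iff _ _ _ _ hr' hr
    simp only [pos_main hκ, pos_main hκ'] at h1
    have := ih l (by omega) hκ' hr'
    omega
  · exact hij
  · obtain ⟨κ', hκ', hm⟩ := exists_main (w := w) (j := j) (by omega)
    obtain ⟨⟨l, κ''⟩, hr'⟩ := h.left _ hm
    obtain rfl := h.kind_eq hw hw' hr'
    have h1 := h.pos_iff _ _ _ _ hr' hr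
    simp only [pos_main hκ, pos_main hκ'] at h1
    have := ih j hij hκ' hr'
    omega

lemma index_E_le (h : Matching w w' R) (hw : GoodWord w) (hw' : GoodWord w') {i j : ℕ}
    (hr : R ⟨i, E⟩ ⟨j, E⟩) : j ≤ i := by
  obtain ⟨hx, -⟩ := h.mem _ _ hr
  obtain ⟨⟨l, κ⟩, hr'⟩ := h.left ⟨i, M⟩ (mem_pts_M.2 (Or.inr (mem_pts_E.1 hx)))
  obtain rfl := h.kind_eq hw hw' hr'
  obtain rfl := h.index_eq hw hw' (Or.inl rfl) hr'
  have h1 := h.val_iff _ _ _ _ hr hr'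
  simp only [val, Prod.Lex.toLex_lt_toLex] at h1
  omega

lemma index_F_le (h : Matching w w' R) (hw : GoodWord w) (hw' : GoodWord w') {i j : ℕ}
    (hr : R ⟨i, F⟩ ⟨j, F⟩) : j ≤ i := by
  obtain ⟨hx, -⟩ := h.mem _ _ hr
  obtain ⟨⟨l, κ⟩, hr'⟩ := h.left ⟨i, D⟩ (mem_pts_D.2 (Or.inr (mem_pts_F.1 hx)))
  obtain rfl := h.kind_eq hw hw' hr'
  obtain rfl := h.index_eq hw hw' (Or.inr (Or.inl rfl)) hr'
  have h1 := h.val_iff _ _ _ _ hr' hr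
  simp only [val, Prod.Lex.toLex_lt_toLex] at h1
  omega

/-- A matching between good words relates each point only to itself. -/
lemma eq_of_rel (h : Matching w w' R) (hw : GoodWord w) (hw' : GoodWord w') {x y : Pt}
    (hr : R x y) : x = y := by
  obtain ⟨i, κ⟩ := x
  obtain ⟨j, κ'⟩ := y
  obtain rfl := h.kind_eq hw hw' hr
  have : i = j := by
    cases κ
    · exact h.index_eq hw hw' (Or.inl rfl) hr
    · exact h.index_eq hw hw' (Or.inr (Or.inl rfl)) hr
    · exact h.index_eq hw hw' (Or.inr (Or.inr rfl)) hr
    · exact le_antisymm (h.symm.index_E_le hw' hw hr) (h.index_E_le hw hw' hr)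
    · exact le_antisymm (h.symm.index_F_le hw' hw hr) (h.index_F_le hw hw' hr)
  rw [this]

end Matching

lemma eq_of_pts_eq {w w' : List Letter} (h : pts w = pts w') : w = w' := by
  refine List.ext_getElem? fun j => ?_
  have hk : kindsAt w j = kindsAt w' j := by
    ext κ
    rw [← mem_pts, ← mem_pts, h]
  revert hk
  simp only [kindsAt]
  generalize w[j]? = a
  generalize w'[j]? = b
  cases a with
  | none => cases b with
    | none => simp
    | some b => cases b <;> simp only [kinds] <;> decide
  | some a => cases b with
    | none => cases a <;> simp [kinds]
    | some b => cases a <;> cases b <;> simp [kinds] <;> decide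

/-- A permutation has at most one good word. -/
lemma Realizes.word_unique {n : ℕ} {π : Perm (Fin n)} {w w' : List Letter} (hw : GoodWord w)
    (hw' : GoodWord w') (h : Realizes π w) (h' : Realizes π w') : w = w' := by
  obtain ⟨g, g1, g2, g3, g4⟩ := h
  obtain ⟨f, f1, f2, f3, f4⟩ := h'
  have aux : ∀ {v : List Letter} {g : Fin n → Pt},
      (∀ i j, π i < π j → val v (g i) < val v (g j)) →
      ∀ i j, (π i < π j ↔ val v (g i) < val v (g j)) := by
    intro v g hg i j
    refine ⟨hg i j, fun hlt => ?_⟩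
    rcases lt_trichotomy (π i) (π j) with h | h | h
    · exact h
    · rw [π.injective h] at hlt; exact absurd hlt (lt_irrefl _)
    · exact absurd (hg _ _ h) hlt.asymm
  have hM : Matching w w' (fun x y => ∃ i, g i = x ∧ f i = y) := by
    refine ⟨?_, ?_, ?_, ?_, ?_⟩
    · rintro _ _ ⟨i, rfl, rfl⟩; exact ⟨g1 i, f1 i⟩
    · intro x hx
      obtain ⟨i, rfl⟩ := g2 x hx
      exact ⟨_, i, rfl, rfl⟩
    · intro x hx
      obtain ⟨i, rfl⟩ := f2 x hx
      exact ⟨_, i, rfl, rfl⟩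
    · rintro _ _ _ _ ⟨i, rfl, rfl⟩ ⟨j, rfl, rfl⟩
      exact (g3.lt_iff_lt (a := i) (b := j)).trans (f3.lt_iff_lt (a := i) (b := j)).symm
    · rintro _ _ _ _ ⟨i, rfl, rfl⟩ ⟨j, rfl, rfl⟩
      rw [← aux g4, ← aux f4]
  refine eq_of_pts_eq (Finset.Subset.antisymm ?_ ?_)
  · intro x hx
    obtain ⟨i, rfl⟩ := g2 x hx
    rw [hM.eq_of_rel hw hw' ⟨i, rfl, rfl⟩]
    exact f1 i
  · intro x hx
    obtain ⟨i, rfl⟩ := f2 x hx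
    rw [← hM.eq_of_rel hw hw' ⟨i, rfl, rfl⟩]
    exact g1 i

open PermPattern

lemma ncard_simple_of_three_le {n : ℕ} (hn : 3 ≤ n) :
    (Si (Av {⟨4, p3124⟩, ⟨4, p4312⟩}) n).ncard = cnt State.s0 n := by
  rw [← ncard_goodWord]
  symm
  choose π hπ using fun w : {w // GoodWord w ∧ weight w = n} => exists_realizes w.2.2
  refine Set.ncard_congr (fun w hw => π ⟨w, hw⟩) ?_ ?_ ?_
  · intro w hw
    exact ⟨(hπ ⟨w, hw⟩).mem_av hw.1, (hπ ⟨w, hw⟩).isSimple hw.1⟩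
  · intro w w' hw hw' h
    have h1 := hπ ⟨w, hw⟩
    have h2 := hπ ⟨w', hw'⟩
    rw [h] at h1
    exact h1.word_unique hw.1 hw'.1 h2
  · rintro σ ⟨h1, h2⟩
    obtain ⟨w, hw, hσ⟩ := exists_goodWord hn h1 h2
    exact ⟨w, ⟨hw, hσ.weight_eq⟩, (hπ ⟨w, hw, hσ.weight_eq⟩).perm_unique hσ⟩

lemma three_le_weight {w : List Letter} (hw : GoodWord w) : 3 ≤ weight w := by
  obtain ⟨j₀, hj₀, hbefore, hD, hdh, hu⟩ := hw.exists_first_d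
  obtain ⟨h1, h2, h3, h4⟩ := hw.first_mh hj₀ hbefore
  rw [← card_pts]
  have hsub : ({⟨w.idxOf mh, M⟩, ⟨w.idxOf mh, E⟩, ⟨j₀, D⟩} : Finset Pt) ⊆ pts w := by
    intro x hx
    simp only [Finset.mem_insert, Finset.mem_singleton] at hx
    rcases hx with rfl | rfl | rfl
    · exact mem_pts_M.2 (Or.inr h1)
    · exact mem_pts_E.2 h1
    · exact mem_pts_D.2 (Or.inl hj₀)
  refine le_trans (le_of_eq ?_) (Finset.card_le_card hsub)
  rw [Finset.card_eq_three.2 ⟨_, _, _, ?_, ?_, ?_, rfl⟩] <;> simp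

lemma cnt_eq_zero {n : ℕ} (hn : n < 3) : cnt State.s0 n = 0 := by
  rw [← ncard_goodWord]
  have : {w | GoodWord w ∧ weight w = n} = ∅ := by
    ext w
    simp only [Set.mem_ofPred_eq, Set.mem_empty_iff_false, iff_false, not_and]
    intro hw h
    have := three_le_weight hw
    omega
  simp [this]

lemma mem_simple_of_le_two {n : ℕ} (hn : n ≤ 2) (π : Perm (Fin n)) :
    π ∈ Si (Av {⟨4, p3124⟩, ⟨4, p4312⟩}) n := by
  constructor
  · rintro τ hτ ⟨f, hf, -⟩
    have h4 : τ.1 = 4 := by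
      simp only [Set.mem_insert_iff, Set.mem_singleton_iff] at hτ
      rcases hτ with rfl | rfl <;> rfl
    have := Fintype.card_le_of_injective f hf.injective
    simp only [Fintype.card_fin] at this
    omega
  · intro I hI
    have h1 := hI.1.card_pos
    have h2 := Finset.card_le_univ I
    rw [Fintype.card_fin] at h2
    omega

lemma ncard_simple_of_le_two {n : ℕ} (hn : n ≤ 2) :
    (Si (Av {⟨4, p3124⟩, ⟨4, p4312⟩}) n).ncard = n.factorial := by
  have : Si (Av {⟨4, p3124⟩, ⟨4, p4312⟩}) n = Set.univ :=
    Set.eq_univ_of_forall (mem_simple_of_le_two hn)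
  rw [this, Set.ncard_univ, Nat.card_eq_fintype_card, Fintype.card_perm, Fintype.card_fin]

open PowerSeries in
lemma genFun_eq : genFun (Si (Av {⟨4, p3124⟩, ⟨4, p4312⟩})) = X + 2 * X ^ 2 + gf State.s0 := by
  have h2 : (2 : PowerSeries ℚ) = C 2 := (map_ofNat C 2).symm
  ext n
  rw [genFun, coeff_mk, map_add, map_add, h2, coeff_C_mul, coeff_X, coeff_X_pow, gf, coeff_mk]
  rcases Nat.lt_or_ge n 3 with h | h
  · rw [cnt_eq_zero h, ncard_simple_of_le_two (by omega)]
    interval_cases n <;> simp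
  · rw [ncard_simple_of_three_le h]
    simp [show n ≠ 0 by omega, show n ≠ 1 by omega, show n ≠ 2 by omega]

end

end SimpleAv

theorem theorem8p1 :
    PermPattern.genFun
        (PermPattern.Si (PermPattern.Av {⟨4, PermPattern.p3124⟩, ⟨4, PermPattern.p4312⟩})) =
      ((PowerSeries.X - 2 * PowerSeries.X ^ 2 - 5 * PowerSeries.X ^ 3 + 12 * PowerSeries.X ^ 4
          + PowerSeries.X ^ 5 - 8 * PowerSeries.X ^ 6 - 3 * PowerSeries.X ^ 7) *
        ((1 - 2 * PowerSeries.X) * (1 - PowerSeries.X - PowerSeries.X ^ 2) ^ 2)⁻¹ :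
          PowerSeries ℚ) := by
  rw [PowerSeries.eq_mul_inv_iff_mul_eq (by simp), SimpleAv.genFun_eq]
  linear_combination SimpleAv.gf_s0_mul
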